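/- Let $\Gamma<\mathrm{SL}(2,\mathbb R)$ be a discrete subgroup such that $M=\Gamma\backslash \mathrm{SL}(2,\mathbb R)$ is compact, and let $\mathrm{vol}$ be the probability measure on $M$ locally given by Haar measure. Let $$U=\begin{pmatrix}0&1\\0&0\end{pmatrix},\quad X=\begin{pmatrix}1/2&0\\0&-1/2\end{pmatrix},\quad V=\begin{pmatrix}0&0\\1&0\end{pmatrix},$$ and let $h_t(x)=x\exp(tU)$ (stable horocycle flow), $\phi^X_t(x)=x\exp(tX)$ (geodesic flow) and $h^{\mathrm{un}}_t(x)=x\exp(tV)$ be the corresponding flows on $M$. Denote by $Uf, Xf, Vf$ the derivatives of $f$ along these flows, let $\square=-X^2+X-UV$ be the Casimir operator, and let $\|f\|_{\mathscr C^2}$ be the maximum of $\|f\|_\infty$, $\|Wf\|_\infty$, $\|WW'f\|_\infty$ over $W,W'\in\{U,X,V\}$. Hölder continuity on $M$ is with respect to the Riemannian distance for which $(U,X,V)$ is an orthonormal frame. Let $f\in\mathscr C^2(M)$ (complex valued) satisfy $\square f=\mu f$ with $\mu\in\mathbb R$, and $\int_M f\,d\mathrm{vol}=0$. Let $\nu\in\mathbb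 R_{\ge0}\cup i\mathbb R_{>0}$ be such that $(1-\nu^2)/4=\mu$. For $x\in M$, $T\ge1$ and $\xi\ge 0$ put $$A_f(x,T)=\frac1T\int_0^T f(h_t x)\,dt,\qquad G(x,\xi)=Vf(\phi^X_{-\xi}x)-Vf(\phi^X_{-\xi}h_1x),\qquad I_\ell(x)=\int_0^1 \ell(h_sx)\,ds,\qquad x_T=\phi^X_{\log T}(x).$$ (i) If $\mu>1/4$, the functions $$\mathcal D^+_\mu f(x)=-\frac{2}{\Im\nu}\int_0^\infty e^{-\xi/2}\sin\Big(\frac{\Im\nu}2\xi\Big)G(x,\xi)\,d\xi+I_f(x),$$ $$\mathcal D^-_\mu f(x)=\frac{2}{\Im\nu}\int_0^\infty e^{-\xi/2}\cos\Big(\frac{\Im\nu}2\xi\Big)G(x,\xi)\,d\xi+\frac1{\Im\nu}I_f(x)-\frac2{\Im\nu}I_{Xf}(x)$$ are Hölder continuous with exponent $1/2$, satisfy $\|\mathcal D^\pm_\mu f\|_\infty\le\left(\frac{11}{\Im\nu}+1\right)\|f\|_{\mathscr C^2}$, and for all $x\in M$, $T\ge1$, $$A_f(x,T)=T^{-1/2}\cos\Big(\frac{\Im\nu}2\log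 T\Big)\mathcal D^+_\mu f(x_T)+T^{-1/2}\sin\Big(\frac{\Im\nu}2\log T\Big)\mathcal D^-_\mu f(x_T)+\mathcal R_\mu f(x,T),\quad |\mathcal R_\mu f(x,T)|\le\frac{16}{\Im\nu}\|f\|_{\mathscr C^2}T^{-1}.$$ Moreover $|A_f(x,T)|\le\frac{15(\log T+1)}{\sqrt T}\|f\|_{\mathscr C^2}$. (ii) If $\mu=1/4$, the functions $$\mathcal D^+_{1/4}f(x)=-\int_0^\infty\xi e^{-\xi/2}G(x,\xi)\,d\xi+I_f(x),\qquad \mathcal D^-_{1/4}f(x)=\int_0^\infty e^{-\xi/2}G(x,\xi)\,d\xi+\tfrac12I_f(x)-I_{Xf}(x)$$ are Hölder continuous, $\mathcal D^+_{1/4}f$ with exponent $1/2-\varepsilon$ for every $0<\varepsilon<1/2$ and $\mathcal D^-_{1/4}f$ with exponent $1/2$, satisfy $\|\mathcal D^\pm_{1/4}f\|_\infty\le9\|f\|_{\mathscr C^2}$, and for all $x\in M$, $T\ge1$, $$A_f(x,T)=T^{-1/2}\mathcal D^+_{1/4}f(x_T)+T^{-1/2}\log T\,\mathcal D^-_{1/4}f(x_T)+\mathcal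 R_{1/4}f(x,T),\quad|\mathcal R_{1/4}f(x,T)|\le8\,\frac{\log T+2}{T}\|f\|_{\mathscr C^2}.$$ (iii) If $0<\mu<1/4$, the functions $$\mathcal D^\pm_\mu f(x)=\mp\frac1\nu\int_0^\infty e^{-\frac{1\mp\nu}2\xi}G(x,\xi)\,d\xi\mp\frac{1\mp\nu}{2\nu}I_f(x)\pm\frac1\nu I_{Xf}(x)$$ are Hölder continuous with exponent $\frac{1\mp\nu}2$, satisfy $\|\mathcal D^\pm_\mu f\|_\infty\le\frac6{\nu(1-\nu)}\|f\|_{\mathscr C^2}$, and for all $x\in M$, $T\ge1$, $$A_f(x,T)=T^{-\frac{1+\nu}2}\mathcal D^+_\mu f(x_T)+T^{-\frac{1-\nu}2}\mathcal D^-_\mu f(x_T)+\mathcal R_\mu f(x,T),\quad|\mathcal R_\mu f(x,T)|\le\frac8{(1-\nu^2)\nu}\|f\|_{\mathscr C^2}T^{-1}.$$ Moreover $|A_f(x,T)|\le\frac{15}{(1-\nu)^2}\|f\|_{\mathscr C^2}(\log T+1)T^{-\frac{1-\nu}2}$. (iv) If $\mu=0$, then for all $x\in M$, $T\ge1$, $$\left|A_f(x,T)-\frac1T\int_0^{\log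 T}\Big(Vf(\phi^X_\xi h_Tx)-Vf(\phi^X_\xi x)\Big)d\xi\right|\le\frac3T\|f\|_{\mathscr C^2}.$$ (v) If $\mu<0$, then $|A_f(x,T)|\le\frac5T\|f\|_{\mathscr C^2}$ for all $x\in M$, $T\ge1$, and $f$ is a continuous coboundary: there is a continuous function $u$ on $M$ such that $f=Uu$, that is, $\frac{d}{dt}\big|_{t=0}u(h_tx)=f(x)$ for every $x\in M$. -/

import Mathlib

open MeasureTheory

namespace HorocycleFlow

/-- The group of real `2 × 2` matrices of determinant one. -/
abbrev SL2R : Type := Matrix.SpecialLinearGroup (Fin 2) ℝ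

instance instMeasurableSpaceSL2R : MeasurableSpace SL2R := borel SL2R

instance instBorelSpaceSL2R : BorelSpace SL2R := ⟨rfl⟩

instance instLocallyCompactSpaceSL2R : LocallyCompactSpace SL2R :=
  haveI : LocallyCompactSpace (Matrix (Fin 2) (Fin 2) ℝ) :=
    inferInstanceAs (LocallyCompactSpace (Fin 2 → Fin 2 → ℝ))
  Matrix.SpecialLinearGroup.isClosedEmbedding_val.locallyCompactSpace

/-- `exp (t U)`, with `U = !![0, 1; 0, 0]`. -/
noncomputable def expU (t : ℝ) : SL2R :=
  ⟨!![1, t; 0, 1], by simp [Matrix.det_fin_two]⟩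

/-- `exp (t X)`, with `X = !![1/2, 0; 0, -1/2]`. -/
noncomputable def expX (t : ℝ) : SL2R :=
  ⟨!![Real.exp (t / 2), 0; 0, Real.exp (-t / 2)], by
    rw [Matrix.det_fin_two_of, ← Real.exp_add, mul_zero, sub_zero, neg_div, add_neg_cancel,
      Real.exp_zero]⟩

/-- `exp (t V)`, with `V = !![0, 0; 1, 0]`. -/
noncomputable def expV (t : ℝ) : SL2R :=
  ⟨!![1, 0; t, 1], by simp [Matrix.det_fin_two]⟩

/-- The space `M = Γ \ SL(2, ℝ)` of cosets `Γ g`, with the quotient topology and the quotient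
`σ`-algebra. -/
abbrev HomSpace (Γ : Subgroup SL2R) : Type := Quotient (QuotientGroup.rightRel Γ)

variable {Γ : Subgroup SL2R}

/-- The projection `g ↦ Γ g`. -/
def proj (Γ : Subgroup SL2R) (g : SL2R) : HomSpace Γ := Quotient.mk (QuotientGroup.rightRel Γ) g

/-- The right action `Γ g ↦ Γ g k` of `k` on `M`. -/
def rightMul (k : SL2R) : HomSpace Γ → HomSpace Γ :=
  Quotient.map (fun g => g * k) (fun a b hab => by
    have h : QuotientGroup.rightRel Γ a b := hab
    change QuotientGroup.rightRel Γ (a * k) (b * k)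
    rw [QuotientGroup.rightRel_apply] at h ⊢
    simpa [mul_assoc] using h)

/-- The stable horocycle flow `h_t`. -/
noncomputable def horo (t : ℝ) (x : HomSpace Γ) : HomSpace Γ := rightMul (expU t) x

/-- The geodesic flow `φ^X_t`. -/
noncomputable def geo (t : ℝ) (x : HomSpace Γ) : HomSpace Γ := rightMul (expX t) x

/-- The unstable horocycle flow `h^un_t`. -/
noncomputable def horoUn (t : ℝ) (x : HomSpace Γ) : HomSpace Γ := rightMul (expV t) x

/-- The derivative of `f` along a flow. -/
noncomputable def flowDeriv (φ : ℝ → HomSpace Γ → HomSpace Γ) (f : HomSpace Γ → ℂ) :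
    HomSpace Γ → ℂ :=
  fun x => deriv (fun t => f (φ t x)) 0

/-- `U f`. -/
noncomputable def derivU (f : HomSpace Γ → ℂ) : HomSpace Γ → ℂ := flowDeriv horo f

/-- `X f`. -/
noncomputable def derivX (f : HomSpace Γ → ℂ) : HomSpace Γ → ℂ := flowDeriv geo f

/-- `V f`. -/
noncomputable def derivV (f : HomSpace Γ → ℂ) : HomSpace Γ → ℂ := flowDeriv horoUn f

/-- `f` is of class `C^2` on `M`. For every `x = Γ g`, the smooth map
`(a, b, c) ↦ Γ g exp (a U) exp (b X) exp (c V)` restricts to a diffeomorphism from a neighbourhood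
of the origin onto a neighbourhood of `x`, so that its local inverses form an atlas of `M`;
`f` is required to be `C^2` in these coordinates. -/
def IsC2 (f : HomSpace Γ → ℂ) : Prop :=
  ∀ x : HomSpace Γ,
    ContDiff ℝ 2 (fun p : ℝ × ℝ × ℝ => f (horoUn p.2.2 (geo p.2.1 (horo p.1 x))))

/-- The Casimir operator `□ = -X² + X - U V`. -/
noncomputable def casimir (f : HomSpace Γ → ℂ) : HomSpace Γ → ℂ :=
  fun x => -derivX (derivX f) x + derivX f x - derivU (derivV f) x

/-- The supremum norm. -/
noncomputable def supNorm (f : HomSpace Γ → ℂ) : ℝ := ⨆ x, ‖f x‖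

/-- The frame `(U, X, V)`, as differential operators. -/
noncomputable def frame (i : Fin 3) : (HomSpace Γ → ℂ) → HomSpace Γ → ℂ :=
  ![derivU, derivX, derivV] i

/-- The `C^2` norm: the maximum of the supremum norms of `f`, of its derivatives `W f`, and of its
derivatives `W W' f`, where `W` and `W'` range over `U, X, V`. -/
noncomputable def c2Norm (f : HomSpace Γ → ℂ) : ℝ :=
  max (supNorm f)
    (max (⨆ i : Fin 3, supNorm (frame i f))
      (⨆ p : Fin 3 × Fin 3, supNorm (frame p.1 (frame p.2 f))))

/-- The measure on `M` which is locally given by the Haar measure of `SL(2, ℝ)`: the smallest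
measure that dominates the image under the projection of the Haar measure on every measurable set
on which the projection is injective. It equals the image of the Haar measure on any measurable
strict fundamental domain of `Γ`. -/
noncomputable def haarQuotient (Γ : Subgroup SL2R) : Measure (HomSpace Γ) :=
  ⨆ W : {W : Set SL2R // MeasurableSet W ∧ Set.InjOn (proj Γ) W},
    Measure.map (proj Γ) ((Measure.haar : Measure SL2R).restrict W.1)

/-- The normalised volume on `M`. -/
noncomputable def vol (Γ : Subgroup SL2R) : Measure (HomSpace Γ) :=
  (haarQuotient Γ Set.univ)⁻¹ • haarQuotient Γ

/-- The matrix `σ(t)⁻¹ σ'(t)` for a curve `σ` in `SL(2, ℝ)`. -/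
noncomputable def velocity (σ : ℝ → SL2R) (t : ℝ) : Matrix (Fin 2) (Fin 2) ℝ :=
  ((σ t)⁻¹ : SL2R).1 * Matrix.of fun i j => deriv (fun s => (σ s).1 i j) t

/-- The norm of `a U + b X + c V = !![b/2, a; c, -b/2]` for the inner product which makes
`(U, X, V)` orthonormal. -/
noncomputable def frameNorm (A : Matrix (Fin 2) (Fin 2) ℝ) : ℝ :=
  Real.sqrt (A 0 1 ^ 2 + (2 * A 0 0) ^ 2 + A 1 0 ^ 2)

/-- The Riemannian distance on `M`, for the metric in which `(U, X, V)` is an orthonormal frame: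
the infimum of the lengths of the `C^1` curves from `x` to `y` (all of which lift to
`SL(2, ℝ)`). -/
noncomputable def riemDist (x y : HomSpace Γ) : ℝ :=
  sInf {L : ℝ | ∃ σ : ℝ → SL2R, (∀ i j, ContDiff ℝ 1 (fun t => (σ t).1 i j)) ∧
    proj Γ (σ 0) = x ∧ proj Γ (σ 1) = y ∧ L = ∫ t in (0 : ℝ)..1, frameNorm (velocity σ t)}

/-- Hölder continuity with exponent `a`. -/
def IsHolder (a : ℝ) (D : HomSpace Γ → ℂ) : Prop :=
  ∃ C : ℝ, ∀ x y : HomSpace Γ, ‖D x - D y‖ ≤ C * riemDist x y ^ a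

/-- The horocycle average `T⁻¹ ∫_0^T f (h_t x) dt`. -/
noncomputable def horoAverage (f : HomSpace Γ → ℂ) (x : HomSpace Γ) (T : ℝ) : ℂ :=
  (1 / T) • ∫ t in (0 : ℝ)..T, f (horo t x)

/-- `G_f(x, ξ) = V f (φ^X_{-ξ} x) - V f (φ^X_{-ξ} h_1 x)`. -/
noncomputable def gFun (f : HomSpace Γ → ℂ) (x : HomSpace Γ) (ξ : ℝ) : ℂ :=
  derivV f (geo (-ξ) x) - derivV f (geo (-ξ) (horo 1 x))

/-- `∫_0^1 f (h_s x) ds`. -/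
noncomputable def unitInt (f : HomSpace Γ → ℂ) (x : HomSpace Γ) : ℂ :=
  ∫ s in (0 : ℝ)..1, f (horo s x)

/-- The coefficient `D^+_μ f` for `μ > 1/4`, where `y = Im ν`. -/
noncomputable def princPlus (y : ℝ) (f : HomSpace Γ → ℂ) (x : HomSpace Γ) : ℂ :=
  -((2 / y) • ∫ ξ in Set.Ioi (0 : ℝ), (Real.exp (-ξ / 2) * Real.sin (y / 2 * ξ)) • gFun f x ξ)
    + unitInt f x

/-- The coefficient `D^-_μ f` for `μ > 1/4`, where `y = Im ν`. -/
noncomputable def princMinus (y : ℝ) (f : HomSpace Γ → ℂ) (x : HomSpace Γ) : ℂ :=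
  (2 / y) • (∫ ξ in Set.Ioi (0 : ℝ), (Real.exp (-ξ / 2) * Real.cos (y / 2 * ξ)) • gFun f x ξ)
    + (1 / y) • unitInt f x - (2 / y) • unitInt (derivX f) x

/-- The coefficient `D^+_{1/4} f`. -/
noncomputable def quarterPlus (f : HomSpace Γ → ℂ) (x : HomSpace Γ) : ℂ :=
  -(∫ ξ in Set.Ioi (0 : ℝ), (ξ * Real.exp (-ξ / 2)) • gFun f x ξ) + unitInt f x

/-- The coefficient `D^-_{1/4} f`. -/
noncomputable def quarterMinus (f : HomSpace Γ → ℂ) (x : HomSpace Γ) : ℂ :=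
  (∫ ξ in Set.Ioi (0 : ℝ), Real.exp (-ξ / 2) • gFun f x ξ)
    + (1 / 2 : ℝ) • unitInt f x - unitInt (derivX f) x

/-- The coefficient `D^+_μ f` for `0 < μ < 1/4`, where `n = ν`. -/
noncomputable def compPlus (n : ℝ) (f : HomSpace Γ → ℂ) (x : HomSpace Γ) : ℂ :=
  -((1 / n) • ∫ ξ in Set.Ioi (0 : ℝ), Real.exp (-((1 - n) / 2 * ξ)) • gFun f x ξ)
    - ((1 - n) / (2 * n)) • unitInt f x + (1 / n) • unitInt (derivX f) x

/-- The coefficient `D^-_μ f` for `0 < μ < 1/4`, where `n = ν`. -/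
noncomputable def compMinus (n : ℝ) (f : HomSpace Γ → ℂ) (x : HomSpace Γ) : ℂ :=
  (1 / n) • (∫ ξ in Set.Ioi (0 : ℝ), Real.exp (-((1 + n) / 2 * ξ)) • gFun f x ξ)
    + ((1 + n) / (2 * n)) • unitInt f x - (1 / n) • unitInt (derivX f) x

end HorocycleFlow

open HorocycleFlow

/-! Fix a point y and let a(ξ) be the average of f over the `φ^X_{-ξ}`-image of the unit horocycle
arc starting at y (`arcAvg`). That image is an arc of length e^ξ, so y = x_T and ξ = log T give a(ξ)
= A_f(x, T) (`horoAverage_eq_arcAvg`). Each derivative in ξ brings down -X. The equation `□f = μf`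
therefore becomes a'' + a' + μa = e^{-ξ} G(y, ξ): the term UVf integrates along the arc to a
difference of endpoint values of Vf, divided by the speed e^ξ (`arcAvg_derivX_derivX`). The
characteristic exponents are -(1 ± ν)/2.

Variation of constants solves this equation (`duhamel`, `arcAvg_eq`). For μ > 0 the Duhamel integral
may be extended to a half line at the cost of O(e^{-ξ}) (`arcAvg_sub_main_le`). The addition formula
for the fundamental solution then separates ξ from the integration variable, and the coefficients
are the functions D^±. Estimating the finite Duhamel integral directly gives the bounds that do not
degenerate as ν tends to 0 (`norm_arcAvg_le_exp`). Hölder continuity is an interpolation: G is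
bounded, and it changes by O(e^ξ L) along a curve of length L. Cutting the integral against e^{-aξ}
at ξ = -log L gives O(L^a) (`norm_integral_kernel_le`).

For μ = 0 the exponents are 0 and -1, and the solution contains a constant term. It vanishes because
the averages of f tend to its mean, which is zero. For eigenfunctions this convergence has an
elementary proof (`mem_equiSpace_of_isEigen`). Functions with convergent averages form a closed
space, and a Hahn–Banach and Fourier argument reduces membership to the weight vectors of the
rotation group (`mem_of_kPart`). On weight n the lowering operator satisfies ‖lower F‖² = (μ + n²/4
- n/2)‖F‖² in L² (`integral_lower`), which settles the weights 0, 1, 2. For n ≠ 0, F is a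
combination of XF, UF and lower F; the averages of XF and UF tend to 0, and lower F is reached from
weight n - 2 (`mem_lower`).

For μ < 0, factoring `-X² + X - μ` into first order operators in X and inverting both along
geodesics gives an explicit continuous u with Uu = f and ‖u‖ ≤ ‖f‖_{C²}/|μ| (`exists_coboundary`).
This yields the constant 5 when μ ≤ -3/4. In the gap -3/4 < μ < 0 the energy identity and the same
weight induction show that f = 0 (`eq_zero_of_isEigen`). -/

namespace HorocycleFlow
variable {Γ : Subgroup SL2R}

open Topology Filter Set

/-! ### The right action on the quotient and its continuity. -/

section Action

@[simp] lemma rightMul_proj (k g : SL2R) : rightMul k (proj Γ g) = proj Γ (g * k) := rfl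

lemma proj_surjective : Function.Surjective (proj Γ) := Quotient.mk_surjective

lemma rightMul_rightMul (k l : SL2R) (x : HomSpace Γ) :
    rightMul l (rightMul k x) = rightMul (k * l) x := by
  obtain ⟨g, rfl⟩ := proj_surjective x
  simp [mul_assoc]

@[simp] lemma rightMul_one (x : HomSpace Γ) : rightMul 1 x = x := by
  obtain ⟨g, rfl⟩ := proj_surjective x
  simp

lemma continuous_proj : Continuous (proj Γ) := continuous_quotient_mk'

lemma isOpenMap_proj : IsOpenMap (proj Γ) := isOpenMap_quotient_mk'_mul (Γ := Γ) (T := SL2R)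

lemma isOpenQuotientMap_proj : IsOpenQuotientMap (proj Γ) :=
  ⟨proj_surjective, continuous_proj, isOpenMap_proj⟩

lemma proj_eq_iff {a b : SL2R} : proj Γ a = proj Γ b ↔ b * a⁻¹ ∈ Γ := by
  rw [← QuotientGroup.rightRel_apply]
  exact Quotient.eq

lemma continuous_rightMul_prod :
    Continuous (fun p : SL2R × HomSpace Γ => rightMul p.1 p.2) := by
  have h : IsOpenQuotientMap (Prod.map (id : SL2R → SL2R) (proj Γ)) :=
    IsOpenQuotientMap.id.prodMap isOpenQuotientMap_proj
  refine h.isQuotientMap.continuous_iff.2 ?_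
  exact continuous_proj.comp (continuous_snd.mul continuous_fst)

lemma continuous_rightMul_of {T : Type*} [TopologicalSpace T] {k : T → SL2R} {x : T → HomSpace Γ}
    (hk : Continuous k) (hx : Continuous x) : Continuous (fun t => rightMul (k t) (x t)) :=
  continuous_rightMul_prod.comp (hk.prodMk hx)

lemma continuous_SL2R_iff {T : Type*} [TopologicalSpace T] {k : T → SL2R} :
    Continuous k ↔ ∀ i j, Continuous (fun t => (k t).1 i j) := by
  refine Matrix.SpecialLinearGroup.isClosedEmbedding_val.isInducing.continuous_iff.trans ?_
  refine continuous_pi_iff.trans (forall_congr' fun i => ?_)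
  exact continuous_pi_iff

end Action

/-! ### Matrix identities for the three one-parameter groups. -/

section Matrices

lemma expU_val (t : ℝ) : (expU t).1 = !![1, t; 0, 1] := rfl
lemma expX_val (t : ℝ) : (expX t).1 = !![Real.exp (t / 2), 0; 0, Real.exp (-t / 2)] := rfl
lemma expV_val (t : ℝ) : (expV t).1 = !![1, 0; t, 1] := rfl

lemma SL2R_ext {a b : SL2R} (h00 : a.1 0 0 = b.1 0 0) (h01 : a.1 0 1 = b.1 0 1)
    (h10 : a.1 1 0 = b.1 1 0) (h11 : a.1 1 1 = b.1 1 1) : a = b := by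
  apply Subtype.ext
  ext i j
  fin_cases i <;> fin_cases j <;> assumption

lemma mul_val (a b : SL2R) (i j : Fin 2) :
    (a * b).1 i j = a.1 i 0 * b.1 0 j + a.1 i 1 * b.1 1 j := by
  change (a.1 * b.1) i j = _
  rw [Matrix.mul_apply, Fin.sum_univ_two]

lemma inv_val (a : SL2R) : (a⁻¹).1 = !![a.1 1 1, -a.1 0 1; -a.1 1 0, a.1 0 0] := by
  rw [Matrix.SpecialLinearGroup.coe_inv, Matrix.adjugate_fin_two]

lemma det_val (a : SL2R) : a.1 0 0 * a.1 1 1 - a.1 0 1 * a.1 1 0 = 1 := by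
  rw [← Matrix.det_fin_two]; exact a.2

lemma one_val (i j : Fin 2) : (1 : SL2R).1 i j = if i = j then 1 else 0 := Matrix.one_apply

lemma expU_add (s t : ℝ) : expU (s + t) = expU s * expU t := by
  apply SL2R_ext <;> simp [mul_val, expU_val, add_comm]

lemma expV_add (s t : ℝ) : expV (s + t) = expV s * expV t := by
  apply SL2R_ext <;> simp [mul_val, expV_val]

lemma expX_add (s t : ℝ) : expX (s + t) = expX s * expX t := by
  apply SL2R_ext <;> simp [mul_val, expX_val, ← Real.exp_add] <;> ring

@[simp] lemma expU_zero : expU 0 = 1 := by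
  apply SL2R_ext <;> simp [expU_val, one_val]

@[simp] lemma expV_zero : expV 0 = 1 := by
  apply SL2R_ext <;> simp [expV_val, one_val]

@[simp] lemma expX_zero : expX 0 = 1 := by
  apply SL2R_ext <;> simp [expX_val, one_val]

lemma expX_mul_expU (r s : ℝ) : expX r * expU s = expU (Real.exp r * s) * expX r := by
  have h : Real.exp (r / 2) = Real.exp r * Real.exp (-r / 2) := by
    rw [← Real.exp_add]; congr 1; ring
  apply SL2R_ext <;> simp [mul_val, expX_val, expU_val]
  rw [h]; ring

lemma expX_mul_expV (r s : ℝ) : expX r * expV s = expV (Real.exp (-r) * s) * expX r := by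
  have h : Real.exp (-r / 2) = Real.exp (-r) * Real.exp (r / 2) := by
    rw [← Real.exp_add]; congr 1; ring
  apply SL2R_ext <;> simp [mul_val, expX_val, expV_val]
  rw [h]; ring

lemma expU_inv (r : ℝ) : (expU r)⁻¹ = expU (-r) := by
  rw [inv_eq_iff_mul_eq_one, ← expU_add]; simp

lemma expV_inv (r : ℝ) : (expV r)⁻¹ = expV (-r) := by
  rw [inv_eq_iff_mul_eq_one, ← expV_add]; simp

lemma horo_geo (r s : ℝ) (x : HomSpace Γ) : horo s (geo r x) = geo r (horo (Real.exp r * s) x) := by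
  simp only [horo, geo, rightMul_rightMul, expX_mul_expU]

lemma horo_horo (r s : ℝ) (x : HomSpace Γ) : horo s (horo r x) = horo (r + s) x := by
  simp only [horo, rightMul_rightMul, expU_add]

lemma geo_geo (r s : ℝ) (x : HomSpace Γ) : geo s (geo r x) = geo (r + s) x := by
  simp only [geo, rightMul_rightMul, expX_add]

@[simp] lemma horo_zero (x : HomSpace Γ) : horo 0 x = x := by simp [horo]
@[simp] lemma geo_zero (x : HomSpace Γ) : geo 0 x = x := by simp [geo]

end Matrices

/-! ### Differentiability on the quotient in exponential coordinates. -/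

section Smooth

variable {E E' : Type*} [NormedAddCommGroup E] [NormedSpace ℝ E]
  [NormedAddCommGroup E'] [NormedSpace ℝ E'] {n : WithTop ℕ∞}

/-- A family of matrices in `SL(2, ℝ)` with entries of class `C^n`. -/
def SmoothFam (n : WithTop ℕ∞) (γ : E → SL2R) : Prop := ∀ i j, ContDiff ℝ n (fun e => (γ e).1 i j)

lemma SmoothFam.continuous {γ : E → SL2R} (h : SmoothFam n γ) : Continuous γ :=
  continuous_SL2R_iff.2 fun i j => (h i j).continuous

lemma SmoothFam.const (k : SL2R) : SmoothFam n (fun _ : E => k) := fun _ _ => contDiff_const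

lemma SmoothFam.mul {γ δ : E → SL2R} (h : SmoothFam n γ) (h' : SmoothFam n δ) :
    SmoothFam n (fun e => γ e * δ e) := fun i j => by
  simp only [mul_val]
  exact ((h _ _).mul (h' _ _)).add ((h _ _).mul (h' _ _))

lemma SmoothFam.comp {γ : E → SL2R} (h : SmoothFam n γ) {u : E' → E} (hu : ContDiff ℝ n u) :
    SmoothFam n (fun e => γ (u e)) := fun i j => (h i j).comp hu

lemma smoothFam_expU : SmoothFam n expU := fun i j => by
  fin_cases i <;> fin_cases j <;> simp [expU_val] <;> fun_prop

lemma smoothFam_expV : SmoothFam n expV := fun i j => by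
  fin_cases i <;> fin_cases j <;> simp [expV_val] <;> fun_prop

lemma smoothFam_expX : SmoothFam n expX := fun i j => by
  fin_cases i <;> fin_cases j <;> simp [expX_val] <;> fun_prop

lemma continuous_expU : Continuous expU := (smoothFam_expU (n := 0)).continuous
lemma continuous_expX : Continuous expX := (smoothFam_expX (n := 0)).continuous
/-- The coordinates `(a, b, c) ↦ exp (a U) exp (b X) exp (c V)` near the identity. -/
noncomputable def box (p : ℝ × ℝ × ℝ) : SL2R := expU p.1 * expX p.2.1 * expV p.2.2

/-- The inverse of `box`, on matrices with a positive lower right entry. -/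
noncomputable def coords (M : Matrix (Fin 2) (Fin 2) ℝ) : ℝ × ℝ × ℝ :=
  (M 0 1 / M 1 1, -2 * Real.log (M 1 1), M 1 0 / M 1 1)

/-- The lower right entry of exp(aU) exp(bX) exp(cV) is e^{-b/2}, and the off-diagonal entries are a
and c times it, so all three coordinates can be read off where that entry is positive. -/
lemma box_coords {g : SL2R} (hg : 0 < g.1 1 1) : box (coords g.1) = g := by
  have hd := det_val g
  have h1 : Real.exp (-(-2 * Real.log (g.1 1 1)) / 2) = g.1 1 1 := by
    rw [← Real.exp_log hg]; simp
  have h2 : Real.exp (-2 * Real.log (g.1 1 1) / 2) = (g.1 1 1)⁻¹ := by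
    rw [show -2 * Real.log (g.1 1 1) / 2 = -Real.log (g.1 1 1) by ring, Real.exp_neg,
      Real.exp_log hg]
  apply SL2R_ext <;>
    simp only [box, coords, mul_val, expU_val, expX_val, expV_val, Matrix.of_apply,
      Matrix.cons_val', Matrix.cons_val_zero, Matrix.cons_val_one, Matrix.cons_val_fin_one, h1, h2]
    <;> field_simp <;> linarith

lemma smoothFam_box : SmoothFam n box :=
  ((smoothFam_expU.comp contDiff_fst).mul
    (smoothFam_expX.comp (contDiff_fst.comp contDiff_snd))).mul
    (smoothFam_expV.comp (contDiff_snd.comp contDiff_snd))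

/-- Functions of class `C^n` on `M`. -/
def IsCn (n : WithTop ℕ∞) (f : HomSpace Γ → ℂ) : Prop :=
  ∀ x : HomSpace Γ, ContDiff ℝ n (fun p : ℝ × ℝ × ℝ => f (rightMul (box p) x))

lemma isC2_iff {f : HomSpace Γ → ℂ} : IsC2 f ↔ IsCn 2 f := by
  simp only [IsC2, IsCn, horo, geo, horoUn, rightMul_rightMul, box]

lemma IsCn.of_le {m : WithTop ℕ∞} {f : HomSpace Γ → ℂ} (h : IsCn n f) (hm : m ≤ n) : IsCn m f :=
  fun x => (h x).of_le hm

/-- A family of functions on `M` that is of class `C^n` in the parameter and the point. -/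
def IsCnFam (n : WithTop ℕ∞) (f : E → HomSpace Γ → ℂ) : Prop :=
  ∀ x : HomSpace Γ, ContDiff ℝ n (fun p : E × ℝ × ℝ × ℝ => f p.1 (rightMul (box p.2) x))

lemma IsCnFam.of_le {m : WithTop ℕ∞} {f : E → HomSpace Γ → ℂ} (h : IsCnFam n f) (hm : m ≤ n) :
    IsCnFam m f := fun x => (h x).of_le hm

/-- Smoothness is local: after recentring at `γ e₀`, the family stays near the identity, where
`coords` is smooth. This replaces the particular chart `box` by arbitrary smooth families of group
elements. -/
lemma IsCnFam.contDiff {f : E → HomSpace Γ → ℂ} (hf : IsCnFam n f) {u : E' → E} {γ : E' → SL2R}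
    (hu : ContDiff ℝ n u) (hγ : SmoothFam n γ) (x : HomSpace Γ) :
    ContDiff ℝ n (fun e => f (u e) (rightMul (γ e) x)) := by
  rw [contDiff_iff_contDiffAt]
  intro e₀
  set k := γ e₀
  have hδ : SmoothFam n (fun e => k⁻¹ * γ e) := (SmoothFam.const _).mul hγ
  have h1 : (k⁻¹ * γ e₀).1 1 1 = 1 := by simp [k, one_val]
  have hpos : ∀ᶠ e in 𝓝 e₀, 0 < (k⁻¹ * γ e).1 1 1 :=
    (hδ 1 1).continuous.continuousAt.eventually (lt_mem_nhds (one_pos.trans_eq h1.symm))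
  have hne : (k⁻¹ * γ e₀).1 1 1 ≠ 0 := by rw [h1]; exact one_ne_zero
  have hc : ContDiffAt ℝ n (fun e => coords (k⁻¹ * γ e).1) e₀ := by
    refine ContDiffAt.prodMk ?_ (ContDiffAt.prodMk ?_ ?_)
    · exact (hδ 0 1).contDiffAt.div (hδ 1 1).contDiffAt hne
    · exact contDiffAt_const.mul ((hδ 1 1).contDiffAt.log hne)
    · exact (hδ 1 0).contDiffAt.div (hδ 1 1).contDiffAt hne
  have := (hf (rightMul k x)).contDiffAt.comp e₀ (hu.contDiffAt.prodMk hc)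
  refine this.congr_of_eventuallyEq ?_
  filter_upwards [hpos] with e he
  simp only [Function.comp_apply, box_coords he, rightMul_rightMul, mul_inv_cancel_left]

lemma IsCn.isCnFam {f : HomSpace Γ → ℂ} (hf : IsCn n f) : IsCnFam (E := E) n (fun _ => f) :=
  fun x => (hf x).comp contDiff_snd

lemma IsCn.contDiff {f : HomSpace Γ → ℂ} (hf : IsCn n f) {γ : E → SL2R} (hγ : SmoothFam n γ)
    (x : HomSpace Γ) : ContDiff ℝ n (fun e => f (rightMul (γ e) x)) :=
  (hf.isCnFam (E := E)).contDiff contDiff_id hγ x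

lemma IsCnFam.isCn {f : E → HomSpace Γ → ℂ} (hf : IsCnFam n f) (e : E) : IsCn n (f e) :=
  fun x => hf.contDiff (contDiff_const (c := e)) smoothFam_box x

/-- Translates along a smooth family form a smooth family. -/
lemma IsCn.translate {f : HomSpace Γ → ℂ} (hf : IsCn n f) {k : E → SL2R} (hk : SmoothFam n k) :
    IsCnFam n (fun e x => f (rightMul (k e) x)) := fun x => by
  simp only [rightMul_rightMul]
  exact hf.contDiff ((smoothFam_box.comp contDiff_snd).mul (hk.comp contDiff_fst)) x

/-- The product of `proj Γ` with the identity is again an open quotient map, so joint continuity can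
be tested upstairs, in the chart around a group element. -/
lemma IsCnFam.continuous {f : E → HomSpace Γ → ℂ} (hf : IsCnFam n f) :
    Continuous (fun p : E × HomSpace Γ => f p.1 p.2) := by
  have h : IsOpenQuotientMap (Prod.map (id : E → E) (proj Γ)) :=
    IsOpenQuotientMap.id.prodMap isOpenQuotientMap_proj
  refine h.isQuotientMap.continuous_iff.2 (continuous_iff_continuousAt.2 ?_)
  rintro ⟨e₀, g₀⟩
  have hδ : Continuous (fun p : E × SL2R => g₀⁻¹ * p.2) := continuous_const.mul continuous_snd
  have hδ' := continuous_SL2R_iff.1 hδ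
  have h1 : (g₀⁻¹ * g₀).1 1 1 = 1 := by simp [one_val]
  have hpos : ∀ᶠ p in 𝓝 (e₀, g₀), 0 < (g₀⁻¹ * p.2 : SL2R).1 1 1 :=
    (hδ' 1 1).continuousAt.eventually
      (lt_mem_nhds (one_pos.trans_eq h1.symm))
  have hne : (g₀⁻¹ * g₀).1 1 1 ≠ 0 := by rw [h1]; exact one_ne_zero
  have hc : ContinuousAt (fun p : E × SL2R => coords (g₀⁻¹ * p.2).1) (e₀, g₀) := by
    refine ContinuousAt.prodMk ?_ (ContinuousAt.prodMk ?_ ?_)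
    · exact (hδ' 0 1).continuousAt.div (hδ' 1 1).continuousAt hne
    · exact continuousAt_const.mul ((hδ' 1 1).continuousAt.log hne)
    · exact (hδ' 1 0).continuousAt.div (hδ' 1 1).continuousAt hne
  have hF : Continuous (fun p : E × ℝ × ℝ × ℝ => f p.1 (rightMul (box p.2) (proj Γ g₀))) :=
    (hf (proj Γ g₀)).continuous
  have := hF.continuousAt.comp (f := fun p : E × SL2R => (p.1, coords (g₀⁻¹ * p.2).1))
    (x := (e₀, g₀)) (continuousAt_fst.prodMk hc)
  refine this.congr ?_
  filter_upwards [hpos] with p hp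
  simp only [Function.comp_apply, box_coords hp, rightMul_proj, mul_inv_cancel_left, Prod.map, id]

lemma IsCn.continuous {f : HomSpace Γ → ℂ} (hf : IsCn n f) : Continuous f :=
  (hf.isCnFam (E := ℝ)).continuous.comp ((Continuous.prodMk_right (0 : ℝ)))

end Smooth


/-! ### Derivatives along curves and along the three flows. -/

section Derivatives

variable {E : Type*} [NormedAddCommGroup E] [NormedSpace ℝ E] {n m : WithTop ℕ∞}

lemma hasDerivAt_expU (t : ℝ) (i j : Fin 2) :
    HasDerivAt (fun s => (expU s).1 i j) ((!![0, 1; 0, 0] : Matrix (Fin 2) (Fin 2) ℝ) i j) t := by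
  fin_cases i <;> fin_cases j <;> simp [expU_val, hasDerivAt_const, hasDerivAt_id']

lemma hasDerivAt_expV (t : ℝ) (i j : Fin 2) :
    HasDerivAt (fun s => (expV s).1 i j) ((!![0, 0; 1, 0] : Matrix (Fin 2) (Fin 2) ℝ) i j) t := by
  fin_cases i <;> fin_cases j <;> simp [expV_val, hasDerivAt_const, hasDerivAt_id']

lemma hasDerivAt_expX (i j : Fin 2) :
    HasDerivAt (fun s => (expX s).1 i j)
      ((!![1 / 2, 0; 0, -1 / 2] : Matrix (Fin 2) (Fin 2) ℝ) i j) 0 := by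
  have h1 : HasDerivAt (fun s : ℝ => Real.exp (s / 2)) (1 / 2) 0 := by
    simpa using ((hasDerivAt_id (0 : ℝ)).div_const 2).exp
  have h2 : HasDerivAt (fun s : ℝ => Real.exp (-s / 2)) (-1 / 2) 0 := by
    simpa using ((hasDerivAt_id (0 : ℝ)).neg.div_const 2).exp
  fin_cases i <;> fin_cases j <;> simp [expX_val, hasDerivAt_const]
  · simpa using h1
  · simpa using h2

lemma hasDerivAt_mul_entries {σ τ : ℝ → SL2R} {σ' τ' : Matrix (Fin 2) (Fin 2) ℝ} {t : ℝ}
    (hσ : ∀ i j, HasDerivAt (fun s => (σ s).1 i j) (σ' i j) t)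
    (hτ : ∀ i j, HasDerivAt (fun s => (τ s).1 i j) (τ' i j) t) (i j : Fin 2) :
    HasDerivAt (fun s => (σ s * τ s).1 i j) ((σ' * (τ t).1 + (σ t).1 * τ') i j) t := by
  simp only [mul_val]
  refine (((hσ i 0).mul (hτ 0 j)).add ((hσ i 1).mul (hτ 1 j))).congr_deriv ?_
  simp only [Matrix.add_apply, Matrix.mul_apply, Fin.sum_univ_two]
  ring

/-- The derivative of `f` in the direction of the trace zero matrix `v`. -/
noncomputable def dirD (v : Matrix (Fin 2) (Fin 2) ℝ) (f : HomSpace Γ → ℂ) (x : HomSpace Γ) : ℂ :=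
  (v 0 1 : ℂ) * derivU f x + ((-2 * v 1 1 : ℝ) : ℂ) * derivX f x + (v 1 0 : ℂ) * derivV f x

lemma box_u (t : ℝ) : box (t, 0, 0) = expU t := by simp [box]
lemma box_x (t : ℝ) : box (0, t, 0) = expX t := by simp [box]
lemma box_v (t : ℝ) : box (0, 0, t) = expV t := by simp [box]

/-- Chain rule in the chart centred at the current point. The differential of `coords` at the
identity sends a trace zero matrix v to (v₀₁, -2v₁₁, v₁₀), its components in the frame (U, X, V). -/
lemma hasDerivAt_curve {f : HomSpace Γ → ℂ} (hf : IsCn 1 f) {σ : ℝ → SL2R}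
    {σ' : Matrix (Fin 2) (Fin 2) ℝ} {t : ℝ}
    (hσ : ∀ i j, HasDerivAt (fun s => (σ s).1 i j) (σ' i j) t) (x : HomSpace Γ) :
    HasDerivAt (fun s => f (rightMul (σ s) x))
      (dirD (((σ t)⁻¹).1 * σ') f (rightMul (σ t) x)) t := by
  set k := σ t with hk
  set y := rightMul k x
  set F : ℝ × ℝ × ℝ → ℂ := fun p => f (rightMul (box p) y)
  have hF : HasFDerivAt F (fderiv ℝ F 0) 0 :=
    ((hf y).differentiable one_ne_zero).differentiableAt.hasFDerivAt
  have hline : ∀ q : ℝ × ℝ × ℝ, deriv (fun s : ℝ => F (s • q)) 0 = fderiv ℝ F 0 q := fun q => by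
    have h1 : HasDerivAt (fun s : ℝ => s • q) q 0 := by
      simpa using (hasDerivAt_id (0 : ℝ)).smul_const q
    have h2 : HasFDerivAt F (fderiv ℝ F 0) ((fun s : ℝ => s • q) 0) := by simpa using hF
    exact (h2.comp_hasDerivAt 0 h1).deriv
  have hu : fderiv ℝ F 0 (1, 0, 0) = derivU f y := by
    rw [← hline]; simp [F, box_u, derivU, flowDeriv, horo]
  have hx : fderiv ℝ F 0 (0, 1, 0) = derivX f y := by
    rw [← hline]; simp [F, box_x, derivX, flowDeriv, geo]
  have hv : fderiv ℝ F 0 (0, 0, 1) = derivV f y := by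
    rw [← hline]; simp [F, box_v, derivV, flowDeriv, horoUn]
  have hL : ∀ a b c : ℝ, fderiv ℝ F 0 (a, b, c)
      = (a : ℂ) * derivU f y + (b : ℂ) * derivX f y + (c : ℂ) * derivV f y := fun a b c => by
    have : ((a, b, c) : ℝ × ℝ × ℝ)
        = a • ((1, 0, 0) : ℝ × ℝ × ℝ) + b • ((0, 1, 0) : ℝ × ℝ × ℝ)
          + c • ((0, 0, 1) : ℝ × ℝ × ℝ) := by simp
    rw [this, map_add, map_add, map_smul, map_smul, map_smul, hu, hx, hv]
    simp
  have hδ : ∀ i j, HasDerivAt (fun s => (k⁻¹ * σ s).1 i j) ((k⁻¹.1 * σ') i j) t := fun i j => by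
    simpa using hasDerivAt_mul_entries (σ := fun _ => k⁻¹) (σ' := 0)
      (fun i j => hasDerivAt_const t _) hσ i j
  have hone : ∀ i j, (k⁻¹ * σ t).1 i j = if i = j then 1 else 0 := fun i j => by
    rw [← hk, inv_mul_cancel]; exact one_val i j
  have h11 : (k⁻¹ * σ t).1 1 1 = 1 := (hone 1 1).trans (if_pos rfl)
  have h01 : (k⁻¹ * σ t).1 0 1 = 0 := (hone 0 1).trans (if_neg (by decide))
  have h10 : (k⁻¹ * σ t).1 1 0 = 0 := (hone 1 0).trans (if_neg (by decide))
  have hne : (k⁻¹ * σ t).1 1 1 ≠ 0 := by rw [h11]; exact one_ne_zero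
  set v := k⁻¹.1 * σ'
  have hc : HasDerivAt (fun s => coords (k⁻¹ * σ s).1) (v 0 1, -2 * v 1 1, v 1 0) t := by
    refine HasDerivAt.prodMk ?_ (HasDerivAt.prodMk ?_ ?_)
    · refine ((hδ 0 1).div (hδ 1 1) hne).congr_deriv ?_
      rw [h11, h01]; simp
    · refine (((hδ 1 1).log hne).const_mul (-2)).congr_deriv ?_
      rw [h11]; simp
    · refine ((hδ 1 0).div (hδ 1 1) hne).congr_deriv ?_
      rw [h11, h10]; simp
  have hc0 : coords (k⁻¹ * σ t).1 = 0 := by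
    simp only [coords]
    rw [h11, h01, h10]
    simp
  have hpos : ∀ᶠ s in 𝓝 t, 0 < (k⁻¹ * σ s).1 1 1 :=
    (hδ 1 1).continuousAt.eventually (lt_mem_nhds (one_pos.trans_eq h11.symm))
  have := HasFDerivAt.comp_hasDerivAt t (f := fun s => coords (k⁻¹ * σ s).1) (l := F)
    (by rw [hc0]; exact hF) hc
  rw [hL] at this
  refine this.congr_of_eventuallyEq ?_
  filter_upwards [hpos] with s hs
  simp only [Function.comp_apply, F, y, box_coords hs, rightMul_rightMul, mul_inv_cancel_left]

/-- The flow derivative is the partial derivative in t of a jointly `C^n` function of parameter,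
chart point and time, so exactly one order is lost. -/
lemma IsCnFam.flowDeriv {f : E → HomSpace Γ → ℂ} (hf : IsCnFam n f) (hm : m + 1 ≤ n)
    {w : ℝ → SL2R} (hw : SmoothFam n w) :
    IsCnFam m (fun e x => deriv (fun t => f e (rightMul (w t) x)) 0) := fun x => by
  have h1 : ContDiff ℝ n (fun q : (E × ℝ × ℝ × ℝ) × ℝ =>
      f q.1.1 (rightMul (box q.1.2 * w q.2) x)) :=
    hf.contDiff (contDiff_fst.comp contDiff_fst)
      ((smoothFam_box.comp (contDiff_snd.comp contDiff_fst)).mul (hw.comp contDiff_snd)) x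
  set Φ := fun q : (E × ℝ × ℝ × ℝ) × ℝ => f q.1.1 (rightMul (box q.1.2 * w q.2) x)
  have hn : n ≠ 0 := by
    rintro rfl
    simp at hm
  have h2 : ContDiff ℝ m (fun p : E × ℝ × ℝ × ℝ => fderiv ℝ Φ (p, 0) (0, 1)) :=
    ((h1.fderiv_right hm).comp (contDiff_id.prodMk contDiff_const)).clm_apply contDiff_const
  convert h2 using 2 with p
  have hd : HasDerivAt (fun t : ℝ => (p, t)) ((0 : E × ℝ × ℝ × ℝ), (1 : ℝ)) 0 :=
    (hasDerivAt_const 0 p).prodMk (hasDerivAt_id 0)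
  have := ((h1.differentiable hn).differentiableAt (x := (p, (0 : ℝ)))).hasFDerivAt.comp_hasDerivAt
    0 hd
  simpa [Function.comp_def, Φ, rightMul_rightMul] using this.deriv

lemma IsCnFam.derivU {f : E → HomSpace Γ → ℂ} (hf : IsCnFam n f) (hm : m + 1 ≤ n) :
    IsCnFam m (fun e => derivU (f e)) := hf.flowDeriv hm smoothFam_expU

lemma IsCnFam.derivX {f : E → HomSpace Γ → ℂ} (hf : IsCnFam n f) (hm : m + 1 ≤ n) :
    IsCnFam m (fun e => derivX (f e)) := hf.flowDeriv hm smoothFam_expX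

lemma IsCnFam.derivV {f : E → HomSpace Γ → ℂ} (hf : IsCnFam n f) (hm : m + 1 ≤ n) :
    IsCnFam m (fun e => derivV (f e)) := hf.flowDeriv hm smoothFam_expV

lemma IsCn.derivU {f : HomSpace Γ → ℂ} (hf : IsCn n f) (hm : m + 1 ≤ n) : IsCn m (derivU f) :=
  ((hf.isCnFam (E := ℝ)).derivU hm).isCn 0

lemma IsCn.derivX {f : HomSpace Γ → ℂ} (hf : IsCn n f) (hm : m + 1 ≤ n) : IsCn m (derivX f) :=
  ((hf.isCnFam (E := ℝ)).derivX hm).isCn 0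

lemma IsCn.derivV {f : HomSpace Γ → ℂ} (hf : IsCn n f) (hm : m + 1 ≤ n) : IsCn m (derivV f) :=
  ((hf.isCnFam (E := ℝ)).derivV hm).isCn 0

lemma IsCn.derivU' {f : HomSpace Γ → ℂ} (hf : IsCn 2 f) : IsCn 1 (HorocycleFlow.derivU f) :=
  hf.derivU (by norm_num)
lemma IsCn.derivX' {f : HomSpace Γ → ℂ} (hf : IsCn 2 f) : IsCn 1 (HorocycleFlow.derivX f) :=
  hf.derivX (by norm_num)
lemma IsCn.derivV' {f : HomSpace Γ → ℂ} (hf : IsCn 2 f) : IsCn 1 (HorocycleFlow.derivV f) :=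
  hf.derivV (by norm_num)

lemma IsCn.one {f : HomSpace Γ → ℂ} (hf : IsCn 2 f) : IsCn 1 f := hf.of_le (by norm_num)

variable {f : HomSpace Γ → ℂ}

lemma continuous_derivU (hf : IsCn 1 f) : Continuous (derivU f) :=
  (hf.derivU (m := 0) (by simp)).continuous
lemma continuous_derivX (hf : IsCn 1 f) : Continuous (derivX f) :=
  (hf.derivX (m := 0) (by simp)).continuous
lemma continuous_derivV (hf : IsCn 1 f) : Continuous (derivV f) :=
  (hf.derivV (m := 0) (by simp)).continuous

lemma hasDerivAt_smoothFam (hf : IsCn 1 f) {σ : ℝ → SL2R} (hσ : SmoothFam 1 σ) (x : HomSpace Γ)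
    (t : ℝ) : DifferentiableAt ℝ (fun s => f (rightMul (σ s) x)) t :=
  ((hf.contDiff hσ x).differentiable one_ne_zero).differentiableAt

lemma hasDerivAt_horo_zero (hf : IsCn 1 f) (x : HomSpace Γ) :
    HasDerivAt (fun t => f (horo t x)) (derivU f x) 0 :=
  (hasDerivAt_smoothFam hf smoothFam_expU x 0).hasDerivAt

lemma hasDerivAt_geo_zero (hf : IsCn 1 f) (x : HomSpace Γ) :
    HasDerivAt (fun t => f (geo t x)) (derivX f x) 0 :=
  (hasDerivAt_smoothFam hf smoothFam_expX x 0).hasDerivAt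

lemma hasDerivAt_horoUn_zero (hf : IsCn 1 f) (x : HomSpace Γ) :
    HasDerivAt (fun t => f (horoUn t x)) (derivV f x) 0 :=
  (hasDerivAt_smoothFam hf smoothFam_expV x 0).hasDerivAt

lemma hasDerivAt_horo (hf : IsCn 1 f) (x : HomSpace Γ) (t : ℝ) :
    HasDerivAt (fun t => f (horo t x)) (derivU f (horo t x)) t := by
  have h := hasDerivAt_horo_zero hf (horo t x)
  have h2 := HasDerivAt.comp_sub_const t t (by rwa [sub_self] : HasDerivAt _ _ (t - t))
  refine h2.congr_of_eventuallyEq (Eventually.of_forall fun s => ?_)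
  simp [horo_horo]

lemma hasDerivAt_geo (hf : IsCn 1 f) (x : HomSpace Γ) (t : ℝ) :
    HasDerivAt (fun t => f (geo t x)) (derivX f (geo t x)) t := by
  have h := hasDerivAt_geo_zero hf (geo t x)
  have h2 := HasDerivAt.comp_sub_const t t (by rwa [sub_self] : HasDerivAt _ _ (t - t))
  refine h2.congr_of_eventuallyEq (Eventually.of_forall fun s => ?_)
  simp [geo_geo]

lemma hasDerivAt_horoUn (hf : IsCn 1 f) (x : HomSpace Γ) (t : ℝ) :
    HasDerivAt (fun t => f (horoUn t x)) (derivV f (horoUn t x)) t := by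
  have h := hasDerivAt_horoUn_zero hf (horoUn t x)
  have h2 := HasDerivAt.comp_sub_const t t (by rwa [sub_self] : HasDerivAt _ _ (t - t))
  refine h2.congr_of_eventuallyEq (Eventually.of_forall fun s => ?_)
  simp [horoUn, rightMul_rightMul, ← expV_add]

end Derivatives

/-! ### Commutation relations of U, X and V. -/

section Brackets

variable {f : HomSpace Γ → ℂ}

lemma deriv_deriv_comm {F : ℝ × ℝ → ℂ} (hF : ContDiff ℝ 2 F) :
    deriv (fun s => deriv (fun t => F (s, t)) 0) 0
      = deriv (fun t => deriv (fun s => F (s, t)) 0) 0 := by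
  have hd : Differentiable ℝ F := hF.differentiable two_ne_zero
  have hd2 : Differentiable ℝ (fderiv ℝ F) :=
    (hF.fderiv_right (m := 1) (by norm_num)).differentiable one_ne_zero
  have hsymm : IsSymmSndFDerivAt ℝ F 0 := hF.contDiffAt.isSymmSndFDerivAt (by simp)
  have h1 : ∀ s, deriv (fun t => F (s, t)) 0 = fderiv ℝ F (s, 0) (0, 1) := fun s =>
    (hd.differentiableAt.hasFDerivAt.comp_hasDerivAt (0 : ℝ)
      ((hasDerivAt_const 0 s).prodMk (hasDerivAt_id (0 : ℝ)))).deriv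
  have h2 : ∀ t, deriv (fun s => F (s, t)) 0 = fderiv ℝ F (0, t) (1, 0) := fun t =>
    (hd.differentiableAt.hasFDerivAt.comp_hasDerivAt (0 : ℝ)
      ((hasDerivAt_id (0 : ℝ)).prodMk (hasDerivAt_const 0 t))).deriv
  simp only [h1, h2]
  have h3 : deriv (fun s => fderiv ℝ F (s, 0) (0, 1)) 0
      = fderiv ℝ (fderiv ℝ F) (0, 0) (1, 0) (0, 1) := by
    have := (hd2.differentiableAt.hasFDerivAt.comp_hasDerivAt (0 : ℝ)
      ((hasDerivAt_id (0 : ℝ)).prodMk (hasDerivAt_const 0 (0 : ℝ))))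
    exact (this.clm_apply (hasDerivAt_const 0 ((0, 1) : ℝ × ℝ))).deriv.trans (by simp)
  have h4 : deriv (fun t => fderiv ℝ F (0, t) (1, 0)) 0
      = fderiv ℝ (fderiv ℝ F) (0, 0) (0, 1) (1, 0) := by
    have := (hd2.differentiableAt.hasFDerivAt.comp_hasDerivAt (0 : ℝ)
      ((hasDerivAt_const 0 (0 : ℝ)).prodMk (hasDerivAt_id (0 : ℝ))))
    exact (this.clm_apply (hasDerivAt_const 0 ((1, 0) : ℝ × ℝ))).deriv.trans (by simp)
  rw [h3, h4]
  exact hsymm _ _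

/-- Symmetry of second derivatives. On the right the inner derivative is along `α` before
translation by `β t`, which `deriv_translate` expresses by conjugating the direction by `β t`.
Differentiating that conjugation in t produces the Lie brackets. -/
lemma deriv_deriv_rightMul (hf : IsCn 2 f) {α β : ℝ → SL2R} (hα : SmoothFam 2 α)
    (hβ : SmoothFam 2 β) (x : HomSpace Γ) :
    deriv (fun s => deriv (fun t => f (rightMul (β t) (rightMul (α s) x))) 0) 0
      = deriv (fun t => deriv (fun s => f (rightMul (α s * β t) x)) 0) 0 := by
  simp only [rightMul_rightMul]
  exact deriv_deriv_comm (F := fun p => f (rightMul (α p.1 * β p.2) x))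
    (hf.contDiff ((hα.comp contDiff_fst).mul (hβ.comp contDiff_snd)) x)

/-- The derivative of a translate. -/
lemma deriv_translate (hf : IsCn 1 f) {α : ℝ → SL2R} {A : Matrix (Fin 2) (Fin 2) ℝ}
    (hα : ∀ i j, HasDerivAt (fun s => (α s).1 i j) (A i j) 0) (h0 : α 0 = 1) (k : SL2R)
    (x : HomSpace Γ) :
    HasDerivAt (fun s => f (rightMul (α s * k) x)) (dirD (k⁻¹.1 * (A * k.1)) f (rightMul k x)) 0 := by
  have := hasDerivAt_curve hf (σ := fun s => α s * k) (σ' := A * k.1) (t := 0)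
    (fun i j => by
      simpa using hasDerivAt_mul_entries hα (τ := fun _ => k) (τ' := 0)
        (fun i j => hasDerivAt_const 0 _) i j) x
  simpa [h0] using this

lemma bracket_UV (hf : IsCn 2 f) (x : HomSpace Γ) :
    derivU (derivV f) x = derivV (derivU f) x + 2 * derivX f x := by
  have h := deriv_deriv_rightMul hf smoothFam_expU smoothFam_expV x
  have h2 : ∀ t, deriv (fun s => f (rightMul (expU s * expV t) x)) 0
      = derivU f (horoUn t x) + 2 * t * derivX f (horoUn t x) - t ^ 2 * derivV f (horoUn t x) :=
    fun t => by
    rw [(deriv_translate hf.one (hasDerivAt_expU 0) expU_zero (expV t) x).deriv]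
    simp [dirD, expV_inv, expV_val, Matrix.mul_apply, Fin.sum_univ_two, horoUn]
    ring
  simp only [h2] at h
  refine h.trans (HasDerivAt.deriv ?_)
  have ht : HasDerivAt (fun t : ℝ => (t : ℂ)) 1 0 := (hasDerivAt_id (0 : ℝ)).ofReal_comp
  have := ((hasDerivAt_horoUn_zero hf.derivU' x).add
    ((ht.const_mul 2).mul (hasDerivAt_horoUn_zero hf.derivX' x))).sub
    ((ht.pow 2).mul (hasDerivAt_horoUn_zero hf.derivV' x))
  refine this.congr_deriv ?_
  simp [horoUn]

lemma bracket_XU (hf : IsCn 2 f) (x : HomSpace Γ) :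
    derivX (derivU f) x = derivU (derivX f) x + derivU f x := by
  have h := deriv_deriv_rightMul hf smoothFam_expX smoothFam_expU x
  have h2 : ∀ t, deriv (fun s => f (rightMul (expX s * expU t) x)) 0
      = derivX f (horo t x) + t * derivU f (horo t x) :=
    fun t => by
    rw [(deriv_translate hf.one hasDerivAt_expX expX_zero (expU t) x).deriv]
    simp [dirD, expU_inv, expU_val, Matrix.mul_apply, Fin.sum_univ_two, horo]
    ring
  simp only [h2] at h
  refine h.trans (HasDerivAt.deriv ?_)
  have ht : HasDerivAt (fun t : ℝ => (t : ℂ)) 1 0 := (hasDerivAt_id (0 : ℝ)).ofReal_comp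
  have := (hasDerivAt_horo_zero hf.derivX' x).add (ht.mul (hasDerivAt_horo_zero hf.derivU' x))
  refine this.congr_deriv ?_
  simp

lemma bracket_XV (hf : IsCn 2 f) (x : HomSpace Γ) :
    derivX (derivV f) x = derivV (derivX f) x - derivV f x := by
  have h := deriv_deriv_rightMul hf smoothFam_expX smoothFam_expV x
  have h2 : ∀ t, deriv (fun s => f (rightMul (expX s * expV t) x)) 0
      = derivX f (horoUn t x) - t * derivV f (horoUn t x) :=
    fun t => by
    rw [(deriv_translate hf.one hasDerivAt_expX expX_zero (expV t) x).deriv]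
    simp [dirD, expV_inv, expV_val, Matrix.mul_apply, Fin.sum_univ_two, horoUn]
    ring
  simp only [h2] at h
  refine h.trans (HasDerivAt.deriv ?_)
  have ht : HasDerivAt (fun t : ℝ => (t : ℂ)) 1 0 := (hasDerivAt_id (0 : ℝ)).ofReal_comp
  have := (hasDerivAt_horoUn_zero hf.derivX' x).sub (ht.mul (hasDerivAt_horoUn_zero hf.derivV' x))
  refine this.congr_deriv ?_
  simp [horoUn]

end Brackets


/-! ### Pointwise bounds by the `C^2` norm. -/

section Bounds

variable [CompactSpace (HomSpace Γ)] {f : HomSpace Γ → ℂ}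

/-- A real supremum bounds its family only when the family is bounded above; compactness of the
quotient provides this. -/
lemma bddAbove_range_norm (hf : Continuous f) : BddAbove (range fun x => ‖f x‖) :=
  (isCompact_range hf.norm).bddAbove

lemma norm_le_supNorm (hf : Continuous f) (x : HomSpace Γ) : ‖f x‖ ≤ supNorm f :=
  le_ciSup (bddAbove_range_norm hf) x

lemma exists_norm_le (hf : Continuous f) : ∃ C, 0 ≤ C ∧ ∀ x, ‖f x‖ ≤ C :=
  ⟨supNorm f, (norm_nonneg _).trans (norm_le_supNorm hf (proj Γ 1)), norm_le_supNorm hf⟩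

lemma norm_le_c2Norm (hf : IsCn 2 f) (x : HomSpace Γ) : ‖f x‖ ≤ c2Norm f :=
  (norm_le_supNorm hf.continuous x).trans (le_max_left _ _)

lemma c2Norm_nonneg (hf : IsCn 2 f) : 0 ≤ c2Norm f :=
  (norm_nonneg _).trans (norm_le_c2Norm hf (proj Γ 1))

lemma supNorm_frame_le (f : HomSpace Γ → ℂ) (i : Fin 3) : supNorm (frame i f) ≤ c2Norm f :=
  (le_ciSup (f := fun i : Fin 3 => supNorm (frame i f)) (finite_range _).bddAbove i).trans
    ((le_max_left _ _).trans (le_max_right _ _))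

lemma supNorm_frame_frame_le (f : HomSpace Γ → ℂ) (i j : Fin 3) :
    supNorm (frame i (frame j f)) ≤ c2Norm f :=
  (le_ciSup (f := fun p : Fin 3 × Fin 3 => supNorm (frame p.1 (frame p.2 f)))
    (finite_range _).bddAbove (i, j)).trans ((le_max_right _ _).trans (le_max_right _ _))

lemma isCn_frame {n m : WithTop ℕ∞} (hf : IsCn n f) (hm : m + 1 ≤ n) (i : Fin 3) :
    IsCn m (frame i f) := by
  fin_cases i
  exacts [hf.derivU hm, hf.derivX hm, hf.derivV hm]

lemma norm_frame_le (hf : IsCn 2 f) (i : Fin 3) (x : HomSpace Γ) : ‖frame i f x‖ ≤ c2Norm f :=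
  (norm_le_supNorm (isCn_frame (m := 1) hf (by norm_num) i).continuous x).trans
    (supNorm_frame_le f i)

lemma norm_frame_frame_le (hf : IsCn 2 f) (i j : Fin 3) (x : HomSpace Γ) :
    ‖frame i (frame j f) x‖ ≤ c2Norm f :=
  (norm_le_supNorm (isCn_frame (n := 1) (m := 0)
    (isCn_frame (m := 1) hf (by norm_num) j) (by simp) i).continuous x).trans
    (supNorm_frame_frame_le f i j)

lemma norm_derivV_le (hf : IsCn 2 f) (x : HomSpace Γ) : ‖derivV f x‖ ≤ c2Norm f :=
  norm_frame_le hf 2 x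

lemma norm_derivX_le (hf : IsCn 2 f) (x : HomSpace Γ) : ‖derivX f x‖ ≤ c2Norm f :=
  norm_frame_le hf 1 x

lemma norm_gFun_le (hf : IsCn 2 f) (x : HomSpace Γ) (ξ : ℝ) : ‖gFun f x ξ‖ ≤ 2 * c2Norm f :=
  (norm_sub_le _ _).trans ((add_le_add (norm_derivV_le hf _) (norm_derivV_le hf _)).trans_eq
    (two_mul _).symm)

end Bounds

/-! ### Averages over expanding horocycle arcs and their differential equation. -/

section Flow

lemma continuous_horo_of {T : Type*} [TopologicalSpace T] {t : T → ℝ} {x : T → HomSpace Γ}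
    (ht : Continuous t) (hx : Continuous x) : Continuous (fun a => horo (t a) (x a)) :=
  continuous_rightMul_of (continuous_expU.comp ht) hx

lemma continuous_geo_of {T : Type*} [TopologicalSpace T] {t : T → ℝ} {x : T → HomSpace Γ}
    (ht : Continuous t) (hx : Continuous x) : Continuous (fun a => geo (t a) (x a)) :=
  continuous_rightMul_of (continuous_expX.comp ht) hx

lemma continuous_gFun {f : HomSpace Γ → ℂ} (hf : IsCn 2 f) :
    Continuous (fun p : HomSpace Γ × ℝ => gFun f p.1 p.2) :=
  ((continuous_derivV hf.one).comp (continuous_geo_of continuous_snd.neg continuous_fst)).sub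
    ((continuous_derivV hf.one).comp (continuous_geo_of continuous_snd.neg
      (continuous_horo_of continuous_const continuous_fst)))

lemma continuous_gFun_right {f : HomSpace Γ → ℂ} (hf : IsCn 2 f) (y : HomSpace Γ) :
    Continuous (gFun f y) := by
  have := (continuous_gFun hf).comp (Continuous.prodMk_right y)
  exact this

/-- The average of `f` along the `φ^X_{-ξ}`-image of a horocycle arc of length one. -/
noncomputable def arcAvg (f : HomSpace Γ → ℂ) (y : HomSpace Γ) (ξ : ℝ) : ℂ :=
  ∫ s in (0 : ℝ)..1, f (geo (-ξ) (horo s y))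

lemma geo_neg_horo (ξ s : ℝ) (y : HomSpace Γ) :
    geo (-ξ) (horo s y) = horo (Real.exp ξ * s) (geo (-ξ) y) := by
  rw [horo_geo, ← mul_assoc, ← Real.exp_add, neg_add_cancel, Real.exp_zero, one_mul]

lemma continuous_arc {f : HomSpace Γ → ℂ} (hf : Continuous f) (y : HomSpace Γ) :
    Continuous (fun p : ℝ × ℝ => f (geo (-p.1) (horo p.2 y))) :=
  hf.comp (continuous_geo_of continuous_fst.neg (continuous_horo_of continuous_snd continuous_const))

lemma continuous_arc_right {f : HomSpace Γ → ℂ} (hf : Continuous f) (y : HomSpace Γ) (ξ : ℝ) :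
    Continuous (fun s : ℝ => f (geo (-ξ) (horo s y))) := by
  have := (continuous_arc hf y).comp (Continuous.prodMk_right ξ)
  exact this

@[simp] lemma arcAvg_zero (f : HomSpace Γ → ℂ) (y : HomSpace Γ) : arcAvg f y 0 = unitInt f y := by
  simp [arcAvg, unitInt]

/-- Flowing the unit arc at `φ^X_{log T} x` back by log T stretches it onto the arc of length T at
x. -/
lemma horoAverage_eq_arcAvg (f : HomSpace Γ → ℂ) (x : HomSpace Γ) {T : ℝ} (hT : 0 < T) :
    horoAverage f x T = arcAvg f (geo (Real.log T) x) (Real.log T) := by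
  have : ∀ s, geo (-Real.log T) (horo s (geo (Real.log T) x)) = horo (s * T) x := fun s => by
    rw [horo_geo, geo_geo, add_neg_cancel, geo_zero, Real.exp_log hT, mul_comm]
  simp only [arcAvg, this, horoAverage]
  rw [intervalIntegral.integral_comp_mul_right (fun t => f (horo t x)) hT.ne']
  simp

lemma norm_arcAvg_le {f : HomSpace Γ → ℂ} {C : ℝ} (hC : ∀ x, ‖f x‖ ≤ C) (y : HomSpace Γ) (ξ : ℝ) :
    ‖arcAvg f y ξ‖ ≤ C := by
  have := intervalIntegral.norm_integral_le_of_norm_le_const (a := 0) (b := 1)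
    (f := fun s => f (geo (-ξ) (horo s y))) (C := C) fun s _ => hC _
  rwa [sub_zero, abs_one, mul_one] at this

lemma norm_unitInt_le {f : HomSpace Γ → ℂ} {C : ℝ} (hC : ∀ x, ‖f x‖ ≤ C) (y : HomSpace Γ) :
    ‖unitInt f y‖ ≤ C := by
  simpa using norm_arcAvg_le hC y 0

variable {f : HomSpace Γ → ℂ}

lemma hasDerivAt_arcAvg [CompactSpace (HomSpace Γ)] (hf : IsCn 1 f) (y : HomSpace Γ) (ξ : ℝ) :
    HasDerivAt (arcAvg f y) (-arcAvg (derivX f) y ξ) ξ := by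
  obtain ⟨C, -, hC⟩ := exists_norm_le (continuous_derivX hf)
  have h := (intervalIntegral.hasDerivAt_integral_of_dominated_loc_of_deriv_le (μ := volume)
    (F := fun ξ s => f (geo (-ξ) (horo s y))) (F' := fun ξ s => -derivX f (geo (-ξ) (horo s y)))
    (x₀ := ξ) (a := 0) (b := 1) (bound := fun _ => C) (s := univ) univ_mem
    (Eventually.of_forall fun ξ => (continuous_arc_right hf.continuous y ξ).aestronglyMeasurable)
    ((continuous_arc_right hf.continuous y ξ).intervalIntegrable _ _)
    ((continuous_arc_right (continuous_derivX hf) y ξ).neg.aestronglyMeasurable)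
    (Eventually.of_forall fun s _ ξ _ => by rw [norm_neg]; exact hC _)
    (intervalIntegrable_const) (Eventually.of_forall fun s _ ξ _ => ?_)).2
  · rw [intervalIntegral.integral_neg] at h
    exact h
  · have := (hasDerivAt_geo hf (horo s y) (-ξ)).scomp ξ (hasDerivAt_neg ξ)
    simpa [Function.comp_def] using this

/-- Fundamental theorem of calculus along an arc traversed at speed e^ξ. This is the source of the
decay of the inhomogeneous term. -/
lemma arcAvg_derivU (hf : IsCn 1 f) (y : HomSpace Γ) (ξ : ℝ) :
    arcAvg (derivU f) y ξ
      = Real.exp (-ξ) * (f (geo (-ξ) (horo 1 y)) - f (geo (-ξ) y)) := by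
  have hd : ∀ s, HasDerivAt (fun s => f (geo (-ξ) (horo s y)))
      (Real.exp ξ * derivU f (geo (-ξ) (horo s y))) s := fun s => by
    simp only [geo_neg_horo]
    have := (hasDerivAt_horo hf (geo (-ξ) y) (Real.exp ξ * s)).scomp s
      ((hasDerivAt_id s).const_mul (Real.exp ξ))
    simpa [Function.comp_def] using this
  have hc : Continuous fun s => Real.exp ξ * derivU f (geo (-ξ) (horo s y)) :=
    continuous_const.mul (continuous_arc_right (continuous_derivU hf) y ξ)
  have := intervalIntegral.integral_eq_sub_of_hasDerivAt (fun s _ => hd s)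
    (hc.intervalIntegrable 0 1)
  rw [intervalIntegral.integral_const_mul, horo_zero] at this
  rw [← this, ← mul_assoc, ← Complex.ofReal_mul, ← Real.exp_add]
  simp [arcAvg]

/-- The eigenvalue equation replaces XXf by Xf - UVf - μf, and the average of UVf is a boundary
term. In view of `hasDerivAt_arcAvg` this is the equation a'' + a' + μa = e^{-ξ} G. -/
lemma arcAvg_derivX_derivX {μ : ℝ} (hf : IsCn 2 f)
    (heig : ∀ x, casimir f x = (μ : ℂ) * f x) (y : HomSpace Γ) (ξ : ℝ) :
    arcAvg (derivX (derivX f)) y ξ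
      = arcAvg (derivX f) y ξ - μ * arcAvg f y ξ + Real.exp (-ξ) * gFun f y ξ := by
  have h1 : ∀ x, derivX (derivX f) x = derivX f x - derivU (derivV f) x - μ * f x := fun x => by
    rw [← heig x, casimir]; ring
  have hi : ∀ {h : HomSpace Γ → ℂ}, Continuous h →
      IntervalIntegrable (fun s => h (geo (-ξ) (horo s y))) volume 0 1 := fun hh =>
    (continuous_arc_right hh y ξ).intervalIntegrable _ _
  have h2 := arcAvg_derivU hf.derivV' y ξ
  have h3 : arcAvg (derivX (derivX f)) y ξ
      = arcAvg (derivX f) y ξ - arcAvg (derivU (derivV f)) y ξ - μ * arcAvg f y ξ := by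
    simp only [arcAvg, h1]
    rw [intervalIntegral.integral_sub, intervalIntegral.integral_sub,
      intervalIntegral.integral_const_mul]
    exacts [hi (continuous_derivX hf.one), hi (continuous_derivU hf.derivV'),
      (hi (continuous_derivX hf.one)).sub (hi (continuous_derivU hf.derivV')),
      (hi hf.continuous).const_mul _]
  rw [h3, h2, gFun]
  ring

end Flow

/-! ### Variation of constants and the resulting estimates. -/

section Duhamel

/-- Variation of constants for `a'' + a' + μ a = b`, where `S` is the solution of the homogeneous
equation with `S 0 = 0` and `S' 0 = 1`. -/
lemma duhamel {μ : ℝ} {S S' : ℝ → ℝ} (hS : ∀ t, HasDerivAt S (S' t) t)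
    (hS' : ∀ t, HasDerivAt S' (-S' t - μ * S t) t) (h0 : S 0 = 0) (h0' : S' 0 = 1)
    {a a' b : ℝ → ℂ} (ha : ∀ t, HasDerivAt a (a' t) t)
    (ha' : ∀ t, HasDerivAt a' (-a' t - μ * a t + b t) t) (hb : Continuous b) (ξ : ℝ) :
    a ξ = ((S' ξ + S ξ : ℝ) : ℂ) * a 0 + (S ξ : ℂ) * a' 0
      + ∫ η in (0 : ℝ)..ξ, (S (ξ - η) : ℂ) * b η := by
  have hSc : Continuous S := continuous_iff_continuousAt.2 fun t => (hS t).continuousAt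
  -- This combination equals a(ξ) at η = ξ and the initial value terms at η = 0; the homogeneous
  -- equation for S cancels everything in its derivative except the source.
  have hd : ∀ η, HasDerivAt (fun η => ((S' (ξ - η) : ℝ) : ℂ) * a η
      + ((S (ξ - η) : ℝ) : ℂ) * (a' η + a η)) ((S (ξ - η) : ℂ) * b η) η := fun η => by
    have e : HasDerivAt (fun η : ℝ => ξ - η) (-1) η := (hasDerivAt_id η).const_sub ξ
    have e1 : HasDerivAt (fun η => ((S (ξ - η) : ℝ) : ℂ)) ((S' (ξ - η) * -1 : ℝ) : ℂ) η :=
      ((hS (ξ - η)).comp η e).ofReal_comp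
    have e2 : HasDerivAt (fun η => ((S' (ξ - η) : ℝ) : ℂ))
        (((-S' (ξ - η) - μ * S (ξ - η)) * -1 : ℝ) : ℂ) η :=
      ((hS' (ξ - η)).comp η e).ofReal_comp
    refine ((e2.mul (ha η)).add (e1.mul ((ha' η).add (ha η)))).congr_deriv ?_
    simp only [Pi.add_apply]
    push_cast
    ring
  have hc : Continuous fun η => (S (ξ - η) : ℂ) * b η :=
    (Complex.continuous_ofReal.comp (hSc.comp (continuous_const.sub continuous_id))).mul hb
  have := intervalIntegral.integral_eq_sub_of_hasDerivAt (fun η _ => hd η)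
    (hc.intervalIntegrable 0 ξ)
  rw [this]
  simp [h0, h0']
  ring

variable [CompactSpace (HomSpace Γ)] {f : HomSpace Γ → ℂ} {μ : ℝ} {S S' : ℝ → ℝ}

lemma arcAvg_eq (hf : IsCn 2 f) (heig : ∀ x, casimir f x = (μ : ℂ) * f x)
    (hS : ∀ t, HasDerivAt S (S' t) t) (hS' : ∀ t, HasDerivAt S' (-S' t - μ * S t) t)
    (h0 : S 0 = 0) (h0' : S' 0 = 1) (y : HomSpace Γ) (ξ : ℝ) :
    arcAvg f y ξ = ((S' ξ + S ξ : ℝ) : ℂ) * unitInt f y - (S ξ : ℂ) * unitInt (derivX f) y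
      + ∫ η in (0 : ℝ)..ξ, (S (ξ - η) * Real.exp (-η)) • gFun f y η := by
  have h := duhamel hS hS' h0 h0' (fun t => hasDerivAt_arcAvg hf.one y t)
    (b := fun η => Real.exp (-η) * gFun f y η)
    (fun t => (hasDerivAt_arcAvg hf.derivX' y t).neg.congr_deriv
      (by rw [arcAvg_derivX_derivX hf heig]; ring))
    ((Complex.continuous_ofReal.comp (Real.continuous_exp.comp continuous_neg)).mul
      (continuous_gFun_right hf y)) ξ
  rw [h, arcAvg_zero, arcAvg_zero, mul_neg, ← sub_eq_add_neg]
  simp [mul_assoc]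

lemma integrableOn_smul_gFun (hf : IsCn 2 f) (y : HomSpace Γ) {k : ℝ → ℝ} {s : Set ℝ}
    (hk : IntegrableOn k s) : IntegrableOn (fun η => k η • gFun f y η) s :=
  Integrable.smul_bdd hk (2 * c2Norm f)
    (continuous_gFun_right hf y).aestronglyMeasurable
    (Eventually.of_forall fun η => norm_gFun_le hf y η)

lemma norm_setIntegral_smul_gFun_le (hf : IsCn 2 f) (y : HomSpace Γ) {k β : ℝ → ℝ} {s : Set ℝ}
    (hs : MeasurableSet s) (hβ : IntegrableOn β s) (hk : ∀ η ∈ s, |k η| ≤ β η) :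
    ‖∫ η in s, k η • gFun f y η‖ ≤ 2 * c2Norm f * ∫ η in s, β η := by
  rw [← integral_const_mul]
  refine norm_integral_le_of_norm_le (hβ.const_mul _) ?_
  refine (ae_restrict_iff' hs).2 (Eventually.of_forall fun η hη => ?_)
  rw [norm_smul, Real.norm_eq_abs, mul_comm (2 * c2Norm f)]
  exact mul_le_mul (hk η hη) (norm_gFun_le hf y η) (norm_nonneg _)
    ((abs_nonneg _).trans (hk η hη))

lemma integrableOn_Ioi_comp_sub {β : ℝ → ℝ} (hβ : IntegrableOn β (Ioi 0)) (ξ : ℝ) :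
    IntegrableOn (fun η => β (η - ξ)) (Ioi ξ)
      ∧ ∫ η in Ioi ξ, β (η - ξ) = ∫ t in Ioi 0, β t := by
  have hp : (fun η : ℝ => η - ξ) ⁻¹' Ioi 0 = Ioi ξ := by ext; simp
  have hm := measurePreserving_sub_right (volume : Measure ℝ) ξ
  have he : MeasurableEmbedding (fun η : ℝ => η - ξ) :=
    (MeasurableEquiv.subRight ξ).measurableEmbedding
  rw [← hp]
  exact ⟨(hm.integrableOn_comp_preimage he).2 hβ, hm.setIntegral_preimage_emb he _ _⟩

/-- Replacing the finite range of integration in `arcAvg_eq` by a half line costs `O(e^{-ξ})`. -/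
lemma arcAvg_sub_main_le (hf : IsCn 2 f) (heig : ∀ x, casimir f x = (μ : ℂ) * f x)
    (hS : ∀ t, HasDerivAt S (S' t) t) (hS' : ∀ t, HasDerivAt S' (-S' t - μ * S t) t)
    (h0 : S 0 = 0) (h0' : S' 0 = 1) {β : ℝ → ℝ} (hβ : IntegrableOn β (Ioi 0))
    (hSβ : ∀ t, 0 < t → |S (-t) * Real.exp (-t)| ≤ β t)
    (y : HomSpace Γ) {ξ : ℝ} (hξ : 0 ≤ ξ) :
    ‖arcAvg f y ξ - (((S' ξ + S ξ : ℝ) : ℂ) * unitInt f y - (S ξ : ℂ) * unitInt (derivX f) y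
      + ∫ η in Ioi (0 : ℝ), (S (ξ - η) * Real.exp (-η)) • gFun f y η)‖
      ≤ 2 * c2Norm f * (∫ t in Ioi (0 : ℝ), β t) * Real.exp (-ξ) := by
  have hSc : Continuous S := continuous_iff_continuousAt.2 fun t => (hS t).continuousAt
  have hkc : Continuous fun η => S (ξ - η) * Real.exp (-η) := by fun_prop
  obtain ⟨hi, he⟩ := integrableOn_Ioi_comp_sub hβ ξ
  -- Beyond ξ the kernel is e^{-ξ} times its value for ξ = 0 at the shifted point η - ξ, so the tail
  -- costs e^{-ξ} times a constant.
  have hb : ∀ η ∈ Ioi ξ, |S (ξ - η) * Real.exp (-η)| ≤ Real.exp (-ξ) * β (η - ξ) := by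
    intro η hη
    have := hSβ (η - ξ) (sub_pos.2 hη)
    have e : S (ξ - η) * Real.exp (-η)
        = Real.exp (-ξ) * (S (-(η - ξ)) * Real.exp (-(η - ξ))) := by
      rw [neg_sub, mul_left_comm, ← Real.exp_add]; ring_nf
    rw [e, abs_mul, abs_of_pos (Real.exp_pos _)]
    exact mul_le_mul_of_nonneg_left this (Real.exp_pos _).le
  have hk1 : IntegrableOn (fun η => S (ξ - η) * Real.exp (-η)) (Ioi ξ) :=
    Integrable.mono' (hi.const_mul _) hkc.aestronglyMeasurable
      ((ae_restrict_iff' measurableSet_Ioi).2 (Eventually.of_forall hb))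
  have hk0 : IntegrableOn (fun η => S (ξ - η) * Real.exp (-η)) (Ioi 0) := by
    rw [← Ioc_union_Ioi_eq_Ioi hξ]
    exact (hkc.integrableOn_Ioc).union hk1
  have hsplit := intervalIntegral.integral_interval_add_Ioi (integrableOn_smul_gFun hf y hk0)
    (integrableOn_smul_gFun hf y hk1)
  rw [arcAvg_eq hf heig hS hS' h0 h0', ← hsplit, add_sub_add_left_eq_sub, sub_add_cancel_left,
    norm_neg]
  refine (norm_setIntegral_smul_gFun_le hf y measurableSet_Ioi (hi.const_mul _) hb).trans_eq ?_
  rw [integral_const_mul, he]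
  ring

lemma integrableOn_exp_neg_mul {a : ℝ} (ha : 0 < a) :
    IntegrableOn (fun t : ℝ => Real.exp (-(a * t))) (Ioi 0) := by
  simpa using integrableOn_exp_mul_Ioi (neg_neg_iff_pos.2 ha) 0

lemma integral_exp_neg_mul {a : ℝ} (ha : 0 < a) :
    ∫ t in Ioi (0 : ℝ), Real.exp (-(a * t)) = 1 / a := by
  have := integral_exp_mul_Ioi (neg_neg_iff_pos.2 ha) 0
  simpa using this

/-- A direct bound, uniform in the spectral parameter. -/
lemma norm_arcAvg_le_exp (hf : IsCn 2 f) (heig : ∀ x, casimir f x = (μ : ℂ) * f x)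
    (hS : ∀ t, HasDerivAt S (S' t) t) (hS' : ∀ t, HasDerivAt S' (-S' t - μ * S t) t)
    (h0 : S 0 = 0) (h0' : S' 0 = 1) {r : ℝ} (hr : -(1 / 2) ≤ r)
    (hSr : ∀ t, 0 ≤ t → |S t| ≤ t * Real.exp (r * t))
    (hSr' : ∀ t, 0 ≤ t → |S' t + S t| ≤ (1 + t / 2) * Real.exp (r * t))
    (y : HomSpace Γ) {ξ : ℝ} (hξ : 0 ≤ ξ) :
    ‖arcAvg f y ξ‖ ≤ 15 * (ξ + 1) * Real.exp (r * ξ) * c2Norm f := by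
  have hN := c2Norm_nonneg hf
  set N := c2Norm f
  have hE := Real.exp_pos (r * ξ)
  set E := Real.exp (r * ξ)
  have hint : ‖∫ η in (0 : ℝ)..ξ, (S (ξ - η) * Real.exp (-η)) • gFun f y η‖
      ≤ 4 * ξ * E * N := by
    rw [intervalIntegral.integral_of_le hξ]
    have hb : ∀ η ∈ Ioc 0 ξ, |S (ξ - η) * Real.exp (-η)|
        ≤ ξ * E * Real.exp (-(1 / 2 * η)) := by
      intro η hη
      rw [abs_mul, abs_of_pos (Real.exp_pos _)]
      have h1 := hSr (ξ - η) (sub_nonneg.2 hη.2)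
      -- The hypothesis r ≥ -1/2 gives r + 1 ≥ 1/2, which leaves the factor e^{-η/2} of integral 2
      -- whatever the spectral parameter is.
      have h2 : Real.exp (r * (ξ - η)) * Real.exp (-η) ≤ E * Real.exp (-(1 / 2 * η)) := by
        rw [← Real.exp_add, ← Real.exp_add]
        refine Real.exp_le_exp.2 ?_
        nlinarith [hη.1]
      calc |S (ξ - η)| * Real.exp (-η)
          ≤ (ξ - η) * Real.exp (r * (ξ - η)) * Real.exp (-η) :=
            mul_le_mul_of_nonneg_right h1 (Real.exp_pos _).le
        _ = (ξ - η) * (Real.exp (r * (ξ - η)) * Real.exp (-η)) := by ring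
        _ ≤ ξ * (E * Real.exp (-(1 / 2 * η))) :=
            mul_le_mul (by linarith [hη.1]) h2 (by positivity) hξ
        _ = _ := by ring
    have hi : IntegrableOn (fun η => ξ * E * Real.exp (-(1 / 2 * η))) (Ioi 0) :=
      (integrableOn_exp_neg_mul (a := 1 / 2) (by norm_num)).const_mul (ξ * E)
    have h1 := norm_setIntegral_smul_gFun_le hf y measurableSet_Ioc
      (hi.mono_set Ioc_subset_Ioi_self) hb
    have h2 : ∫ η in Ioc 0 ξ, ξ * E * Real.exp (-(1 / 2 * η)) ≤ ξ * E * 2 := by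
      refine (setIntegral_mono_set hi ?_ Ioc_subset_Ioi_self.eventuallyLE).trans_eq ?_
      · exact Eventually.of_forall fun η => by positivity
      · rw [integral_const_mul, integral_exp_neg_mul (by norm_num)]; norm_num
    refine h1.trans ((mul_le_mul_of_nonneg_left h2 (by positivity)).trans_eq (by ring))
  have hI : ‖unitInt f y‖ ≤ N := norm_unitInt_le (norm_le_c2Norm hf) y
  have hIX : ‖unitInt (derivX f) y‖ ≤ N := norm_unitInt_le (norm_derivX_le hf) y
  rw [arcAvg_eq hf heig hS hS' h0 h0']
  refine (norm_add_le _ _).trans ((add_le_add (norm_sub_le _ _) hint).trans ?_)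
  rw [norm_mul, norm_mul, Complex.norm_real, Complex.norm_real, Real.norm_eq_abs, Real.norm_eq_abs]
  have h1 := mul_le_mul (hSr' ξ hξ) hI (norm_nonneg _) (by positivity)
  have h2 := mul_le_mul (hSr ξ hξ) hIX (norm_nonneg _) (by positivity)
  have h3 : 0 ≤ E * N := by positivity
  have h4 : 0 ≤ ξ * (E * N) := by positivity
  nlinarith

end Duhamel


/-! ### Integrals of the exponential kernels. -/

section Kernels

lemma exp_neg_div_two (t : ℝ) : Real.exp (-t / 2) = Real.exp (-(1 / 2 * t)) := by ring_nf

lemma integrableOn_exp_neg_half : IntegrableOn (fun t : ℝ => Real.exp (-t / 2)) (Ioi 0) := by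
  simp only [exp_neg_div_two]
  exact integrableOn_exp_neg_mul (by norm_num)

lemma integral_exp_neg_half : ∫ t in Ioi (0 : ℝ), Real.exp (-t / 2) = 2 := by
  simp only [exp_neg_div_two]
  rw [integral_exp_neg_mul (by norm_num)]; norm_num

lemma hasDerivAt_mul_exp_neg_half (t : ℝ) :
    HasDerivAt (fun t : ℝ => -((2 * t + 4) * Real.exp (-t / 2))) (t * Real.exp (-t / 2)) t := by
  have h1 : HasDerivAt (fun t : ℝ => Real.exp (-t / 2)) (Real.exp (-t / 2) * (-1 / 2)) t :=
    ((hasDerivAt_id t).neg.div_const 2).exp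
  have h2 : HasDerivAt (fun t : ℝ => 2 * t + 4) (2 * 1) t :=
    ((hasDerivAt_id t).const_mul 2).add_const 4
  exact (h2.mul h1).neg.congr_deriv (by ring)

lemma tendsto_mul_exp_neg_half :
    Tendsto (fun t : ℝ => -((2 * t + 4) * Real.exp (-t / 2))) atTop (𝓝 0) := by
  have h1 : Tendsto (fun t : ℝ => t / 2) atTop atTop := tendsto_id.atTop_div_const two_pos
  have h2 := ((Real.tendsto_pow_mul_exp_neg_atTop_nhds_zero 1).comp h1).const_mul 4
  have h3 := (Real.tendsto_exp_neg_atTop_nhds_zero.comp h1).const_mul 4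
  have := (h2.add h3).neg
  simp only [mul_zero, add_zero, neg_zero] at this
  refine this.congr fun t => ?_
  simp only [Function.comp_apply, neg_div]
  ring

lemma integrableOn_mul_exp_neg_half :
    IntegrableOn (fun t : ℝ => t * Real.exp (-t / 2)) (Ioi 0) :=
  integrableOn_Ioi_deriv_of_nonneg' (fun t _ => hasDerivAt_mul_exp_neg_half t)
    (fun t ht => mul_nonneg (le_of_lt ht) (Real.exp_pos _).le) tendsto_mul_exp_neg_half

lemma integral_mul_exp_neg_half : ∫ t in Ioi (0 : ℝ), t * Real.exp (-t / 2) = 4 := by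
  rw [integral_Ioi_of_hasDerivAt_of_nonneg' (fun t _ => hasDerivAt_mul_exp_neg_half t)
    (fun t ht => mul_nonneg (le_of_lt ht) (Real.exp_pos _).le) tendsto_mul_exp_neg_half]
  simp

lemma IntegrableOn.of_abs_le {k β : ℝ → ℝ} (hk : Continuous k) (hβ : IntegrableOn β (Ioi 0))
    (h : ∀ t ∈ Ioi (0 : ℝ), |k t| ≤ β t) : IntegrableOn k (Ioi 0) :=
  Integrable.mono' hβ hk.aestronglyMeasurable
    ((ae_restrict_iff' measurableSet_Ioi).2 (Eventually.of_forall h))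

lemma integral_smul_sub_smul {F G : ℝ → ℂ} {s : Set ℝ} (hF : IntegrableOn F s)
    (hG : IntegrableOn G s) (a b : ℝ) :
    ∫ t in s, (a • F t - b • G t) = a • (∫ t in s, F t) - b • ∫ t in s, G t := by
  have h1 : IntegrableOn (fun t => a • F t) s := Integrable.smul a hF
  have h2 : IntegrableOn (fun t => b • G t) s := Integrable.smul b hG
  rw [integral_sub h1 h2, integral_smul, integral_smul]

lemma rpow_eq_exp_log {T : ℝ} (hT : 1 ≤ T) (a : ℝ) : T ^ a = Real.exp (a * Real.log T) := by
  rw [Real.rpow_def_of_pos (by linarith), mul_comm]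

lemma inv_eq_exp_log {T : ℝ} (hT : 1 ≤ T) : T⁻¹ = Real.exp (-Real.log T) := by
  rw [Real.exp_neg, Real.exp_log (by linarith)]

lemma hasDerivAt_exp_mul (r t : ℝ) :
    HasDerivAt (fun t : ℝ => Real.exp (r * t)) (r * Real.exp (r * t)) t := by
  simpa [mul_comm] using ((hasDerivAt_id t).const_mul r).exp

end Kernels

/-! ### Asymptotic expansions for positive eigenvalues. -/

section Expansions

variable [CompactSpace (HomSpace Γ)] {f : HomSpace Γ → ℂ} {μ : ℝ}

/-! ### Eigenvalues above 1/4: oscillating solutions. -/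

section Principal

variable {y : ℝ}

/-- The fundamental solution for `μ = (1 + y²) / 4`. -/
noncomputable def princS (y t : ℝ) : ℝ := 2 / y * (Real.exp (-t / 2) * Real.sin (y / 2 * t))

/-- The derivative of `princS`. -/
noncomputable def princS' (y t : ℝ) : ℝ :=
  Real.exp (-t / 2) * Real.cos (y / 2 * t) - 1 / 2 * princS y t

lemma hasDerivAt_princ_aux (y t : ℝ) :
    HasDerivAt (fun t : ℝ => Real.exp (-t / 2) * Real.sin (y / 2 * t))
      (y / 2 * (Real.exp (-t / 2) * Real.cos (y / 2 * t))
        - 1 / 2 * (Real.exp (-t / 2) * Real.sin (y / 2 * t))) t ∧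
    HasDerivAt (fun t : ℝ => Real.exp (-t / 2) * Real.cos (y / 2 * t))
      (-(y / 2) * (Real.exp (-t / 2) * Real.sin (y / 2 * t))
        - 1 / 2 * (Real.exp (-t / 2) * Real.cos (y / 2 * t))) t := by
  have h1 : HasDerivAt (fun t : ℝ => Real.exp (-t / 2)) (Real.exp (-t / 2) * (-1 / 2)) t :=
    ((hasDerivAt_id t).neg.div_const 2).exp
  have h2 : HasDerivAt (fun t : ℝ => y / 2 * t) (y / 2 * 1) t := (hasDerivAt_id t).const_mul _
  exact ⟨(h1.mul h2.sin).congr_deriv (by ring), (h1.mul h2.cos).congr_deriv (by ring)⟩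

lemma hasDerivAt_princS (hy : 0 < y) (t : ℝ) : HasDerivAt (princS y) (princS' y t) t :=
  ((hasDerivAt_princ_aux y t).1.const_mul (2 / y)).congr_deriv (by
    simp only [princS', princS]; field_simp)

lemma hasDerivAt_princS' (hy : 0 < y) (t : ℝ) :
    HasDerivAt (princS' y) (-princS' y t - (1 + y ^ 2) / 4 * princS y t) t :=
  ((hasDerivAt_princ_aux y t).2.sub ((hasDerivAt_princS hy t).const_mul (1 / 2))).congr_deriv (by
    simp only [princS', princS]; field_simp; ring)

lemma abs_princS_neg_le (hy : 0 < y) (t : ℝ) :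
    |princS y (-t) * Real.exp (-t)| ≤ 2 / y * Real.exp (-t / 2) := by
  have e : princS y (-t) * Real.exp (-t)
      = 2 / y * Real.exp (-t / 2) * Real.sin (y / 2 * -t) := by
    have : Real.exp (-t / 2) = Real.exp (- -t / 2) * Real.exp (-t) := by
      rw [← Real.exp_add]; ring_nf
    rw [princS, this]; ring
  rw [e, abs_mul, abs_of_pos (by positivity)]
  exact mul_le_of_le_one_right (by positivity) (Real.abs_sin_le_one _)

/-- The bound |sin u| ≤ |u| absorbs the factor 2/y at the price of a factor t, making the estimate
uniform as y tends to 0. -/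
lemma abs_princS_le (hy : 0 < y) {t : ℝ} (ht : 0 ≤ t) :
    |princS y t| ≤ t * Real.exp (-(1 / 2) * t) := by
  have h := Real.abs_sin_le_abs (x := y / 2 * t)
  rw [abs_of_nonneg (by positivity : 0 ≤ y / 2 * t)] at h
  have e : Real.exp (-t / 2) = Real.exp (-(1 / 2) * t) := by ring_nf
  rw [princS, abs_mul, abs_mul, abs_of_pos (Real.exp_pos _), abs_of_pos (by positivity : 0 < 2 / y),
    e]
  calc 2 / y * (Real.exp (-(1 / 2) * t) * |Real.sin (y / 2 * t)|)
      ≤ 2 / y * (Real.exp (-(1 / 2) * t) * (y / 2 * t)) := by gcongr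
    _ = _ := by field_simp

lemma abs_princS'_add_le (hy : 0 < y) {t : ℝ} (ht : 0 ≤ t) :
    |princS' y t + princS y t| ≤ (1 + t / 2) * Real.exp (-(1 / 2) * t) := by
  have h := abs_princS_le hy ht
  have e : Real.exp (-t / 2) = Real.exp (-(1 / 2) * t) := by ring_nf
  have e2 : princS' y t + princS y t
      = Real.exp (-(1 / 2) * t) * Real.cos (y / 2 * t) + 1 / 2 * princS y t := by
    rw [princS', e]; ring
  have h2 : |Real.exp (-(1 / 2) * t) * Real.cos (y / 2 * t)| ≤ Real.exp (-(1 / 2) * t) := by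
    rw [abs_mul, abs_of_pos (Real.exp_pos _)]
    exact mul_le_of_le_one_right (Real.exp_pos _).le (Real.abs_cos_le_one _)
  rw [e2]
  refine (abs_add_le _ _).trans ?_
  rw [abs_mul (1 / 2), abs_of_pos (by norm_num : (0 : ℝ) < 1 / 2)]
  linarith

lemma integrableOn_princ_sin (y : ℝ) :
    IntegrableOn (fun η => Real.exp (-η / 2) * Real.sin (y / 2 * η)) (Ioi 0) :=
  IntegrableOn.of_abs_le (by fun_prop) integrableOn_exp_neg_half fun t _ => by
    rw [abs_mul, abs_of_pos (Real.exp_pos _)]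
    exact mul_le_of_le_one_right (Real.exp_pos _).le (Real.abs_sin_le_one _)

lemma integrableOn_princ_cos (y : ℝ) :
    IntegrableOn (fun η => Real.exp (-η / 2) * Real.cos (y / 2 * η)) (Ioi 0) :=
  IntegrableOn.of_abs_le (by fun_prop) integrableOn_exp_neg_half fun t _ => by
    rw [abs_mul, abs_of_pos (Real.exp_pos _)]
    exact mul_le_of_le_one_right (Real.exp_pos _).le (Real.abs_cos_le_one _)

lemma norm_princ_sin_le (hf : IsCn 2 f) (x : HomSpace Γ) :
    ‖∫ ξ in Ioi (0 : ℝ), (Real.exp (-ξ / 2) * Real.sin (y / 2 * ξ)) • gFun f x ξ‖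
      ≤ 4 * c2Norm f := by
  refine (norm_setIntegral_smul_gFun_le hf x measurableSet_Ioi integrableOn_exp_neg_half
    fun t _ => ?_).trans_eq (by rw [integral_exp_neg_half]; ring)
  rw [abs_mul, abs_of_pos (Real.exp_pos _)]
  exact mul_le_of_le_one_right (Real.exp_pos _).le (Real.abs_sin_le_one _)

lemma norm_princ_cos_le (hf : IsCn 2 f) (x : HomSpace Γ) :
    ‖∫ ξ in Ioi (0 : ℝ), (Real.exp (-ξ / 2) * Real.cos (y / 2 * ξ)) • gFun f x ξ‖
      ≤ 4 * c2Norm f := by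
  refine (norm_setIntegral_smul_gFun_le hf x measurableSet_Ioi integrableOn_exp_neg_half
    fun t _ => ?_).trans_eq (by rw [integral_exp_neg_half]; ring)
  rw [abs_mul, abs_of_pos (Real.exp_pos _)]
  exact mul_le_of_le_one_right (Real.exp_pos _).le (Real.abs_cos_le_one _)

lemma norm_princPlus_le (hf : IsCn 2 f) (hy : 0 < y) (x : HomSpace Γ) :
    ‖princPlus y f x‖ ≤ (11 / y + 1) * c2Norm f := by
  have hN := c2Norm_nonneg hf
  have h1 := norm_princ_sin_le (y := y) hf x
  have h2 := norm_unitInt_le (norm_le_c2Norm hf) x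
  rw [princPlus]
  refine (norm_add_le _ _).trans ?_
  rw [norm_neg, norm_smul, Real.norm_of_nonneg (by positivity)]
  have h3 := mul_le_mul_of_nonneg_left h1 (by positivity : 0 ≤ 2 / y)
  have h4 : 0 ≤ c2Norm f / y := by positivity
  calc _ ≤ 2 / y * (4 * c2Norm f) + c2Norm f := add_le_add h3 h2
    _ = 8 * (c2Norm f / y) + c2Norm f := by ring
    _ ≤ 11 * (c2Norm f / y) + c2Norm f := by linarith
    _ = _ := by ring

lemma norm_princMinus_le (hf : IsCn 2 f) (hy : 0 < y) (x : HomSpace Γ) :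
    ‖princMinus y f x‖ ≤ (11 / y + 1) * c2Norm f := by
  have hN := c2Norm_nonneg hf
  have h1 := norm_princ_cos_le (y := y) hf x
  have h2 := norm_unitInt_le (norm_le_c2Norm hf) x
  have h3 := norm_unitInt_le (norm_derivX_le hf) x
  rw [princMinus]
  refine (norm_sub_le _ _).trans ((add_le_add_left (norm_add_le _ _) _).trans ?_)
  rw [norm_smul, norm_smul, norm_smul, Real.norm_of_nonneg (by positivity),
    Real.norm_of_nonneg (by positivity)]
  have h4 := mul_le_mul_of_nonneg_left h1 (by positivity : 0 ≤ 2 / y)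
  have h5 := mul_le_mul_of_nonneg_left h2 (by positivity : 0 ≤ 1 / y)
  have h6 := mul_le_mul_of_nonneg_left h3 (by positivity : 0 ≤ 2 / y)
  calc _ ≤ 2 / y * (4 * c2Norm f) + 1 / y * c2Norm f + 2 / y * c2Norm f :=
        add_le_add (add_le_add h4 h5) h6
    _ = 11 / y * c2Norm f := by ring
    _ ≤ _ := by linarith

lemma princ_expansion (hf : IsCn 2 f) (hy : 0 < y)
    (heig : ∀ x, casimir f x = (((1 + y ^ 2) / 4 : ℝ) : ℂ) * f x) (x : HomSpace Γ) {ξ : ℝ}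
    (hξ : 0 ≤ ξ) :
    ‖arcAvg f x ξ - ((Real.exp (-ξ / 2) * Real.cos (y / 2 * ξ)) • princPlus y f x
        + (Real.exp (-ξ / 2) * Real.sin (y / 2 * ξ)) • princMinus y f x)‖
      ≤ 16 / y * c2Norm f * Real.exp (-ξ) := by
  have h := arcAvg_sub_main_le hf heig (hasDerivAt_princS hy) (hasDerivAt_princS' hy)
    (by simp [princS]) (by simp [princS', princS]) (integrableOn_exp_neg_half.const_mul (2 / y))
    (fun t _ => abs_princS_neg_le hy t) x hξ
  rw [integral_const_mul, integral_exp_neg_half] at h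
  -- The subtraction formula for the sine separates ξ from η. The cosine and sine moments of G
  -- thereby become parts of `princMinus` and `princPlus`.
  have hk : ∀ η, (princS y (ξ - η) * Real.exp (-η)) • gFun f x η
      = (2 / y * (Real.exp (-ξ / 2) * Real.sin (y / 2 * ξ))) •
          ((Real.exp (-η / 2) * Real.cos (y / 2 * η)) • gFun f x η)
        - (2 / y * (Real.exp (-ξ / 2) * Real.cos (y / 2 * ξ))) •
          ((Real.exp (-η / 2) * Real.sin (y / 2 * η)) • gFun f x η) := fun η => by
    have e : Real.exp (-(ξ - η) / 2) * Real.exp (-η) = Real.exp (-ξ / 2) * Real.exp (-η / 2) := by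
      rw [← Real.exp_add, ← Real.exp_add]; ring_nf
    rw [smul_smul, smul_smul, ← sub_smul, princS, mul_sub (y / 2), Real.sin_sub]
    congr 1
    linear_combination (2 / y * (Real.sin (y / 2 * ξ) * Real.cos (y / 2 * η)
      - Real.cos (y / 2 * ξ) * Real.sin (y / 2 * η))) * e
  have hI : ∫ η in Ioi (0 : ℝ), (princS y (ξ - η) * Real.exp (-η)) • gFun f x η
      = (2 / y * (Real.exp (-ξ / 2) * Real.sin (y / 2 * ξ))) •
          (∫ η in Ioi (0 : ℝ), (Real.exp (-η / 2) * Real.cos (y / 2 * η)) • gFun f x η)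
        - (2 / y * (Real.exp (-ξ / 2) * Real.cos (y / 2 * ξ))) •
          (∫ η in Ioi (0 : ℝ), (Real.exp (-η / 2) * Real.sin (y / 2 * η)) • gFun f x η) := by
    simp only [hk]
    exact integral_smul_sub_smul (integrableOn_smul_gFun hf x (integrableOn_princ_cos y))
      (integrableOn_smul_gFun hf x (integrableOn_princ_sin y)) _ _
  rw [hI] at h
  refine (le_of_eq ?_).trans (h.trans ?_)
  · congr 2
    simp only [princPlus, princMinus, princS, princS', Complex.real_smul]
    push_cast
    ring
  · refine mul_le_mul_of_nonneg_right ?_ (Real.exp_pos _).le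
    have : 0 ≤ c2Norm f / y := div_nonneg (c2Norm_nonneg hf) hy.le
    calc _ = 8 * (c2Norm f / y) := by ring
      _ ≤ 16 * (c2Norm f / y) := by linarith
      _ = _ := by ring

lemma princ_bound (hf : IsCn 2 f) (hy : 0 < y)
    (heig : ∀ x, casimir f x = (((1 + y ^ 2) / 4 : ℝ) : ℂ) * f x) (x : HomSpace Γ) {ξ : ℝ}
    (hξ : 0 ≤ ξ) :
    ‖arcAvg f x ξ‖ ≤ 15 * (ξ + 1) * Real.exp (-(1 / 2) * ξ) * c2Norm f :=
  norm_arcAvg_le_exp hf heig (hasDerivAt_princS hy) (hasDerivAt_princS' hy)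
    (by simp [princS]) (by simp [princS', princS]) le_rfl (fun _ => abs_princS_le hy)
    (fun _ => abs_princS'_add_le hy) x hξ

end Principal

/-! ### The eigenvalue 1/4: a double characteristic exponent. -/

section Quarter

/-- The fundamental solution for `μ = 1 / 4`. -/
noncomputable def quarterS (t : ℝ) : ℝ := t * Real.exp (-t / 2)

/-- The derivative of `quarterS`. -/
noncomputable def quarterS' (t : ℝ) : ℝ := Real.exp (-t / 2) - 1 / 2 * quarterS t

lemma hasDerivAt_exp_neg_half (t : ℝ) :
    HasDerivAt (fun t : ℝ => Real.exp (-t / 2)) (-(1 / 2) * Real.exp (-t / 2)) t :=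
  (((hasDerivAt_id t).neg.div_const 2).exp).congr_deriv (by simp; ring)

lemma hasDerivAt_quarterS (t : ℝ) : HasDerivAt quarterS (quarterS' t) t :=
  ((hasDerivAt_id t).mul (hasDerivAt_exp_neg_half t)).congr_deriv (by
    simp only [quarterS', quarterS, id]; ring)

lemma hasDerivAt_quarterS' (t : ℝ) :
    HasDerivAt quarterS' (-quarterS' t - 1 / 4 * quarterS t) t :=
  ((hasDerivAt_exp_neg_half t).sub ((hasDerivAt_quarterS t).const_mul (1 / 2))).congr_deriv (by
    simp only [quarterS', quarterS]; ring)

lemma norm_quarter_exp_le (hf : IsCn 2 f) (x : HomSpace Γ) :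
    ‖∫ ξ in Ioi (0 : ℝ), Real.exp (-ξ / 2) • gFun f x ξ‖ ≤ 4 * c2Norm f :=
  (norm_setIntegral_smul_gFun_le hf x measurableSet_Ioi integrableOn_exp_neg_half
    fun t _ => (abs_of_pos (Real.exp_pos _)).le).trans_eq (by rw [integral_exp_neg_half]; ring)

lemma norm_quarter_mul_exp_le (hf : IsCn 2 f) (x : HomSpace Γ) :
    ‖∫ ξ in Ioi (0 : ℝ), (ξ * Real.exp (-ξ / 2)) • gFun f x ξ‖ ≤ 8 * c2Norm f :=
  (norm_setIntegral_smul_gFun_le hf x measurableSet_Ioi integrableOn_mul_exp_neg_half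
    fun t ht => (abs_of_nonneg (mul_nonneg (le_of_lt ht) (Real.exp_pos _).le)).le).trans_eq
      (by rw [integral_mul_exp_neg_half]; ring)

lemma norm_quarterPlus_le (hf : IsCn 2 f) (x : HomSpace Γ) :
    ‖quarterPlus f x‖ ≤ 9 * c2Norm f := by
  have h1 := norm_quarter_mul_exp_le hf x
  have h2 := norm_unitInt_le (norm_le_c2Norm hf) x
  rw [quarterPlus]
  refine (norm_add_le _ _).trans ?_
  rw [norm_neg]
  linarith

lemma norm_quarterMinus_le (hf : IsCn 2 f) (x : HomSpace Γ) :
    ‖quarterMinus f x‖ ≤ 9 * c2Norm f := by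
  have hN := c2Norm_nonneg hf
  have h1 := norm_quarter_exp_le hf x
  have h2 := norm_unitInt_le (norm_le_c2Norm hf) x
  have h3 := norm_unitInt_le (norm_derivX_le hf) x
  rw [quarterMinus]
  refine (norm_sub_le _ _).trans ((add_le_add_left (norm_add_le _ _) _).trans ?_)
  rw [norm_smul, Real.norm_of_nonneg (by norm_num)]
  linarith

lemma quarter_expansion (hf : IsCn 2 f)
    (heig : ∀ x, casimir f x = ((1 / 4 : ℝ) : ℂ) * f x) (x : HomSpace Γ) {ξ : ℝ}
    (hξ : 0 ≤ ξ) :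
    ‖arcAvg f x ξ - (Real.exp (-ξ / 2) • quarterPlus f x
        + (Real.exp (-ξ / 2) * ξ) • quarterMinus f x)‖
      ≤ 8 * c2Norm f * Real.exp (-ξ) := by
  have h := arcAvg_sub_main_le hf heig hasDerivAt_quarterS hasDerivAt_quarterS'
    (by simp [quarterS]) (by simp [quarterS', quarterS]) integrableOn_mul_exp_neg_half
    (fun t ht => by
      have : Real.exp (-t / 2) = Real.exp (- -t / 2) * Real.exp (-t) := by
        rw [← Real.exp_add]; ring_nf
      rw [quarterS, mul_assoc, ← this, abs_mul, abs_neg, abs_of_pos ht,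
        abs_of_pos (Real.exp_pos _)]) x hξ
  rw [integral_mul_exp_neg_half] at h
  -- Here the separation is linear: the factor ξ - η yields one term with ξ outside the integral,
  -- the source of log T, and one with η inside it.
  have hk : ∀ η, (quarterS (ξ - η) * Real.exp (-η)) • gFun f x η
      = (Real.exp (-ξ / 2) * ξ) • (Real.exp (-η / 2) • gFun f x η)
        - Real.exp (-ξ / 2) • ((η * Real.exp (-η / 2)) • gFun f x η) := fun η => by
    have e : Real.exp (-(ξ - η) / 2) * Real.exp (-η) = Real.exp (-ξ / 2) * Real.exp (-η / 2) := by
      rw [← Real.exp_add, ← Real.exp_add]; ring_nf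
    rw [smul_smul, smul_smul, ← sub_smul, quarterS]
    congr 1
    linear_combination (ξ - η) * e
  have hI : ∫ η in Ioi (0 : ℝ), (quarterS (ξ - η) * Real.exp (-η)) • gFun f x η
      = (Real.exp (-ξ / 2) * ξ) • (∫ η in Ioi (0 : ℝ), Real.exp (-η / 2) • gFun f x η)
        - Real.exp (-ξ / 2) • (∫ η in Ioi (0 : ℝ), (η * Real.exp (-η / 2)) • gFun f x η) := by
    simp only [hk]
    exact integral_smul_sub_smul (integrableOn_smul_gFun hf x integrableOn_exp_neg_half)
      (integrableOn_smul_gFun hf x integrableOn_mul_exp_neg_half) _ _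
  rw [hI] at h
  refine (le_of_eq ?_).trans (h.trans_eq (by ring))
  congr 2
  simp only [quarterPlus, quarterMinus, quarterS, quarterS', Complex.real_smul]
  push_cast
  ring

end Quarter

/-! ### Eigenvalues between 0 and 1/4: two real exponents. -/

section Complementary

variable {n : ℝ}

/-- The fundamental solution for `μ = (1 - n²) / 4`. -/
noncomputable def compS (n t : ℝ) : ℝ :=
  1 / n * (Real.exp (-((1 - n) / 2) * t) - Real.exp (-((1 + n) / 2) * t))

/-- The derivative of `compS`. -/
noncomputable def compS' (n t : ℝ) : ℝ :=
  1 / n * (-((1 - n) / 2) * Real.exp (-((1 - n) / 2) * t)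
    - -((1 + n) / 2) * Real.exp (-((1 + n) / 2) * t))

lemma hasDerivAt_compS (n t : ℝ) : HasDerivAt (compS n) (compS' n t) t :=
  ((hasDerivAt_exp_mul _ t).sub (hasDerivAt_exp_mul _ t)).const_mul _

lemma hasDerivAt_compS' (n t : ℝ) :
    HasDerivAt (compS' n) (-compS' n t - (1 - n ^ 2) / 4 * compS n t) t :=
  ((((hasDerivAt_exp_mul _ t).const_mul _).sub
    ((hasDerivAt_exp_mul _ t).const_mul _)).const_mul _).congr_deriv (by
    simp only [compS', compS]; ring)

lemma compS_zero (n : ℝ) : compS n 0 = 0 := by simp [compS]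

lemma compS'_zero (hn : 0 < n) : compS' n 0 = 1 := by
  simp [compS']; field_simp; ring

lemma abs_compS_neg_le (hn : 0 < n) (t : ℝ) :
    |compS n (-t) * Real.exp (-t)|
      ≤ 1 / n * (Real.exp (-((1 + n) / 2 * t)) + Real.exp (-((1 - n) / 2 * t))) := by
  have e : compS n (-t) * Real.exp (-t)
      = 1 / n * (Real.exp (-((1 + n) / 2 * t)) - Real.exp (-((1 - n) / 2 * t))) := by
    rw [compS, mul_assoc, sub_mul, ← Real.exp_add, ← Real.exp_add]
    ring_nf
  rw [e, abs_mul, abs_of_pos (by positivity : 0 < 1 / n)]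
  refine mul_le_mul_of_nonneg_left ?_ (by positivity)
  refine (abs_sub _ _).trans_eq ?_
  rw [abs_of_pos (Real.exp_pos _), abs_of_pos (Real.exp_pos _)]

/-- The inequality 1 - e^{-nt} ≤ nt cancels the factor 1/n, so that the bound survives as n tends to
0. -/
lemma compS_nonneg_le (hn : 0 < n) {t : ℝ} (ht : 0 ≤ t) :
    0 ≤ compS n t ∧ compS n t ≤ t * Real.exp (-((1 - n) / 2) * t) := by
  have e : Real.exp (-((1 + n) / 2) * t)
      = Real.exp (-((1 - n) / 2) * t) * Real.exp (-(n * t)) := by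
    rw [← Real.exp_add]; ring_nf
  have h1 : 1 - n * t ≤ Real.exp (-(n * t)) := by linarith [Real.add_one_le_exp (-(n * t))]
  have h2 : Real.exp (-(n * t)) ≤ 1 := Real.exp_le_one_iff.2 (by nlinarith)
  have hE := Real.exp_pos (-((1 - n) / 2) * t)
  rw [compS, e]
  constructor
  · have : 0 ≤ 1 - Real.exp (-(n * t)) := by linarith
    calc (0 : ℝ) ≤ 1 / n * (Real.exp (-((1 - n) / 2) * t) * (1 - Real.exp (-(n * t)))) := by
          positivity
      _ = _ := by ring
  · calc _ = 1 / n * (Real.exp (-((1 - n) / 2) * t) * (1 - Real.exp (-(n * t)))) := by ring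
      _ ≤ 1 / n * (Real.exp (-((1 - n) / 2) * t) * (n * t)) := by gcongr; linarith
      _ = _ := by field_simp

lemma abs_compS_le (hn : 0 < n) {t : ℝ} (ht : 0 ≤ t) :
    |compS n t| ≤ t * Real.exp (-((1 - n) / 2) * t) := by
  obtain ⟨h1, h2⟩ := compS_nonneg_le hn ht
  rwa [abs_of_nonneg h1]

lemma abs_compS'_add_le (hn : 0 < n) {t : ℝ} (ht : 0 ≤ t) :
    |compS' n t + compS n t| ≤ (1 + t / 2) * Real.exp (-((1 - n) / 2) * t) := by
  obtain ⟨h1, h2⟩ := compS_nonneg_le hn ht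
  have e : compS' n t + compS n t = 1 / 2 * compS n t
      + 1 / 2 * (Real.exp (-((1 - n) / 2) * t) + Real.exp (-((1 + n) / 2) * t)) := by
    simp only [compS', compS]; field_simp; ring
  have h3 : Real.exp (-((1 + n) / 2) * t) ≤ Real.exp (-((1 - n) / 2) * t) :=
    Real.exp_le_exp.2 (by nlinarith)
  have := Real.exp_pos (-((1 + n) / 2) * t)
  rw [e, abs_of_nonneg (by positivity)]
  linarith

lemma norm_comp_exp_le (hf : IsCn 2 f) {a : ℝ} (ha : 0 < a) (x : HomSpace Γ) :
    ‖∫ ξ in Ioi (0 : ℝ), Real.exp (-(a * ξ)) • gFun f x ξ‖ ≤ 2 / a * c2Norm f :=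
  (norm_setIntegral_smul_gFun_le hf x measurableSet_Ioi (integrableOn_exp_neg_mul ha)
    fun t _ => (abs_of_pos (Real.exp_pos _)).le).trans_eq (by rw [integral_exp_neg_mul ha]; ring)

lemma norm_compPlus_le (hf : IsCn 2 f) (hn : 0 < n) (hn1 : n < 1) (x : HomSpace Γ) :
    ‖compPlus n f x‖ ≤ 6 / (n * (1 - n)) * c2Norm f := by
  have hN := c2Norm_nonneg hf
  have hm : 0 < 1 - n := by linarith
  have h1 := norm_comp_exp_le hf (a := (1 - n) / 2) (by linarith) x
  have h2 := norm_unitInt_le (norm_le_c2Norm hf) x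
  have h3 := norm_unitInt_le (norm_derivX_le hf) x
  rw [compPlus]
  refine (norm_add_le _ _).trans ((add_le_add_left (norm_sub_le _ _) _).trans ?_)
  rw [norm_neg, norm_smul, norm_smul, norm_smul, Real.norm_of_nonneg (by positivity),
    Real.norm_of_nonneg (by positivity)]
  have h4 := mul_le_mul_of_nonneg_left h1 (by positivity : 0 ≤ 1 / n)
  have h5 := mul_le_mul_of_nonneg_left h2 (by positivity : 0 ≤ (1 - n) / (2 * n))
  have h6 := mul_le_mul_of_nonneg_left h3 (by positivity : 0 ≤ 1 / n)
  calc _ ≤ 1 / n * (2 / ((1 - n) / 2) * c2Norm f) + (1 - n) / (2 * n) * c2Norm f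
        + 1 / n * c2Norm f := add_le_add (add_le_add h4 h5) h6
    _ = (4 + (1 - n) ^ 2 / 2 + (1 - n)) / (n * (1 - n)) * c2Norm f := by field_simp; ring
    _ ≤ _ := by gcongr; nlinarith

lemma norm_compMinus_le (hf : IsCn 2 f) (hn : 0 < n) (hn1 : n < 1) (x : HomSpace Γ) :
    ‖compMinus n f x‖ ≤ 6 / (n * (1 - n)) * c2Norm f := by
  have hN := c2Norm_nonneg hf
  have hm : 0 < 1 - n := by linarith
  have h1 := norm_comp_exp_le hf (a := (1 + n) / 2) (by linarith) x
  have h2 := norm_unitInt_le (norm_le_c2Norm hf) x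
  have h3 := norm_unitInt_le (norm_derivX_le hf) x
  rw [compMinus]
  refine (norm_sub_le _ _).trans ((add_le_add_left (norm_add_le _ _) _).trans ?_)
  rw [norm_smul, norm_smul, norm_smul, Real.norm_of_nonneg (by positivity),
    Real.norm_of_nonneg (by positivity)]
  have h4 := mul_le_mul_of_nonneg_left h1 (by positivity : 0 ≤ 1 / n)
  have h5 := mul_le_mul_of_nonneg_left h2 (by positivity : 0 ≤ (1 + n) / (2 * n))
  have h6 := mul_le_mul_of_nonneg_left h3 (by positivity : 0 ≤ 1 / n)
  have h7 : 4 / (1 + n) ≤ 4 := by rw [div_le_iff₀ (by linarith)]; nlinarith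
  have h8 := mul_le_mul_of_nonneg_right h7 hm.le
  calc _ ≤ 1 / n * (2 / ((1 + n) / 2) * c2Norm f) + (1 + n) / (2 * n) * c2Norm f
        + 1 / n * c2Norm f := add_le_add (add_le_add h4 h5) h6
    _ = (4 / (1 + n) * (1 - n) + (1 + n) * (1 - n) / 2 + (1 - n)) / (n * (1 - n))
        * c2Norm f := by field_simp; ring
    _ ≤ _ := by gcongr; nlinarith

lemma comp_expansion (hf : IsCn 2 f) (hn : 0 < n) (hn1 : n < 1)
    (heig : ∀ x, casimir f x = (((1 - n ^ 2) / 4 : ℝ) : ℂ) * f x) (x : HomSpace Γ) {ξ : ℝ}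
    (hξ : 0 ≤ ξ) :
    ‖arcAvg f x ξ - (Real.exp (-((1 + n) / 2) * ξ) • compPlus n f x
        + Real.exp (-((1 - n) / 2) * ξ) • compMinus n f x)‖
      ≤ 8 / ((1 - n ^ 2) * n) * c2Norm f * Real.exp (-ξ) := by
  have hm : 0 < 1 - n := by linarith
  have hp : 0 < 1 + n := by linarith
  have i1 := integrableOn_exp_neg_mul (a := (1 + n) / 2) (by linarith)
  have i2 := integrableOn_exp_neg_mul (a := (1 - n) / 2) (by linarith)
  have h := arcAvg_sub_main_le hf heig (hasDerivAt_compS n) (hasDerivAt_compS' n)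
    (compS_zero n) (compS'_zero hn) ((i1.add i2).const_mul (1 / n))
    (fun t _ => abs_compS_neg_le hn t) x hξ
  simp only [Pi.add_apply] at h
  rw [integral_const_mul, integral_add i1 i2, integral_exp_neg_mul (by linarith),
    integral_exp_neg_mul (by linarith)] at h
  -- Multiplication by e^{-η} exchanges the two exponents: the rate in η is (1 ± n)/2 when the rate
  -- in ξ is (1 ∓ n)/2. For this reason the slower term in ξ carries the more regular coefficient.
  have hk : ∀ η, (compS n (ξ - η) * Real.exp (-η)) • gFun f x η
      = (1 / n * Real.exp (-((1 - n) / 2) * ξ)) • (Real.exp (-((1 + n) / 2 * η)) • gFun f x η)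
        - (1 / n * Real.exp (-((1 + n) / 2) * ξ)) •
          (Real.exp (-((1 - n) / 2 * η)) • gFun f x η) := fun η => by
    rw [smul_smul, smul_smul, ← sub_smul, compS]
    congr 1
    rw [mul_assoc, sub_mul, mul_assoc, mul_assoc, ← Real.exp_add, ← Real.exp_add, ← Real.exp_add,
      ← Real.exp_add]
    ring_nf
  have hI : ∫ η in Ioi (0 : ℝ), (compS n (ξ - η) * Real.exp (-η)) • gFun f x η
      = (1 / n * Real.exp (-((1 - n) / 2) * ξ)) •
          (∫ η in Ioi (0 : ℝ), Real.exp (-((1 + n) / 2 * η)) • gFun f x η)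
        - (1 / n * Real.exp (-((1 + n) / 2) * ξ)) •
          (∫ η in Ioi (0 : ℝ), Real.exp (-((1 - n) / 2 * η)) • gFun f x η) := by
    simp only [hk]
    exact integral_smul_sub_smul (integrableOn_smul_gFun hf x i1)
      (integrableOn_smul_gFun hf x i2) _ _
  rw [hI] at h
  refine (le_of_eq ?_).trans (h.trans_eq ?_)
  · congr 2
    simp only [compPlus, compMinus, compS, compS', Complex.real_smul]
    have : (n : ℂ) ≠ 0 := by exact_mod_cast hn.ne'
    push_cast
    field_simp
    ring
  · have : 1 - n ^ 2 = (1 - n) * (1 + n) := by ring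
    rw [this]
    field_simp
    ring

lemma comp_bound (hf : IsCn 2 f) (hn : 0 < n)
    (heig : ∀ x, casimir f x = (((1 - n ^ 2) / 4 : ℝ) : ℂ) * f x) (x : HomSpace Γ) {ξ : ℝ}
    (hξ : 0 ≤ ξ) :
    ‖arcAvg f x ξ‖ ≤ 15 * (ξ + 1) * Real.exp (-((1 - n) / 2) * ξ) * c2Norm f :=
  norm_arcAvg_le_exp hf heig (hasDerivAt_compS n) (hasDerivAt_compS' n)
    (compS_zero n) (compS'_zero hn) (by linarith) (fun _ => abs_compS_le hn)
    (fun _ => abs_compS'_add_le hn) x hξ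

end Complementary

end Expansions


/-! ### Lengths of curves and Lipschitz estimates for translates. -/

section Curves

/-- The Riemannian length of a curve. -/
noncomputable def curveLength (σ : ℝ → SL2R) : ℝ :=
  ∫ t in (0 : ℝ)..1, frameNorm (velocity σ t)

lemma frameNorm_nonneg (A : Matrix (Fin 2) (Fin 2) ℝ) : 0 ≤ frameNorm A := Real.sqrt_nonneg _

lemma curveLength_nonneg (σ : ℝ → SL2R) : 0 ≤ curveLength σ :=
  intervalIntegral.integral_nonneg zero_le_one fun _ _ => frameNorm_nonneg _

lemma SmoothFam.hasDerivAt {σ : ℝ → SL2R} (hσ : SmoothFam 1 σ) (t : ℝ) (i j : Fin 2) :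
    HasDerivAt (fun s => (σ s).1 i j)
      ((Matrix.of fun i j => deriv (fun s => (σ s).1 i j) t : Matrix (Fin 2) (Fin 2) ℝ) i j) t :=
  ((hσ i j).differentiable one_ne_zero).differentiableAt.hasDerivAt

lemma velocity_apply (σ : ℝ → SL2R) (t : ℝ) (i j : Fin 2) :
    velocity σ t i j = ((σ t)⁻¹).1 i 0 * deriv (fun s => (σ s).1 0 j) t
      + ((σ t)⁻¹).1 i 1 * deriv (fun s => (σ s).1 1 j) t := by
  simp [velocity, Matrix.mul_apply, Fin.sum_univ_two]

/-- Differentiate det σ = 1. The fourth entry of the velocity is therefore controlled by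
`frameNorm`, which uses only the other three. -/
lemma velocity_trace {σ : ℝ → SL2R} (hσ : SmoothFam 1 σ) (t : ℝ) :
    velocity σ t 1 1 = -velocity σ t 0 0 := by
  have h := (((hσ.hasDerivAt t 0 0).mul (hσ.hasDerivAt t 1 1)).sub
    ((hσ.hasDerivAt t 0 1).mul (hσ.hasDerivAt t 1 0)))
  have h1 : HasDerivAt (fun _ : ℝ => (1 : ℝ)) _ t :=
    h.congr_of_eventuallyEq (Eventually.of_forall fun s => (det_val (σ s)).symm)
  have h2 := h1.unique (hasDerivAt_const t 1)
  simp only [Matrix.of_apply] at h2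
  rw [velocity_apply, velocity_apply, inv_val]
  simp
  linarith

lemma continuous_velocity {σ : ℝ → SL2R} (hσ : SmoothFam 1 σ) (i j : Fin 2) :
    Continuous fun t => velocity σ t i j := by
  have hd : ∀ i j, Continuous (deriv fun s => (σ s).1 i j) := fun i j =>
    (hσ i j).continuous_deriv le_rfl
  have hi : ∀ i j, Continuous fun t => ((σ t)⁻¹).1 i j :=
    continuous_SL2R_iff.1 hσ.continuous.inv
  simp only [velocity_apply]
  exact ((hi _ _).mul (hd _ _)).add ((hi _ _).mul (hd _ _))

lemma continuous_frameNorm_velocity {σ : ℝ → SL2R} (hσ : SmoothFam 1 σ) :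
    Continuous fun t => frameNorm (velocity σ t) := by
  have := continuous_velocity hσ
  exact ((((this 0 1).pow 2).add (((this 0 0).const_mul 2).pow 2)).add ((this 1 0).pow 2)).sqrt

lemma abs_velocity_le {σ : ℝ → SL2R} (hσ : SmoothFam 1 σ) (t : ℝ) (i j : Fin 2) :
    |velocity σ t i j| ≤ frameNorm (velocity σ t) := by
  have s1 := sq_nonneg (velocity σ t 0 0)
  have s2 := sq_nonneg (velocity σ t 0 1)
  have s3 := sq_nonneg (velocity σ t 1 0)
  have h00 : |velocity σ t 0 0| ≤ frameNorm (velocity σ t) := Real.abs_le_sqrt (by nlinarith)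
  fin_cases i <;> fin_cases j
  · exact h00
  · exact Real.abs_le_sqrt (by dsimp; nlinarith)
  · exact Real.abs_le_sqrt (by dsimp; nlinarith)
  · change |velocity σ t 1 1| ≤ _
    rw [velocity_trace hσ, abs_neg]
    exact h00

lemma abs_conj_le {k : SL2R} {κ m : ℝ} (hk : ∀ i j, |k.1 i j| ≤ κ)
    {v : Matrix (Fin 2) (Fin 2) ℝ} (hv : ∀ i j, |v i j| ≤ m) (i j : Fin 2) :
    |((k⁻¹).1 * (v * k.1)) i j| ≤ 4 * κ ^ 2 * m := by
  have hκ : 0 ≤ κ := (abs_nonneg _).trans (hk 0 0)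
  have hm : 0 ≤ m := (abs_nonneg _).trans (hv 0 0)
  have hi : ∀ i j, |(k⁻¹).1 i j| ≤ κ := fun i j => by
    rw [inv_val]
    fin_cases i <;> fin_cases j <;> simp [hk]
  have h1 : ∀ a b c d : Fin 2, |(k⁻¹).1 i a * (v b c * k.1 d j)| ≤ κ * (m * κ) := fun a b c d => by
    rw [abs_mul, abs_mul]
    exact mul_le_mul (hi _ _) (mul_le_mul (hv _ _) (hk _ _) (abs_nonneg _) hm) (by positivity) hκ
  simp only [Matrix.mul_apply, Fin.sum_univ_two, mul_add]
  refine (abs_add_le _ _).trans ((add_le_add (abs_add_le _ _) (abs_add_le _ _)).trans ?_)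
  refine (add_le_add (add_le_add (h1 _ _ _ _) (h1 _ _ _ _))
    (add_le_add (h1 _ _ _ _) (h1 _ _ _ _))).trans_eq ?_
  ring

/-- Translates of `C^1` functions are Lipschitz. -/
lemma norm_sub_le_curveLength {h : HomSpace Γ → ℂ} (hh : IsCn 1 h) {C : ℝ}
    (hC : ∀ i x, ‖frame i h x‖ ≤ C) {k : SL2R} {κ : ℝ} (hk : ∀ i j, |k.1 i j| ≤ κ)
    {σ : ℝ → SL2R} (hσ : SmoothFam 1 σ) :
    ‖h (rightMul k (proj Γ (σ 0))) - h (rightMul k (proj Γ (σ 1)))‖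
      ≤ 16 * C * κ ^ 2 * curveLength σ := by
  have hC0 : 0 ≤ C := (norm_nonneg _).trans (hC 0 (proj Γ 1))
  have hτ : SmoothFam 1 fun t => σ t * k := hσ.mul (SmoothFam.const k)
  set F : ℝ → ℂ := fun t => h (rightMul (σ t * k) (proj Γ 1)) with hF
  have hFt : ∀ t, F t = h (rightMul k (proj Γ (σ t))) := fun t => by simp [F]
  have hFc : ContDiff ℝ 1 F := hh.contDiff hτ _
  have hd : ∀ t, HasDerivAt F (deriv F t) t := fun t =>
    (hFc.differentiable one_ne_zero).differentiableAt.hasDerivAt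
  have hb : ∀ t, ‖deriv F t‖ ≤ 16 * C * κ ^ 2 * frameNorm (velocity σ t) := fun t => by
    have h1 := hasDerivAt_curve hh (σ := fun t => σ t * k) (t := t) (fun i j => by
      simpa using hasDerivAt_mul_entries (hσ.hasDerivAt t) (τ := fun _ => k) (τ' := 0)
        (fun i j => hasDerivAt_const t _) i j) (proj Γ 1)
    rw [h1.deriv]
    have h2 : ((σ t * k)⁻¹).1 * ((Matrix.of fun i j => deriv (fun s => (σ s).1 i j) t) * k.1)
        = (k⁻¹).1 * (velocity σ t * k.1) := by
      rw [mul_inv_rev, velocity]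
      change ((k⁻¹).1 * ((σ t)⁻¹).1) * _ = _
      simp only [Matrix.mul_assoc]
    rw [h2]
    -- Conjugation by k costs 4κ² in each entry. The frame coefficients v₀₁, -2v₁₁, v₁₀ add up to
    -- four such entries, whence 16.
    have h3 := abs_conj_le hk (abs_velocity_le hσ t)
    set w := (k⁻¹).1 * (velocity σ t * k.1)
    set m := frameNorm (velocity σ t)
    have h4 : ∀ (a : ℝ) (z : ℂ), |a| ≤ 4 * κ ^ 2 * m → ‖z‖ ≤ C →
        ‖(a : ℂ) * z‖ ≤ 4 * κ ^ 2 * m * C := fun a z ha hz => by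
      rw [norm_mul, Complex.norm_real, Real.norm_eq_abs]
      exact mul_le_mul ha hz (norm_nonneg _) ((abs_nonneg _).trans ha)
    have hU := h4 _ _ (h3 0 1) (hC 0 (rightMul (σ t * k) (proj Γ 1)))
    have hX := h4 _ _ (h3 1 1) (hC 1 (rightMul (σ t * k) (proj Γ 1)))
    have hV := h4 _ _ (h3 1 0) (hC 2 (rightMul (σ t * k) (proj Γ 1)))
    have hX' : ‖((-2 * w 1 1 : ℝ) : ℂ) * derivX h (rightMul (σ t * k) (proj Γ 1))‖
        ≤ 2 * (4 * κ ^ 2 * m * C) := by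
      have : ((-2 * w 1 1 : ℝ) : ℂ) * derivX h (rightMul (σ t * k) (proj Γ 1))
          = -2 * ((w 1 1 : ℂ) * frame 1 h (rightMul (σ t * k) (proj Γ 1))) := by
        push_cast
        exact mul_assoc _ _ _
      rw [this, norm_mul]
      simpa using hX
    refine (norm_add_le _ _).trans ((add_le_add_left (norm_add_le _ _) _).trans ?_)
    refine (add_le_add (add_le_add hU hX') hV).trans_eq ?_
    ring
  rw [← hFt, ← hFt, norm_sub_rev,
    ← intervalIntegral.integral_eq_sub_of_hasDerivAt (fun t _ => hd t)
      ((hFc.continuous_deriv le_rfl).intervalIntegrable 0 1), curveLength,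
    ← intervalIntegral.integral_const_mul]
  refine intervalIntegral.norm_integral_le_of_norm_le zero_le_one
    (Eventually.of_forall fun t _ => hb t)
    (((continuous_frameNorm_velocity hσ).const_mul _).intervalIntegrable _ _)

/-- `SL(2, ℝ)` is generated by the matrices `exp (s U)` and `exp (s V)`. -/
lemma shear_induction {P : SL2R → Prop} (hU : ∀ s, P (expU s)) (hV : ∀ s, P (expV s))
    (hmul : ∀ k l, P k → P l → P (k * l)) (k : SL2R) : P k := by
  have key : ∀ k : SL2R, k.1 1 0 ≠ 0 → P k := fun k hk => by
    have hd := det_val k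
    -- A matrix with nonzero lower left entry is a product of three shears; the remaining upper
    -- right entry is forced by the determinant.
    have : expU ((k.1 0 0 - 1) / k.1 1 0) * expV (k.1 1 0) * expU ((k.1 1 1 - 1) / k.1 1 0)
        = k := by
      apply SL2R_ext <;> simp [mul_val, expU_val, expV_val] <;> field_simp <;> linarith
    rw [← this]
    exact hmul _ _ (hmul _ _ (hU _) (hV _)) (hU _)
  by_cases hk : k.1 1 0 = 0
  · have hd := det_val k
    -- When the lower left entry vanishes, multiplication by `expV 1` replaces it by the lower right
    -- entry, which is then nonzero.
    have h := key (k * expV 1) (by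
      intro h
      rw [mul_val] at h
      simp [expV_val, hk] at h
      simp [hk, h] at hd)
    have h2 := hmul _ _ h (hV (-1))
    rwa [mul_assoc, ← expV_add, add_neg_cancel, expV_zero, mul_one] at h2
  · exact key k hk

/-- Curves for two factors are multiplied pointwise instead of being concatenated, so no smoothing
at a junction is needed. -/
lemma exists_curve_one (k : SL2R) : ∃ σ : ℝ → SL2R, SmoothFam 1 σ ∧ σ 0 = 1 ∧ σ 1 = k := by
  refine shear_induction (P := fun k => ∃ σ : ℝ → SL2R, SmoothFam 1 σ ∧ σ 0 = 1 ∧ σ 1 = k)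
    (fun s => ?_) (fun s => ?_) (fun k l => ?_) k
  · exact ⟨fun t => expU (t * s), smoothFam_expU.comp (by fun_prop), by simp, by simp⟩
  · exact ⟨fun t => expV (t * s), smoothFam_expV.comp (by fun_prop), by simp, by simp⟩
  · rintro ⟨σ, hσ, h0, h1⟩ ⟨τ, hτ, h0', h1'⟩
    exact ⟨fun t => σ t * τ t, hσ.mul hτ, by simp [h0, h0'], by simp [h1, h1']⟩

end Curves

/-! ### Hölder continuity of the coefficients. -/

section Holder

/-- Hölder continuity with respect to the length of every curve. -/
def CurveHolder (a : ℝ) (D : HomSpace Γ → ℂ) : Prop :=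
  ∃ C : ℝ, ∀ σ : ℝ → SL2R, SmoothFam 1 σ →
    ‖D (proj Γ (σ 0)) - D (proj Γ (σ 1))‖ ≤ C * curveLength σ ^ a

/-- The estimate is a closed condition on the length, so it passes to the infimum. The set of
lengths must be nonempty because `sInf ∅ = 0`; hence the need for connecting curves. -/
lemma CurveHolder.isHolder {a : ℝ} (ha : 0 ≤ a) {D : HomSpace Γ → ℂ} (h : CurveHolder a D) :
    IsHolder a D := by
  obtain ⟨C, hC⟩ := h
  refine ⟨C, fun x y => ?_⟩
  set S := {L : ℝ | ∃ σ : ℝ → SL2R, (∀ i j, ContDiff ℝ 1 (fun t => (σ t).1 i j)) ∧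
    proj Γ (σ 0) = x ∧ proj Γ (σ 1) = y ∧ L = ∫ t in (0 : ℝ)..1, frameNorm (velocity σ t)}
  have hne : S.Nonempty := by
    obtain ⟨g, rfl⟩ := proj_surjective x
    obtain ⟨g', rfl⟩ := proj_surjective y
    obtain ⟨σ, hσ, h0, h1⟩ := exists_curve_one (g⁻¹ * g')
    exact ⟨_, fun t => g * σ t, (SmoothFam.const g).mul hσ, by simp [h0], by simp [h1], rfl⟩
  have hbdd : BddBelow S := ⟨0, by
    rintro L ⟨σ, -, -, -, rfl⟩
    exact curveLength_nonneg σ⟩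
  have hcl : IsClosed {L : ℝ | ‖D x - D y‖ ≤ C * L ^ a} :=
    isClosed_le continuous_const (continuous_const.mul (Real.continuous_rpow_const ha))
  refine hcl.closure_subset_iff.2 ?_ (csInf_mem_closure hne hbdd)
  rintro L ⟨σ, hσ, rfl, rfl, rfl⟩
  exact hC σ hσ

lemma CurveHolder.add {a : ℝ} {D D' : HomSpace Γ → ℂ} (h : CurveHolder a D)
    (h' : CurveHolder a D') : CurveHolder a (fun x => D x + D' x) := by
  obtain ⟨C, hC⟩ := h
  obtain ⟨C', hC'⟩ := h'
  refine ⟨C + C', fun σ hσ => ?_⟩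
  rw [add_sub_add_comm, add_mul]
  exact (norm_add_le _ _).trans (add_le_add (hC σ hσ) (hC' σ hσ))

lemma CurveHolder.smul {a : ℝ} {D : HomSpace Γ → ℂ} (h : CurveHolder a D) (c : ℝ) :
    CurveHolder a (fun x => c • D x) := by
  obtain ⟨C, hC⟩ := h
  refine ⟨|c| * C, fun σ hσ => ?_⟩
  rw [← smul_sub, norm_smul, Real.norm_eq_abs, mul_assoc]
  exact mul_le_mul_of_nonneg_left (hC σ hσ) (abs_nonneg _)

lemma CurveHolder.neg {a : ℝ} {D : HomSpace Γ → ℂ} (h : CurveHolder a D) :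
    CurveHolder a (fun x => -D x) := by
  simpa using h.smul (-1)

lemma CurveHolder.sub {a : ℝ} {D D' : HomSpace Γ → ℂ} (h : CurveHolder a D)
    (h' : CurveHolder a D') : CurveHolder a (fun x => D x - D' x) := by
  simpa only [sub_eq_add_neg] using h.add h'.neg

/-- The Lipschitz bound is used for L ≤ 1 and the uniform bound for L ≥ 1. -/
lemma le_mul_rpow {a L d K B : ℝ} (ha : a ≤ 1) (hL : 0 ≤ L) (ha0 : 0 < a)
    (h1 : d ≤ K * L) (h2 : d ≤ B) (hK : 0 ≤ K) (hB : 0 ≤ B) : d ≤ (K + B) * L ^ a := by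
  have hLa := Real.rpow_nonneg hL a
  rcases le_total L 1 with h | h
  · rcases hL.eq_or_lt with rfl | hL'
    · rw [Real.zero_rpow ha0.ne']
      linarith
    · have : L ≤ L ^ a := by
        simpa using Real.rpow_le_rpow_of_exponent_ge hL' h ha
      nlinarith
  · have : 1 ≤ L ^ a := Real.one_le_rpow h ha0.le
    nlinarith

variable [CompactSpace (HomSpace Γ)] {f : HomSpace Γ → ℂ}

lemma curveHolder_unitInt (hf : IsCn 1 f) {a : ℝ} (ha0 : 0 < a) (ha : a ≤ 1) :
    CurveHolder a (unitInt f) := by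
  obtain ⟨C0, hC00, hC0⟩ := exists_norm_le hf.continuous
  have hex : ∃ C, ∀ i x, ‖frame i f x‖ ≤ C := by
    have := fun i => exists_norm_le (isCn_frame (m := 0) hf (by simp) i).continuous
    choose C _ hC using this
    exact ⟨∑ i, C i, fun i x => (hC i x).trans
      (Finset.single_le_sum (f := C) (fun j _ => (norm_nonneg _).trans (hC j x))
        (Finset.mem_univ i))⟩
  obtain ⟨C, hC⟩ := hex
  have hCn : 0 ≤ C := (norm_nonneg _).trans (hC 0 (proj Γ 1))
  refine ⟨16 * C + 2 * C0, fun σ hσ => ?_⟩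
  have hc : ∀ x : HomSpace Γ, Continuous fun s : ℝ => f (horo s x) := fun x =>
    hf.continuous.comp (continuous_horo_of continuous_id continuous_const)
  refine le_mul_rpow ha (curveLength_nonneg σ) ha0 ?_ ?_ (by positivity) (by positivity)
  · rw [unitInt, unitInt, ← intervalIntegral.integral_sub ((hc _).intervalIntegrable _ _)
      ((hc _).intervalIntegrable _ _)]
    have := intervalIntegral.norm_integral_le_of_norm_le_const (a := 0) (b := 1)
      (f := fun s => f (horo s (proj Γ (σ 0))) - f (horo s (proj Γ (σ 1))))
      (C := 16 * C * curveLength σ) fun s hs => ?_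
    · rwa [sub_zero, abs_one, mul_one] at this
    · rw [uIoc_of_le zero_le_one] at hs
      have := norm_sub_le_curveLength hf hC (k := expU s) (κ := 1) (fun i j => by
        fin_cases i <;> fin_cases j <;> simp [expU_val, abs_of_pos hs.1, hs.2]) hσ
      rwa [one_pow, mul_one] at this
  · refine (norm_sub_le _ _).trans ?_
    linarith [norm_unitInt_le hC0 (proj Γ (σ 0)), norm_unitInt_le hC0 (proj Γ (σ 1))]

/-- Both terms of G are translates of Vf by matrices whose entries are at most e^{ξ/2}; conjugation
squares this to e^ξ, and two terms double the constant 16. -/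
lemma norm_gFun_sub_le (hf : IsCn 2 f) {σ : ℝ → SL2R} (hσ : SmoothFam 1 σ) {ξ : ℝ} (hξ : 0 < ξ) :
    ‖gFun f (proj Γ (σ 0)) ξ - gFun f (proj Γ (σ 1)) ξ‖
      ≤ 32 * c2Norm f * (Real.exp ξ * curveLength σ) := by
  have hC : ∀ i x, ‖frame i (derivV f) x‖ ≤ c2Norm f := fun i x => norm_frame_frame_le hf i 2 x
  have hκ : Real.exp (ξ / 2) ^ 2 = Real.exp ξ := by
    rw [← Real.exp_nat_mul]; congr 1; push_cast; ring
  have h1 : Real.exp (-ξ / 2) ≤ Real.exp (ξ / 2) := Real.exp_le_exp.2 (by linarith)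
  have hpos := Real.exp_pos (ξ / 2)
  have e1 := norm_sub_le_curveLength hf.derivV' hC (k := expX (-ξ)) (κ := Real.exp (ξ / 2))
    (fun i j => by fin_cases i <;> fin_cases j <;> simp [expX_val, h1, hpos.le]) hσ
  have e2 := norm_sub_le_curveLength hf.derivV' hC (k := expU 1 * expX (-ξ))
    (κ := Real.exp (ξ / 2))
    (fun i j => by
      fin_cases i <;> fin_cases j <;> simp [mul_val, expU_val, expX_val, h1, hpos.le]) hσ
  rw [hκ] at e1 e2
  simp only [gFun, geo, horo, rightMul_rightMul]
  rw [sub_sub_sub_comm]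
  refine (norm_sub_le _ _).trans ((add_le_add e1 e2).trans_eq ?_)
  ring

lemma norm_setIntegral_exp_Ioi_le {B a : ℝ} (ha : 0 < a) (c : ℝ) {F : ℝ → ℂ}
    (h : ∀ t ∈ Ioi c, ‖F t‖ ≤ B * Real.exp (-a * t)) :
    ‖∫ t in Ioi c, F t‖ ≤ B * (Real.exp (-a * c) / a) := by
  have hi := integrableOn_exp_mul_Ioi (neg_neg_iff_pos.2 ha) c
  refine (norm_integral_le_of_norm_le (hi.const_mul B)
    ((ae_restrict_iff' measurableSet_Ioi).2 (Eventually.of_forall h))).trans_eq ?_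
  rw [integral_const_mul, integral_exp_mul_Ioi (neg_neg_iff_pos.2 ha), neg_div_neg_eq]

lemma norm_setIntegral_exp_Ioc_le {B b : ℝ} (hb : 0 < b) (hB : 0 ≤ B) {c : ℝ} (hc : 0 ≤ c)
    {F : ℝ → ℂ} (h : ∀ t ∈ Ioc 0 c, ‖F t‖ ≤ B * Real.exp (b * t)) :
    ‖∫ t in Ioc 0 c, F t‖ ≤ B * (Real.exp (b * c) / b) := by
  have hcont : Continuous fun t : ℝ => Real.exp (b * t) := by fun_prop
  refine (norm_integral_le_of_norm_le (hcont.integrableOn_Ioc.const_mul B)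
    ((ae_restrict_iff' measurableSet_Ioc).2 (Eventually.of_forall h))).trans ?_
  rw [integral_const_mul]
  refine mul_le_mul_of_nonneg_left ?_ hB
  have hd : ∀ t, HasDerivAt (fun t : ℝ => Real.exp (b * t) / b) (Real.exp (b * t)) t := fun t =>
    ((hasDerivAt_exp_mul b t).div_const b).congr_deriv (by field_simp)
  rw [← intervalIntegral.integral_of_le hc,
    intervalIntegral.integral_eq_sub_of_hasDerivAt (fun t _ => hd t)
      (hcont.intervalIntegrable _ _)]
  have : 0 ≤ Real.exp (b * 0) / b := by positivity
  linarith

/-- The two bounds `|g| ≤ M` and `|g| ≤ M e^ξ L` make the integral of `g` against a kernel of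
size `e^{-a ξ}` a Hölder quantity in `L`. -/
lemma norm_integral_kernel_le {a B M L : ℝ} (ha0 : 0 < a) (ha : a < 1) (hB : 0 ≤ B) (hM : 0 ≤ M)
    (hL : 0 ≤ L) {k : ℝ → ℝ} {g : ℝ → ℂ} (hk : ∀ ξ ∈ Ioi (0 : ℝ), |k ξ| ≤ B * Real.exp (-a * ξ))
    (h1 : ∀ ξ ∈ Ioi (0 : ℝ), ‖g ξ‖ ≤ M) (h2 : ∀ ξ ∈ Ioi (0 : ℝ), ‖g ξ‖ ≤ M * (Real.exp ξ * L))
    (hi : IntegrableOn (fun ξ => k ξ • g ξ) (Ioi 0)) :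
    ‖∫ ξ in Ioi (0 : ℝ), k ξ • g ξ‖ ≤ B * M * (1 / (1 - a) + 1 / a) * L ^ a := by
  have hb : 0 < 1 - a := by linarith
  have hLa := Real.rpow_nonneg hL a
  have hBM : 0 ≤ B * M := mul_nonneg hB hM
  have b1 : ∀ ξ ∈ Ioi (0 : ℝ), ‖k ξ • g ξ‖ ≤ B * M * Real.exp (-a * ξ) := fun ξ hξ => by
    rw [norm_smul, Real.norm_eq_abs]
    refine (mul_le_mul (hk ξ hξ) (h1 ξ hξ) (norm_nonneg _) (by positivity)).trans_eq (by ring)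
  have b2 : ∀ ξ ∈ Ioi (0 : ℝ), ‖k ξ • g ξ‖ ≤ B * M * L * Real.exp ((1 - a) * ξ) := fun ξ hξ => by
    rw [norm_smul, Real.norm_eq_abs]
    refine (mul_le_mul (hk ξ hξ) (h2 ξ hξ) (norm_nonneg _) (by positivity)).trans_eq ?_
    have : Real.exp ((1 - a) * ξ) = Real.exp (-a * ξ) * Real.exp ξ := by
      rw [← Real.exp_add]; ring_nf
    rw [this]; ring
  rcases hL.eq_or_lt with rfl | hLpos
  · have : ∫ ξ in Ioi (0 : ℝ), k ξ • g ξ = 0 := by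
      refine setIntegral_eq_zero_of_forall_eq_zero fun ξ hξ => ?_
      refine norm_le_zero_iff.1 ((b2 ξ hξ).trans_eq ?_)
      ring
    rw [this, Real.zero_rpow ha0.ne']
    simp
  rcases le_or_gt 1 L with h | h
  · refine (norm_setIntegral_exp_Ioi_le ha0 0 b1).trans ?_
    have : 1 ≤ L ^ a := Real.one_le_rpow h ha0.le
    have h3 : 0 ≤ 1 / (1 - a) := by positivity
    have h4 : 0 ≤ 1 / a := by positivity
    rw [mul_zero, Real.exp_zero, mul_assoc (B * M)]
    refine mul_le_mul_of_nonneg_left ?_ hBM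
    nlinarith
  -- The cutoff -log L is where the two bounds on g cross, that is, where e^ξ L = 1.
  · have hc : 0 ≤ -Real.log L := by linarith [Real.log_neg hLpos h]
    set c := -Real.log L
    have e1 : Real.exp (-a * c) = L ^ a := by
      rw [Real.rpow_def_of_pos hLpos]; congr 1; simp only [c]; ring
    have e2 : L * Real.exp ((1 - a) * c) = L ^ a := by
      rw [Real.rpow_def_of_pos hLpos]
      nth_rewrite 1 [← Real.exp_log hLpos]
      rw [← Real.exp_add]; congr 1; simp only [c]; ring
    rw [← Ioc_union_Ioi_eq_Ioi hc, setIntegral_union (by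
      rw [Set.disjoint_left]; intro t ht ht'; exact absurd ht' (not_lt.2 ht.2)) measurableSet_Ioi
      (hi.mono_set Ioc_subset_Ioi_self) (hi.mono_set (Ioi_subset_Ioi hc))]
    have n1 := norm_setIntegral_exp_Ioc_le hb (by positivity) hc
      fun t ht => b2 t ht.1
    have n2 := norm_setIntegral_exp_Ioi_le ha0 c fun t ht => b1 t (hc.trans_lt ht)
    refine (norm_add_le _ _).trans ((add_le_add n1 n2).trans_eq ?_)
    rw [e1, ← e2]
    ring

lemma curveHolder_integral (hf : IsCn 2 f) {a B : ℝ} (ha0 : 0 < a) (ha : a < 1) {k : ℝ → ℝ}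
    (hkc : Continuous k) (hB : 0 ≤ B) (hk : ∀ ξ ∈ Ioi (0 : ℝ), |k ξ| ≤ B * Real.exp (-a * ξ)) :
    CurveHolder a (fun x => ∫ ξ in Ioi (0 : ℝ), k ξ • gFun f x ξ) := by
  have hN := c2Norm_nonneg hf
  have hki : IntegrableOn k (Ioi 0) := IntegrableOn.of_abs_le hkc
    ((integrableOn_exp_mul_Ioi (neg_neg_iff_pos.2 ha0) 0).const_mul B) hk
  refine ⟨B * (32 * c2Norm f) * (1 / (1 - a) + 1 / a), fun σ hσ => ?_⟩
  have i1 := integrableOn_smul_gFun hf (proj Γ (σ 0)) hki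
  have i2 := integrableOn_smul_gFun hf (proj Γ (σ 1)) hki
  rw [← integral_sub i1 i2]
  simp only [← smul_sub]
  refine norm_integral_kernel_le ha0 ha hB (by positivity) (curveLength_nonneg σ) hk
    (fun ξ _ => ?_) (fun ξ hξ => norm_gFun_sub_le hf hσ hξ) ?_
  · refine (norm_sub_le _ _).trans ?_
    -- The uniform bound 4‖f‖ is relaxed to 32‖f‖, so that a single M serves both estimates.
    linarith [norm_gFun_le hf (proj Γ (σ 0)) ξ, norm_gFun_le hf (proj Γ (σ 1)) ξ]
  · simp only [smul_sub]
    exact Integrable.sub i1 i2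

lemma exp_neg_half_eq (ξ : ℝ) : Real.exp (-ξ / 2) = Real.exp (-(1 / 2) * ξ) := by ring_nf

lemma isHolder_princPlus (hf : IsCn 2 f) (y : ℝ) : IsHolder (1 / 2) (princPlus y f) := by
  refine CurveHolder.isHolder (by norm_num) (CurveHolder.add (CurveHolder.neg (CurveHolder.smul
    (curveHolder_integral hf (B := 1) (by norm_num) (by norm_num) (by fun_prop) zero_le_one
      fun ξ _ => ?_) _)) (curveHolder_unitInt hf.one (by norm_num) (by norm_num)))
  rw [abs_mul, abs_of_pos (Real.exp_pos _), one_mul, exp_neg_half_eq]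
  exact mul_le_of_le_one_right (Real.exp_pos _).le (Real.abs_sin_le_one _)

lemma isHolder_princMinus (hf : IsCn 2 f) (y : ℝ) : IsHolder (1 / 2) (princMinus y f) := by
  refine CurveHolder.isHolder (by norm_num) (CurveHolder.sub (CurveHolder.add (CurveHolder.smul
    (curveHolder_integral hf (B := 1) (by norm_num) (by norm_num) (by fun_prop) zero_le_one
      fun ξ _ => ?_) _) (CurveHolder.smul (curveHolder_unitInt hf.one (by norm_num)
      (by norm_num)) _)) (CurveHolder.smul (curveHolder_unitInt hf.derivX' (by norm_num)
      (by norm_num)) _))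
  rw [abs_mul, abs_of_pos (Real.exp_pos _), one_mul, exp_neg_half_eq]
  exact mul_le_of_le_one_right (Real.exp_pos _).le (Real.abs_cos_le_one _)

lemma isHolder_quarterPlus (hf : IsCn 2 f) {ε : ℝ} (hε : 0 < ε) (hε' : ε < 1 / 2) :
    IsHolder (1 / 2 - ε) (quarterPlus f) := by
  refine CurveHolder.isHolder (by linarith) (CurveHolder.add (CurveHolder.neg
    (curveHolder_integral hf (B := 1 / ε) (by linarith) (by linarith) (by fun_prop) (by positivity)
      fun ξ hξ => ?_)) (curveHolder_unitInt hf.one (by linarith) (by linarith)))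
  have hξ' : (0 : ℝ) < ξ := hξ
  rw [abs_of_pos (by positivity), exp_neg_half_eq]
  -- The linear factor ξ is absorbed into e^{εξ}/ε, which costs ε in the Hölder exponent.
  have h1 : ε * ξ ≤ Real.exp (ε * ξ) := by linarith [Real.add_one_le_exp (ε * ξ)]
  have h2 : ξ ≤ 1 / ε * Real.exp (ε * ξ) := by
    rw [one_div, ← div_eq_inv_mul, le_div_iff₀ hε]; linarith
  refine (mul_le_mul_of_nonneg_right h2 (Real.exp_pos _).le).trans_eq ?_
  rw [mul_assoc, ← Real.exp_add]
  ring_nf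

lemma isHolder_quarterMinus (hf : IsCn 2 f) : IsHolder (1 / 2) (quarterMinus f) := by
  refine CurveHolder.isHolder (by norm_num) (CurveHolder.sub (CurveHolder.add
    (curveHolder_integral hf (B := 1) (by norm_num) (by norm_num) (by fun_prop) zero_le_one
      fun ξ _ => ?_) (CurveHolder.smul (curveHolder_unitInt hf.one (by norm_num)
      (by norm_num)) _)) (curveHolder_unitInt hf.derivX' (by norm_num) (by norm_num)))
  rw [abs_of_pos (Real.exp_pos _), one_mul, exp_neg_half_eq]

lemma isHolder_compPlus (hf : IsCn 2 f) {n : ℝ} (hn : 0 < n) (hn1 : n < 1) :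
    IsHolder ((1 - n) / 2) (compPlus n f) := by
  refine CurveHolder.isHolder (by linarith) (CurveHolder.add (CurveHolder.sub (CurveHolder.neg
    (CurveHolder.smul (curveHolder_integral hf (B := 1) (by linarith) (by linarith) (by fun_prop)
      zero_le_one fun ξ _ => ?_) _)) (CurveHolder.smul (curveHolder_unitInt hf.one (by linarith)
      (by linarith)) _)) (CurveHolder.smul (curveHolder_unitInt hf.derivX' (by linarith)
      (by linarith)) _))
  rw [abs_of_pos (Real.exp_pos _), one_mul, neg_mul]

lemma isHolder_compMinus (hf : IsCn 2 f) {n : ℝ} (hn : 0 < n) (hn1 : n < 1) :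
    IsHolder ((1 + n) / 2) (compMinus n f) := by
  refine CurveHolder.isHolder (by linarith) (CurveHolder.sub (CurveHolder.add
    (CurveHolder.smul (curveHolder_integral hf (B := 1) (by linarith) (by linarith) (by fun_prop)
      zero_le_one fun ξ _ => ?_) _) (CurveHolder.smul (curveHolder_unitInt hf.one (by linarith)
      (by linarith)) _)) (CurveHolder.smul (curveHolder_unitInt hf.derivX' (by linarith)
      (by linarith)) _))
  rw [abs_of_pos (Real.exp_pos _), one_mul, neg_mul]

end Holder


/-! ### Unimodularity of SL(2, ℝ). -/

section Unimodular

instance instSecondCountableTopologySL2R : SecondCountableTopology SL2R :=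
  haveI : SecondCountableTopology (Matrix (Fin 2) (Fin 2) ℝ) :=
    inferInstanceAs (SecondCountableTopology (Fin 2 → Fin 2 → ℝ))
  Matrix.SpecialLinearGroup.isClosedEmbedding_val.isInducing.secondCountableTopology

/-- Each shear is conjugate to its own square by a diagonal matrix, so its modulus equals its square
and is 1; shears generate the group. -/
lemma modularCharacterFun_eq_one (k : SL2R) : Measure.modularCharacterFun k = 1 := by
  have hconj : ∀ a b c : SL2R, a * b = c * a →
      Measure.modularCharacterFun b = Measure.modularCharacterFun c := fun a b c h => by
    have h1 := congrArg Measure.modularCharacterFun h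
    rw [Measure.modularCharacterFun_map_mul, Measure.modularCharacterFun_map_mul, mul_comm] at h1
    exact mul_right_cancel₀ (Measure.modularCharacterFun_pos a).ne' h1
  have hsq : ∀ b : SL2R, Measure.modularCharacterFun b
      = Measure.modularCharacterFun b * Measure.modularCharacterFun b →
      Measure.modularCharacterFun b = 1 := fun b h =>
    (mul_eq_left₀ (Measure.modularCharacterFun_pos b).ne').1 h.symm
  refine shear_induction (P := fun k => Measure.modularCharacterFun k = 1) (fun s => hsq _ ?_) (fun s => hsq _ ?_) (fun k l hk hl => ?_) k
  · rw [← Measure.modularCharacterFun_map_mul, ← expU_add]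
    refine hconj (expX (Real.log 2)) _ _ ?_
    rw [expX_mul_expU, Real.exp_log two_pos, two_mul]
  · rw [← Measure.modularCharacterFun_map_mul, ← expV_add]
    refine hconj (expX (-Real.log 2)) _ _ ?_
    rw [expX_mul_expV, neg_neg, Real.exp_log two_pos, two_mul]
  · rw [Measure.modularCharacterFun_map_mul, hk, hl, one_mul]

lemma map_mul_right_haar (k : SL2R) :
    Measure.map (fun g => g * k) (Measure.haar : Measure SL2R) = Measure.haar := by
  rw [Measure.map_right_mul_eq_modularCharacterFun_smul, modularCharacterFun_eq_one, one_smul]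

end Unimodular

/-! ### The invariant probability measure on the compact quotient. -/

section Quotient

lemma measurable_proj : Measurable (proj Γ) := measurable_quotient_mk''

instance instOpensMeasurableSpaceHomSpace : OpensMeasurableSpace (HomSpace Γ) :=
  ⟨MeasurableSpace.generateFrom_le fun _ hU =>
    measurableSet_quotient.2 (hU.preimage continuous_proj).measurableSet⟩

lemma measurable_rightMul (k : SL2R) : Measurable (rightMul (Γ := Γ) k) :=
  measurable_from_quotient.2 (measurable_proj.comp (measurable_mul_const k))

/-- The image on `M` of the Haar measure on `W`. -/
noncomputable def pushHaar (Γ : Subgroup SL2R) (W : Set SL2R) : Measure (HomSpace Γ) :=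
  Measure.map (proj Γ) ((Measure.haar : Measure SL2R).restrict W)

lemma pushHaar_apply (W : Set SL2R) {A : Set (HomSpace Γ)} (hA : MeasurableSet A) :
    pushHaar Γ W A = (Measure.haar : Measure SL2R) (proj Γ ⁻¹' A ∩ W) := by
  rw [pushHaar, Measure.map_apply measurable_proj hA,
    Measure.restrict_apply (measurable_proj hA)]

lemma map_rightMul_pushHaar (k : SL2R) {W : Set SL2R} (hW : MeasurableSet W) :
    Measure.map (rightMul k) (pushHaar Γ W) = pushHaar Γ ((fun g => g * k⁻¹) ⁻¹' W) := by
  ext A hA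
  rw [Measure.map_apply (measurable_rightMul k) hA, pushHaar_apply _ (measurable_rightMul k hA),
    pushHaar_apply _ hA]
  nth_rewrite 2 [← map_mul_right_haar k]
  rw [Measure.map_apply (measurable_mul_const k)
    ((measurable_proj hA).inter (measurable_mul_const _ hW))]
  congr 1
  ext g
  simp

lemma pushHaar_le (W : Set SL2R) (hW : MeasurableSet W) (hinj : InjOn (proj Γ) W) :
    pushHaar Γ W ≤ haarQuotient Γ :=
  le_iSup (fun W : {W : Set SL2R // MeasurableSet W ∧ InjOn (proj Γ) W} => pushHaar Γ W.1)
    ⟨W, hW, hinj⟩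

/-- Right translates of sets on which `proj Γ` is injective have the same property, and
unimodularity preserves their Haar measure. Applying this inequality to both k and k⁻¹ gives
invariance. -/
lemma haarQuotient_le_map (k : SL2R) :
    haarQuotient Γ ≤ Measure.map (rightMul k) (haarQuotient Γ) := by
  refine iSup_le fun ⟨W, hW, hinj⟩ => ?_
  have hW' : MeasurableSet ((fun g => g * k) ⁻¹' W) := measurable_mul_const k hW
  have hinj' : InjOn (proj Γ) ((fun g => g * k) ⁻¹' W) := fun a ha b hb hab => by
    have := hinj ha hb (by simpa using congrArg (rightMul k) hab)
    exact mul_right_cancel this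
  have h := Measure.map_mono (pushHaar_le _ hW' hinj') (measurable_rightMul k)
  rw [map_rightMul_pushHaar k hW'] at h
  simp only [← preimage_comp, Function.comp_def, mul_assoc, inv_mul_cancel, mul_one,
    preimage_id'] at h
  exact h

lemma map_rightMul_haarQuotient (k : SL2R) :
    Measure.map (rightMul k) (haarQuotient Γ) = haarQuotient Γ := by
  refine le_antisymm ?_ (haarQuotient_le_map k)
  have h := Measure.map_mono (haarQuotient_le_map (Γ := Γ) k⁻¹) (measurable_rightMul k)
  rw [Measure.map_map (measurable_rightMul k) (measurable_rightMul k⁻¹)] at h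
  have : rightMul k ∘ rightMul k⁻¹ = (id : HomSpace Γ → HomSpace Γ) := by
    funext x
    simp [rightMul_rightMul]
  rwa [this, Measure.map_id] at h

/-- Images of interiors of compact neighbourhoods form an open cover; a finite subcover suffices. -/
lemma exists_compact_proj_eq_univ [CompactSpace (HomSpace Γ)] :
    ∃ C : Set SL2R, IsCompact C ∧ proj Γ '' C = univ := by
  have hK : ∀ g : SL2R, ∃ K, IsCompact K ∧ g ∈ interior K := fun g => exists_compact_mem_nhds g |>.imp
    fun K hK => ⟨hK.1, mem_interior_iff_mem_nhds.2 hK.2⟩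
  choose K hKc hKi using hK
  obtain ⟨t, ht⟩ := isCompact_univ.elim_finite_subcover (fun g => proj Γ '' interior (K g))
    (fun g => isOpenMap_proj _ isOpen_interior) (fun x _ => by
      obtain ⟨g, rfl⟩ := proj_surjective x
      exact mem_iUnion.2 ⟨g, mem_image_of_mem _ (hKi g)⟩)
  refine ⟨⋃ g ∈ t, K g, t.isCompact_biUnion fun g _ => hKc g, ?_⟩
  refine eq_univ_of_univ_subset (ht.trans ?_)
  simp only [image_iUnion]
  exact iUnion₂_mono fun g _ => image_mono interior_subset

instance [DiscreteTopology Γ] : Countable Γ :=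
  haveI : SecondCountableTopology Γ := TopologicalSpace.Subtype.secondCountableTopology _
  countable_of_Lindelof_of_discrete

/-- Cut W into countably many pieces, each moved into C by an element of Γ. The moved pieces are
disjoint because `proj Γ` is injective on W, and left invariance preserves their measures. With C
compact this bounds the total mass. -/
lemma pushHaar_le_of_cover [DiscreteTopology Γ] {C W : Set SL2R} (hC : MeasurableSet C)
    (hCu : proj Γ '' C = univ) (hW : MeasurableSet W) (hinj : InjOn (proj Γ) W) :
    pushHaar Γ W ≤ pushHaar Γ C := by
  refine Measure.le_iff.2 fun A hA => ?_
  rw [pushHaar_apply _ hA, pushHaar_apply _ hA]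
  have hA' : MeasurableSet (proj Γ ⁻¹' A) := measurable_proj hA
  have hm : ∀ γ : Γ, MeasurableSet ((fun g => (γ : SL2R) * g) ⁻¹' W ∩ (proj Γ ⁻¹' A ∩ C)) :=
    fun γ => (measurable_const_mul _ hW).inter (hA'.inter hC)
  have hγ : ∀ (γ : Γ) (g : SL2R), proj Γ ((γ : SL2R) * g) = proj Γ g := fun γ g =>
    (proj_eq_iff.2 (by simp)).symm
  have hdisj : Pairwise (Function.onFun Disjoint fun γ : Γ =>
      (fun g => (γ : SL2R) * g) ⁻¹' W ∩ (proj Γ ⁻¹' A ∩ C)) := fun γ δ hne => by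
    refine Set.disjoint_left.2 fun g hg hg' => hne ?_
    have := hinj hg.1 hg'.1 (by rw [hγ, hγ])
    exact Subtype.ext (mul_right_cancel this)
  calc (Measure.haar : Measure SL2R) (proj Γ ⁻¹' A ∩ W)
      ≤ (Measure.haar : Measure SL2R)
        (⋃ γ : Γ, (fun g => (γ : SL2R)⁻¹ * g) ⁻¹'
          ((fun g => (γ : SL2R) * g) ⁻¹' W ∩ (proj Γ ⁻¹' A ∩ C))) := by
        refine measure_mono fun g hg => ?_
        obtain ⟨c, hc, hcg⟩ := hCu.ge (mem_univ (proj Γ g))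
        rw [proj_eq_iff] at hcg
        refine mem_iUnion.2 ⟨⟨g * c⁻¹, hcg⟩, ?_⟩
        have e : (g * c⁻¹)⁻¹ * g = c := by group
        have e2 : proj Γ c = proj Γ g := proj_eq_iff.2 hcg
        simp only [mem_preimage, mem_inter_iff, e, e2]
        exact ⟨by simpa using hg.2, hg.1, hc⟩
    _ ≤ ∑' γ : Γ, (Measure.haar : Measure SL2R) ((fun g => (γ : SL2R)⁻¹ * g) ⁻¹'
          ((fun g => (γ : SL2R) * g) ⁻¹' W ∩ (proj Γ ⁻¹' A ∩ C))) := measure_iUnion_le _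
    _ = ∑' γ : Γ, (Measure.haar : Measure SL2R)
          ((fun g => (γ : SL2R) * g) ⁻¹' W ∩ (proj Γ ⁻¹' A ∩ C)) := by
        simp only [measure_preimage_mul]
    _ = (Measure.haar : Measure SL2R)
          (⋃ γ : Γ, (fun g => (γ : SL2R) * g) ⁻¹' W ∩ (proj Γ ⁻¹' A ∩ C)) :=
        (measure_iUnion hdisj hm).symm
    _ ≤ _ := measure_mono (iUnion_subset fun γ => inter_subset_right)

lemma haarQuotient_univ_lt_top [DiscreteTopology Γ] [CompactSpace (HomSpace Γ)] :
    haarQuotient Γ univ < ⊤ := by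
  obtain ⟨C, hC, hCu⟩ := exists_compact_proj_eq_univ (Γ := Γ)
  have h : haarQuotient Γ ≤ pushHaar Γ C :=
    iSup_le fun ⟨W, hW, hinj⟩ => pushHaar_le_of_cover hC.measurableSet hCu hW hinj
  refine (h univ).trans_lt ?_
  rw [pushHaar_apply _ MeasurableSet.univ, preimage_univ, univ_inter]
  exact hC.measure_lt_top

/-- Discreteness gives a neighbourhood of the identity with W W⁻¹ meeting Γ only in 1; its interior
is an admissible set of positive measure. -/
lemma haarQuotient_univ_ne_zero [DiscreteTopology Γ] : haarQuotient Γ univ ≠ 0 := by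
  obtain ⟨N, hN, hNΓ⟩ : ∃ N : Set SL2R, N ∈ 𝓝 (1 : SL2R) ∧ ∀ g ∈ N, g ∈ Γ → g = 1 := by
    have h1 : ({1} : Set Γ) ∈ 𝓝 (1 : Γ) := (isOpen_discrete _).mem_nhds rfl
    rw [nhds_subtype_eq_comap] at h1
    obtain ⟨N, hN, hN1⟩ := h1
    exact ⟨N, hN, fun g hg hgΓ => congrArg Subtype.val (hN1 (a := ⟨g, hgΓ⟩) hg)⟩
  have hdiv : Tendsto (fun p : SL2R × SL2R => p.2 * p.1⁻¹) (𝓝 (1, 1)) (𝓝 1) := by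
    have : Continuous (fun p : SL2R × SL2R => p.2 * p.1⁻¹) :=
      continuous_snd.mul continuous_fst.inv
    simpa using this.tendsto (1, 1)
  have h2 := hdiv hN
  rw [mem_map, nhds_prod_eq, mem_prod_self_iff] at h2
  obtain ⟨W, hW, hWN⟩ := h2
  have hinj : InjOn (proj Γ) (interior W) := fun a ha b hb hab => by
    have h3 := hNΓ _ (hWN (mk_mem_prod (interior_subset ha) (interior_subset hb)))
      (proj_eq_iff.1 hab)
    exact (mul_inv_eq_one.1 h3).symm
  have hpos : 0 < (Measure.haar : Measure SL2R) (interior W) :=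
    isOpen_interior.measure_pos _ ⟨1, mem_interior_iff_mem_nhds.2 hW⟩
  have h4 := pushHaar_le (interior W) isOpen_interior.measurableSet hinj univ
  rw [pushHaar_apply _ MeasurableSet.univ, preimage_univ, univ_inter] at h4
  exact (hpos.trans_le h4).ne'

lemma map_rightMul_vol (k : SL2R) : Measure.map (rightMul k) (vol Γ) = vol Γ := by
  rw [vol, Measure.map_smul, map_rightMul_haarQuotient]

variable [DiscreteTopology Γ] [CompactSpace (HomSpace Γ)]

instance instIsProbabilityMeasureVol : IsProbabilityMeasure (vol Γ) := ⟨by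
  rw [vol, Measure.smul_apply, smul_eq_mul]
  exact ENNReal.inv_mul_cancel haarQuotient_univ_ne_zero haarQuotient_univ_lt_top.ne⟩

instance instIsOpenPosMeasureVol : (vol Γ).IsOpenPosMeasure := ⟨fun U hU hne h0 => by
  obtain ⟨x, hx⟩ := hne
  obtain ⟨g, rfl⟩ := proj_surjective x
  have hcont : ∀ k : SL2R, Continuous (rightMul (Γ := Γ) k) := fun k =>
    continuous_rightMul_of continuous_const continuous_id
  -- By transitivity the translates of U cover the space, and finitely many suffice; if U were null,
  -- invariance would make the whole space null.
  obtain ⟨t, ht⟩ := isCompact_univ.elim_finite_subcover (fun k : SL2R => rightMul k ⁻¹' U)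
    (fun k => hU.preimage (hcont k)) (fun y _ => by
      obtain ⟨g', rfl⟩ := proj_surjective y
      exact mem_iUnion.2 ⟨g'⁻¹ * g, by simpa using hx⟩)
  have h1 : vol Γ (⋃ k ∈ t, rightMul k ⁻¹' U) = 0 :=
    (measure_biUnion_null_iff t.countable_toSet).2 fun k _ => by
      rw [← Measure.map_apply (measurable_rightMul k) hU.measurableSet, map_rightMul_vol, h0]
  have h2 := measure_mono_null ht h1
  rw [measure_univ] at h2
  exact one_ne_zero h2⟩

end Quotient

/-! ### Invariant integration of flow derivatives. -/

section Integration

variable [DiscreteTopology Γ] [CompactSpace (HomSpace Γ)] {f g : HomSpace Γ → ℂ}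

lemma aestronglyMeasurable_vol (hf : Continuous f) : AEStronglyMeasurable f (vol Γ) :=
  hf.measurable.aestronglyMeasurable

lemma integrable_vol (hf : Continuous f) : Integrable f (vol Γ) := by
  obtain ⟨C, -, hC⟩ := exists_norm_le hf
  exact Integrable.of_bound (aestronglyMeasurable_vol hf) C (Eventually.of_forall hC)

lemma integral_rightMul (hf : Continuous f) (k : SL2R) :
    ∫ x, f (rightMul k x) ∂vol Γ = ∫ x, f x ∂vol Γ := by
  have h := integral_map (μ := vol Γ) (measurable_rightMul k).aemeasurable
    (f := f) (by rw [map_rightMul_vol]; exact aestronglyMeasurable_vol hf)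
  rw [map_rightMul_vol] at h
  exact h.symm

/-- The integral of f translated by w(t) does not depend on t; differentiate under the integral at t
= 0. -/
lemma integral_flowDeriv_eq_zero (hf : Continuous f) (hg : Continuous g) {w : ℝ → SL2R}
    (hd : ∀ x t, HasDerivAt (fun s => f (rightMul (w s) x)) (g (rightMul (w t) x)) t) :
    ∫ x, g x ∂vol Γ = 0 := by
  obtain ⟨C, -, hC⟩ := exists_norm_le hg
  have hc : ∀ {h : HomSpace Γ → ℂ}, Continuous h → ∀ t, Continuous fun x => h (rightMul (w t) x) :=
    fun hh t => hh.comp (continuous_rightMul_of continuous_const continuous_id)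
  have h := (hasDerivAt_integral_of_dominated_loc_of_deriv_le (μ := vol Γ)
    (F := fun t x => f (rightMul (w t) x)) (F' := fun t x => g (rightMul (w t) x))
    (x₀ := (0 : ℝ)) (bound := fun _ => C) (s := univ) univ_mem
    (Eventually.of_forall fun t => aestronglyMeasurable_vol (hc hf t))
    (integrable_vol (hc hf 0)) (aestronglyMeasurable_vol (hc hg 0))
    (Eventually.of_forall fun x t _ => hC _) (integrable_const C)
    (Eventually.of_forall fun x t _ => hd x t)).2
  simp only [integral_rightMul hf, integral_rightMul hg] at h
  exact h.unique (hasDerivAt_const _ _)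

lemma integral_derivU (hf : IsCn 1 f) : ∫ x, derivU f x ∂vol Γ = 0 :=
  integral_flowDeriv_eq_zero hf.continuous (continuous_derivU hf) (hasDerivAt_horo hf)

lemma integral_derivX (hf : IsCn 1 f) : ∫ x, derivX f x ∂vol Γ = 0 :=
  integral_flowDeriv_eq_zero hf.continuous (continuous_derivX hf) (hasDerivAt_geo hf)

lemma integral_derivV (hf : IsCn 1 f) : ∫ x, derivV f x ∂vol Γ = 0 :=
  integral_flowDeriv_eq_zero hf.continuous (continuous_derivV hf) (hasDerivAt_horoUn hf)

end Integration


/-! ### Linearity, product rule and conjugation for the derivatives. -/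

section Linear

variable {n : WithTop ℕ∞} {f g : HomSpace Γ → ℂ}

lemma IsCn.add_mul (hf : IsCn n f) (hg : IsCn n g) (c : ℂ) : IsCn n (fun x => f x + c * g x) :=
  fun x => (hf x).add (contDiff_const.mul (hg x))

lemma IsCn.const_mul (hf : IsCn n f) (c : ℂ) : IsCn n (fun x => c * f x) :=
  fun x => contDiff_const.mul (hf x)

lemma IsCn.mul (hf : IsCn n f) (hg : IsCn n g) : IsCn n (fun x => f x * g x) :=
  fun x => (hf x).mul (hg x)

lemma IsCn.conj (hf : IsCn n f) : IsCn n (fun x => (starRingEnd ℂ) (f x)) :=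
  fun x => Complex.conjCLE.contDiff.comp (hf x)

lemma derivU_add_mul (hf : IsCn 1 f) (hg : IsCn 1 g) (c : ℂ) (x : HomSpace Γ) :
    derivU (fun x => f x + c * g x) x = derivU f x + c * derivU g x :=
  ((hasDerivAt_horo_zero hf x).add ((hasDerivAt_horo_zero hg x).const_mul c)).deriv

lemma derivX_add_mul (hf : IsCn 1 f) (hg : IsCn 1 g) (c : ℂ) (x : HomSpace Γ) :
    derivX (fun x => f x + c * g x) x = derivX f x + c * derivX g x :=
  ((hasDerivAt_geo_zero hf x).add ((hasDerivAt_geo_zero hg x).const_mul c)).deriv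

lemma derivV_add_mul (hf : IsCn 1 f) (hg : IsCn 1 g) (c : ℂ) (x : HomSpace Γ) :
    derivV (fun x => f x + c * g x) x = derivV f x + c * derivV g x :=
  ((hasDerivAt_horoUn_zero hf x).add ((hasDerivAt_horoUn_zero hg x).const_mul c)).deriv

lemma derivU_const_mul (hf : IsCn 1 f) (c : ℂ) (x : HomSpace Γ) :
    derivU (fun x => c * f x) x = c * derivU f x :=
  ((hasDerivAt_horo_zero hf x).const_mul c).deriv

lemma derivV_const_mul (hf : IsCn 1 f) (c : ℂ) (x : HomSpace Γ) :
    derivV (fun x => c * f x) x = c * derivV f x :=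
  ((hasDerivAt_horoUn_zero hf x).const_mul c).deriv

lemma derivU_mul (hf : IsCn 1 f) (hg : IsCn 1 g) (x : HomSpace Γ) :
    derivU (fun x => f x * g x) x = derivU f x * g x + f x * derivU g x := by
  have := ((hasDerivAt_horo_zero hf x).mul (hasDerivAt_horo_zero hg x)).deriv
  simp only [horo, expU_zero, rightMul_one] at this
  exact this

lemma derivX_mul (hf : IsCn 1 f) (hg : IsCn 1 g) (x : HomSpace Γ) :
    derivX (fun x => f x * g x) x = derivX f x * g x + f x * derivX g x := by
  have := ((hasDerivAt_geo_zero hf x).mul (hasDerivAt_geo_zero hg x)).deriv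
  simp only [geo, expX_zero, rightMul_one] at this
  exact this

lemma derivV_mul (hf : IsCn 1 f) (hg : IsCn 1 g) (x : HomSpace Γ) :
    derivV (fun x => f x * g x) x = derivV f x * g x + f x * derivV g x := by
  have := ((hasDerivAt_horoUn_zero hf x).mul (hasDerivAt_horoUn_zero hg x)).deriv
  simp only [horoUn, expV_zero, rightMul_one] at this
  exact this

lemma flowDeriv_conj (φ : ℝ → HomSpace Γ → HomSpace Γ) (f : HomSpace Γ → ℂ) (x : HomSpace Γ) :
    flowDeriv φ (fun x => (starRingEnd ℂ) (f x)) x = (starRingEnd ℂ) (flowDeriv φ f x) :=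
  deriv.star

end Linear

/-! ### Invariance of eigenfunctions under conjugation and translation. -/

section Eigen

variable {f : HomSpace Γ → ℂ} {μ : ℝ}

/-- The `C^2` eigenfunctions of the Casimir operator. -/
structure IsEigen (μ : ℝ) (f : HomSpace Γ → ℂ) : Prop where
  isCn : IsCn 2 f
  eig : ∀ x, casimir f x = (μ : ℂ) * f x

lemma IsEigen.conj (hf : IsEigen μ f) : IsEigen μ (fun x => (starRingEnd ℂ) (f x)) := by
  refine ⟨hf.isCn.conj, fun x => ?_⟩
  have h := congrArg (starRingEnd ℂ) (hf.eig x)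
  have hU : derivU (fun x => (starRingEnd ℂ) (derivV f x))
      = fun x => (starRingEnd ℂ) (derivU (derivV f) x) := funext (flowDeriv_conj horo _)
  have hX : ∀ f : HomSpace Γ → ℂ, derivX (fun x => (starRingEnd ℂ) (f x))
      = fun x => (starRingEnd ℂ) (derivX f x) := fun f => funext (flowDeriv_conj geo f)
  have hV : derivV (fun x => (starRingEnd ℂ) (f x))
      = fun x => (starRingEnd ℂ) (derivV f x) := funext (flowDeriv_conj horoUn f)
  simp only [casimir, map_sub, map_add, map_neg, map_mul, Complex.conj_ofReal] at h
  simp only [casimir, hX, hV, hU]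
  exact h

lemma IsCn.rightMul {n : WithTop ℕ∞} (hf : IsCn n f) (k : SL2R) :
    IsCn n (fun x => f (HorocycleFlow.rightMul k x)) :=
  (hf.translate (E := ℝ) (SmoothFam.const k)).isCn 0

lemma derivU_rightMul (hf : IsCn 1 f) (k : SL2R) (x : HomSpace Γ) :
    derivU (fun x => f (rightMul k x)) x
      = dirD (k⁻¹.1 * (!![0, 1; 0, 0] * k.1)) f (rightMul k x) := by
  have := (deriv_translate hf (hasDerivAt_expU 0) expU_zero k x).deriv
  simp only [← rightMul_rightMul] at this
  exact this

lemma derivX_rightMul (hf : IsCn 1 f) (k : SL2R) (x : HomSpace Γ) :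
    derivX (fun x => f (rightMul k x)) x
      = dirD (k⁻¹.1 * (!![1 / 2, 0; 0, -1 / 2] * k.1)) f (rightMul k x) := by
  have := (deriv_translate hf hasDerivAt_expX expX_zero k x).deriv
  simp only [← rightMul_rightMul] at this
  exact this

lemma derivV_rightMul (hf : IsCn 1 f) (k : SL2R) (x : HomSpace Γ) :
    derivV (fun x => f (rightMul k x)) x
      = dirD (k⁻¹.1 * (!![0, 0; 1, 0] * k.1)) f (rightMul k x) := by
  have := (deriv_translate hf (hasDerivAt_expV 0) expV_zero k x).deriv
  simp only [← rightMul_rightMul] at this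
  exact this

/-- Conjugation fixes U and adds multiples of U and X to X and V; the terms in s cancel by
`bracket_XU`. -/
lemma casimir_rightMul_expU (hf : IsCn 2 f) (s : ℝ) (x : HomSpace Γ) :
    casimir (fun x => f (rightMul (expU s) x)) x = casimir f (rightMul (expU s) x) := by
  have hU : ∀ {f : HomSpace Γ → ℂ}, IsCn 1 f → ∀ x,
      derivU (fun x => f (rightMul (expU s) x)) x = derivU f (rightMul (expU s) x) := fun hf x => by
    rw [derivU_rightMul hf]
    simp [dirD, expU_inv, expU_val, Matrix.mul_apply, Fin.sum_univ_two]
  have hX : ∀ {f : HomSpace Γ → ℂ}, IsCn 1 f → ∀ x, derivX (fun x => f (rightMul (expU s) x)) x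
      = derivX f (rightMul (expU s) x) + s * derivU f (rightMul (expU s) x) := fun hf x => by
    rw [derivX_rightMul hf]
    simp [dirD, expU_inv, expU_val, Matrix.mul_apply, Fin.sum_univ_two]
    ring
  have hV : derivV (fun x => f (rightMul (expU s) x)) = fun x =>
      derivV f (rightMul (expU s) x) + (-2 * s) * derivX f (rightMul (expU s) x)
        + (-s ^ 2) * derivU f (rightMul (expU s) x) := funext fun x => by
    rw [derivV_rightMul hf.one]
    simp [dirD, expU_inv, expU_val, Matrix.mul_apply, Fin.sum_univ_two]
    ring
  have cVX := hf.derivV'.add_mul hf.derivX' (-2 * s : ℂ)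
  have cg := hf.derivX'.add_mul hf.derivU' (s : ℂ)
  have hX' : derivX (fun x => f (rightMul (expU s) x)) = _ := funext (hX hf.one)
  simp only [casimir]
  rw [hV, hX', hX cg, hU (cVX.add_mul hf.derivU' (-s ^ 2 : ℂ)),
    derivX_add_mul hf.derivX' hf.derivU', derivU_add_mul hf.derivX' hf.derivU',
    derivU_add_mul cVX hf.derivU', derivU_add_mul hf.derivV' hf.derivX', bracket_XU hf]
  ring

lemma casimir_rightMul_expV (hf : IsCn 2 f) (s : ℝ) (x : HomSpace Γ) :
    casimir (fun x => f (rightMul (expV s) x)) x = casimir f (rightMul (expV s) x) := by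
  have hU : ∀ {f : HomSpace Γ → ℂ}, IsCn 1 f → ∀ x, derivU (fun x => f (rightMul (expV s) x)) x
      = derivU f (rightMul (expV s) x) + 2 * s * derivX f (rightMul (expV s) x)
        - s ^ 2 * derivV f (rightMul (expV s) x) := fun hf x => by
    rw [derivU_rightMul hf]
    simp [dirD, expV_inv, expV_val, Matrix.mul_apply, Fin.sum_univ_two]
    ring
  have hX : ∀ {f : HomSpace Γ → ℂ}, IsCn 1 f → ∀ x, derivX (fun x => f (rightMul (expV s) x)) x
      = derivX f (rightMul (expV s) x) + (-s) * derivV f (rightMul (expV s) x) := fun hf x => by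
    rw [derivX_rightMul hf]
    simp [dirD, expV_inv, expV_val, Matrix.mul_apply, Fin.sum_univ_two]
    ring
  have hV : derivV (fun x => f (rightMul (expV s) x))
      = fun x => derivV f (rightMul (expV s) x) := funext fun x => by
    rw [derivV_rightMul hf.one]
    simp [dirD, expV_inv, expV_val, Matrix.mul_apply, Fin.sum_univ_two]
  have cg := hf.derivX'.add_mul hf.derivV' (-s : ℂ)
  have hX' : derivX (fun x => f (rightMul (expV s) x)) = _ := funext (hX hf.one)
  simp only [casimir]
  rw [hV, hX', hX cg, hU hf.derivV',
    derivX_add_mul hf.derivX' hf.derivV', derivV_add_mul hf.derivX' hf.derivV', bracket_XV hf]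
  ring

/-- The Casimir operator commutes with right translations. -/
lemma casimir_rightMul (hf : IsCn 2 f) (k : SL2R) (x : HomSpace Γ) :
    casimir (fun x => f (rightMul k x)) x = casimir f (rightMul k x) := by
  refine shear_induction (P := fun k => ∀ f : HomSpace Γ → ℂ, IsCn 2 f → ∀ x,
    casimir (fun x => f (rightMul k x)) x = casimir f (rightMul k x))
    (fun s f hf x => casimir_rightMul_expU hf s x) (fun s f hf x => casimir_rightMul_expV hf s x)
    (fun k l hk hl f hf x => ?_) k f hf x
  simp only [← rightMul_rightMul]
  rw [hk _ (hf.rightMul l), hl f hf]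

lemma IsEigen.rightMul (hf : IsEigen μ f) (k : SL2R) :
    IsEigen μ (fun x => f (HorocycleFlow.rightMul k x)) :=
  ⟨hf.isCn.rightMul k, fun x => by rw [casimir_rightMul hf.isCn, hf.eig]⟩

end Eigen

/-! ### Integrals of smooth families of eigenfunctions. -/

section ParametricIntegral

universe u

lemma continuous_fderiv_fst {P G : Type u} [NormedAddCommGroup P] [NormedSpace ℝ P]
    [NormedAddCommGroup G] [NormedSpace ℝ G] {n m : WithTop ℕ∞} (hm : m + 1 ≤ n)
    {Φ : P × ℝ → G} (hΦ : ContDiff ℝ n Φ) :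
    ContDiff ℝ m (fun q : P × ℝ => fderiv ℝ (fun p => Φ (p, q.2)) q.1) := by
  have hn : n ≠ 0 := by
    rintro rfl
    simp at hm
  have h : ∀ q : P × ℝ, fderiv ℝ (fun p => Φ (p, q.2)) q.1
      = (fderiv ℝ Φ q).comp (ContinuousLinearMap.inl ℝ P ℝ) := fun q =>
    (((hΦ.differentiable hn).differentiableAt (x := q)).hasFDerivAt.comp q.1
      (hasFDerivAt_prodMk_left q.1 q.2)).fderiv
  simp only [h]
  exact (hΦ.fderiv_right hm).clm_comp contDiff_const

lemma hasFDerivAt_intervalIntegral {P G : Type u} [NormedAddCommGroup P] [NormedSpace ℝ P]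
    [ProperSpace P] [NormedAddCommGroup G] [NormedSpace ℝ G] {Φ : P × ℝ → G}
    (hΦ : ContDiff ℝ 1 Φ) (a b : ℝ) (p : P) :
    HasFDerivAt (fun p => ∫ θ in a..b, Φ (p, θ))
      (∫ θ in a..b, fderiv ℝ (fun p => Φ (p, θ)) p) p := by
  have hc := (continuous_fderiv_fst (m := 0) (by simp) hΦ).continuous
  obtain ⟨C, hC⟩ := ((isCompact_closedBall p 1).prod
    (isCompact_uIcc (a := a) (b := b))).exists_bound_of_continuousOn hc.continuousOn
  refine intervalIntegral.hasFDerivAt_integral_of_dominated_of_fderiv_le (μ := volume)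
    (F := fun p θ => Φ (p, θ)) (F' := fun p θ => fderiv ℝ (fun p => Φ (p, θ)) p)
    (s := Metric.closedBall p 1) (bound := fun _ => C) (Metric.closedBall_mem_nhds p one_pos)
    (Eventually.of_forall fun p => (hΦ.continuous.comp
      (Continuous.prodMk_right p)).aestronglyMeasurable)
    ((hΦ.continuous.comp (Continuous.prodMk_right p)).intervalIntegrable _ _)
    ((hc.comp (Continuous.prodMk_right p)).aestronglyMeasurable)
    (Eventually.of_forall fun θ hθ q hq => hC (q, θ) ⟨hq, uIoc_subset_uIcc hθ⟩)
    intervalIntegrable_const (Eventually.of_forall fun θ _ q _ => ?_)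
  have h1 : Differentiable ℝ fun p => Φ (p, θ) := fun p =>
    (((hΦ.differentiable one_ne_zero).differentiableAt (x := (p, θ))).hasFDerivAt.comp p
      (hasFDerivAt_prodMk_left p θ)).differentiableAt
  exact h1.differentiableAt.hasFDerivAt

/-- The target G varies in the induction because the derivative takes values in P →L[ℝ] G; P and G
share a universe so that this space stays in it. -/
lemma contDiff_intervalIntegral {P : Type u} [NormedAddCommGroup P] [NormedSpace ℝ P]
    [ProperSpace P] (n : ℕ) : ∀ {G : Type u} [NormedAddCommGroup G] [NormedSpace ℝ G]
    {Φ : P × ℝ → G}, ContDiff ℝ n Φ → ∀ a b : ℝ,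
    ContDiff ℝ n (fun p => ∫ θ in a..b, Φ (p, θ)) := by
  induction n with
  | zero =>
    intro G _ _ Φ hΦ a b
    exact contDiff_zero.2 (intervalIntegral.continuous_parametric_intervalIntegral_of_continuous'
      (f := fun p θ => Φ (p, θ)) hΦ.continuous a b)
  | succ n ih =>
    intro G _ _ Φ hΦ a b
    refine contDiff_succ_iff_hasFDerivAt.2 ⟨fun p => ∫ θ in a..b, fderiv ℝ (fun p => Φ (p, θ)) p,
      ?_, fun p => hasFDerivAt_intervalIntegral (hΦ.of_le (by norm_cast; omega)) a b p⟩
    exact ih (continuous_fderiv_fst (by norm_cast) hΦ) a b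

variable {h : ℝ → HomSpace Γ → ℂ}

lemma IsCnFam.intervalIntegral {n : ℕ} (hh : IsCnFam n h) (a b : ℝ) :
    IsCn n (fun x => ∫ θ in a..b, h θ x) := fun x =>
  contDiff_intervalIntegral n (Φ := fun q : (ℝ × ℝ × ℝ) × ℝ => h q.2 (rightMul (box q.1) x))
    ((hh x).comp (contDiff_snd.prodMk contDiff_fst)) a b

lemma deriv_intervalIntegral (hh : IsCnFam 1 h) (a b : ℝ) {w : ℝ → SL2R} (hw : SmoothFam 1 w)
    (x : HomSpace Γ) :
    deriv (fun t => ∫ θ in a..b, h θ (rightMul (w t) x)) 0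
      = ∫ θ in a..b, deriv (fun t => h θ (rightMul (w t) x)) 0 := by
  have hΦ : ContDiff ℝ 1 (fun q : ℝ × ℝ => h q.2 (rightMul (w q.1) x)) :=
    hh.contDiff contDiff_snd (hw.comp contDiff_fst) x
  have h1 := hasFDerivAt_intervalIntegral hΦ a b (0 : ℝ)
  have hc := (continuous_fderiv_fst (m := 0) (by simp) hΦ).continuous
  have h2 := h1.hasDerivAt.deriv
  have hi : IntervalIntegrable (fun θ => fderiv ℝ (fun p => h θ (rightMul (w p) x)) 0)
      volume a b := (hc.comp (Continuous.prodMk_right 0)).intervalIntegrable _ _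
  exact h2.trans (ContinuousLinearMap.intervalIntegral_apply hi 1)

lemma IsEigen.intervalIntegral {μ : ℝ} (hh : IsCnFam 2 h) (he : ∀ θ, IsEigen μ (h θ)) (a b : ℝ) :
    IsEigen μ (fun x => ∫ θ in a..b, h θ x) := by
  refine ⟨hh.intervalIntegral a b, fun x => ?_⟩
  have h1 : IsCnFam 1 h := hh.of_le (by norm_num)
  have hX : derivX (fun x => ∫ θ in a..b, h θ x) = fun x => ∫ θ in a..b, derivX (h θ) x :=
    funext fun x => deriv_intervalIntegral h1 a b smoothFam_expX x
  have hV : derivV (fun x => ∫ θ in a..b, h θ x) = fun x => ∫ θ in a..b, derivV (h θ) x :=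
    funext fun x => deriv_intervalIntegral h1 a b smoothFam_expV x
  have cX : IsCnFam 1 fun θ => derivX (h θ) := hh.derivX (by norm_num)
  have cV : IsCnFam 1 fun θ => derivV (h θ) := hh.derivV (by norm_num)
  have hXX : derivX (fun x => ∫ θ in a..b, derivX (h θ) x) x
      = ∫ θ in a..b, derivX (derivX (h θ)) x :=
    deriv_intervalIntegral cX a b smoothFam_expX x
  have hUV : derivU (fun x => ∫ θ in a..b, derivV (h θ) x) x
      = ∫ θ in a..b, derivU (derivV (h θ)) x :=
    deriv_intervalIntegral cV a b smoothFam_expU x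
  have hi : ∀ {k : ℝ → HomSpace Γ → ℂ}, IsCnFam 0 k →
      IntervalIntegrable (fun θ => k θ x) volume a b := fun hk =>
    (hk.continuous.comp (Continuous.prodMk_left x)).intervalIntegrable _ _
  have iX : IntervalIntegrable (fun θ => derivX (h θ) x) volume a b := hi (cX.of_le (by simp))
  have iXX : IntervalIntegrable (fun θ => derivX (derivX (h θ)) x) volume a b :=
    hi (cX.derivX (by simp))
  have iUV : IntervalIntegrable (fun θ => derivU (derivV (h θ)) x) volume a b :=
    hi (cV.derivU (by simp))
  simp only [casimir]
  have key : ∫ θ in a..b, (-derivX (derivX (h θ)) x + derivX (h θ) x - derivU (derivV (h θ)) x)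
      = ∫ θ in a..b, (μ : ℂ) * h θ x :=
    intervalIntegral.integral_congr fun θ _ => (he θ).eig x
  have iXX' : IntervalIntegrable (fun θ => -derivX (derivX (h θ)) x) volume a b := iXX.neg
  rw [intervalIntegral.integral_sub (iXX'.add iX) iUV, intervalIntegral.integral_add iXX' iX,
    intervalIntegral.integral_neg, intervalIntegral.integral_const_mul] at key
  rw [hX, hV, hXX, hUV]
  exact key

end ParametricIntegral


/-! ### The rotation group and its characters. -/

section Rotations

/-- The rotations `exp (θ (U - V))`. -/
noncomputable def rot (θ : ℝ) : SL2R :=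
  ⟨!![Real.cos θ, Real.sin θ; -Real.sin θ, Real.cos θ], by
    rw [Matrix.det_fin_two_of]; nlinarith [Real.sin_sq_add_cos_sq θ]⟩

lemma rot_val (θ : ℝ) : (rot θ).1 = !![Real.cos θ, Real.sin θ; -Real.sin θ, Real.cos θ] := rfl

lemma rot_add (θ φ : ℝ) : rot (θ + φ) = rot θ * rot φ := by
  apply SL2R_ext <;> simp [mul_val, rot_val, Real.cos_add, Real.sin_add] <;> ring

@[simp] lemma rot_zero : rot 0 = 1 := by
  apply SL2R_ext <;> simp [rot_val, one_val]

lemma rot_periodic : Function.Periodic rot (2 * Real.pi) := fun θ => by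
  apply SL2R_ext <;> simp [rot_val]

lemma smoothFam_rot {n : WithTop ℕ∞} : SmoothFam n rot := fun i j => by
  fin_cases i <;> fin_cases j <;> simp [rot_val]
  exacts [Real.contDiff_cos, Real.contDiff_sin, Real.contDiff_sin.neg, Real.contDiff_cos]

lemma hasDerivAt_rot (i j : Fin 2) :
    HasDerivAt (fun θ => (rot θ).1 i j) ((!![0, 1; -1, 0] : Matrix (Fin 2) (Fin 2) ℝ) i j) 0 := by
  fin_cases i <;> fin_cases j <;> simp [rot_val]
  · simpa using Real.hasDerivAt_cos 0
  · simpa using Real.hasDerivAt_sin 0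
  · have := (Real.hasDerivAt_sin 0).neg
    rw [Real.cos_zero] at this
    exact this
  · simpa using Real.hasDerivAt_cos 0

lemma continuous_rot : Continuous rot := (smoothFam_rot (n := 0)).continuous

/-- The character `θ ↦ e^{i n θ}`. -/
noncomputable def chi (n : ℤ) (θ : ℝ) : ℂ := Complex.exp (Complex.I * n * θ)

lemma contDiff_chi (n : ℤ) {m : WithTop ℕ∞} : ContDiff ℝ m (chi n) := by
  exact (contDiff_const.mul Complex.ofRealCLM.contDiff).cexp

lemma continuous_chi (n : ℤ) : Continuous (chi n) := (contDiff_chi n (m := 0)).continuous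

lemma chi_mul (n m : ℤ) (θ : ℝ) : chi n θ * chi m θ = chi (n + m) θ := by
  rw [chi, chi, chi, ← Complex.exp_add]; congr 1; push_cast; ring

lemma chi_add (n : ℤ) (θ φ : ℝ) : chi n (θ + φ) = chi n θ * chi n φ := by
  rw [chi, chi, chi, ← Complex.exp_add]; congr 1; push_cast; ring

@[simp] lemma chi_zero (n : ℤ) : chi n 0 = 1 := by simp [chi]

@[simp] lemma zero_chi (θ : ℝ) : chi 0 θ = 1 := by simp [chi]

lemma chi_periodic (n : ℤ) : Function.Periodic (chi n) (2 * Real.pi) := fun θ => by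
  rw [chi_add]
  have : chi n (2 * Real.pi) = 1 := by
    rw [chi, ← Complex.exp_int_mul_two_pi_mul_I n]
    congr 1; push_cast; ring
  rw [this, mul_one]

lemma conj_chi (n : ℤ) (θ : ℝ) : (starRingEnd ℂ) (chi n θ) = chi (-n) θ := by
  rw [chi, chi, ← Complex.exp_conj]
  simp

lemma norm_chi (n : ℤ) (θ : ℝ) : ‖chi n θ‖ = 1 := by
  have : Complex.I * n * θ = ((n * θ : ℝ) : ℂ) * Complex.I := by push_cast; ring
  rw [chi, this, Complex.norm_exp_ofReal_mul_I]

lemma hasDerivAt_chi (n : ℤ) (θ : ℝ) : HasDerivAt (chi n) (Complex.I * n * chi n θ) θ := by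
  have h : HasDerivAt (fun θ : ℝ => Complex.I * n * (θ : ℂ)) (Complex.I * n * 1) θ :=
    ((hasDerivAt_id θ).ofReal_comp).const_mul _
  exact h.cexp.congr_deriv (by rw [chi]; ring)

lemma integral_chi {n : ℤ} (hn : n ≠ 0) : ∫ θ in (0 : ℝ)..2 * Real.pi, chi n θ = 0 := by
  have hc : (Complex.I * n : ℂ) ≠ 0 := mul_ne_zero Complex.I_ne_zero (by exact_mod_cast hn)
  have hd : ∀ θ, HasDerivAt (fun θ => (Complex.I * n)⁻¹ * chi n θ) (chi n θ) θ := fun θ =>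
    ((hasDerivAt_chi n θ).const_mul _).congr_deriv (by rw [inv_mul_cancel_left₀ hc])
  rw [intervalIntegral.integral_eq_sub_of_hasDerivAt (fun θ _ => hd θ)
    ((continuous_chi n).intervalIntegrable _ _)]
  have := chi_periodic n 0
  rw [zero_add] at this
  rw [this, sub_self]

end Rotations

/-! ### Uniqueness of Fourier coefficients. -/

section Fourier

/-- Zero coefficients are summable, and a continuous periodic function with summable coefficients is
the pointwise sum of its Fourier series. -/
lemma eq_zero_of_fourier {c : ℝ → ℂ} (hc : Continuous c)
    (hper : Function.Periodic c (2 * Real.pi))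
    (h : ∀ n : ℤ, ∫ θ in (0 : ℝ)..2 * Real.pi, chi (-n) θ * c θ = 0) (θ : ℝ) : c θ = 0 := by
  have : Fact (0 < 2 * Real.pi) := ⟨Real.two_pi_pos⟩
  let F : C(AddCircle (2 * Real.pi), ℂ) := ⟨hper.lift, by
    exact continuous_coinduced_dom.2 hc⟩
  have hF : ∀ t : ℝ, F (t : AddCircle (2 * Real.pi)) = c t := fun t => hper.lift_coe t
  have hcoef : ∀ n : ℤ, fourierCoeff F n = 0 := fun n => by
    rw [fourierCoeff_eq_intervalIntegral F n 0, zero_add]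
    have : ∀ t : ℝ, fourier (-n) (t : AddCircle (2 * Real.pi)) • F (t : AddCircle (2 * Real.pi))
        = chi (-n) t * c t := fun t => by
      rw [hF, fourier_coe_apply, smul_eq_mul, chi]
      congr 2
      push_cast
      have : (Real.pi : ℂ) ≠ 0 := by exact_mod_cast Real.pi_ne_zero
      field_simp
    simp only [this, h, smul_zero]
  have hs := has_pointwise_sum_fourier_series_of_summable (f := F)
    (by rw [show fourierCoeff F = fun _ => 0 from funext hcoef]; exact summable_zero)
    (θ : AddCircle (2 * Real.pi))
  simp only [hcoef, zero_smul] at hs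
  rw [← hF]
  exact hs.unique hasSum_zero

end Fourier

/-! ### Weight vectors, the lowering operator and the energy identity. -/

section Weights

variable {f F : HomSpace Γ → ℂ} {μ : ℝ} {n : ℤ}

/-- `F` transforms under the rotations by the character `e^{i n θ}`. -/
def IsWeight (n : ℤ) (F : HomSpace Γ → ℂ) : Prop :=
  ∀ θ x, F (rightMul (rot θ) x) = chi n θ * F x

/-- The (unnormalised) projection to the weight `n`. -/
noncomputable def kPart (n : ℤ) (f : HomSpace Γ → ℂ) (x : HomSpace Γ) : ℂ :=
  ∫ θ in (0 : ℝ)..2 * Real.pi, chi (-n) θ * f (rightMul (rot θ) x)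

lemma isWeight_kPart (n : ℤ) (f : HomSpace Γ → ℂ) : IsWeight n (kPart n f) := fun φ x => by
  have hper : Function.Periodic (fun θ => chi (-n) θ * f (rightMul (rot θ) x)) (2 * Real.pi) :=
    fun θ => by simp only [chi_periodic (-n) θ, rot_periodic θ]
  have h1 := hper.intervalIntegral_add_eq φ 0
  have h2 := intervalIntegral.integral_comp_add_right (a := 0) (b := 2 * Real.pi)
    (fun θ => chi (-n) θ * f (rightMul (rot θ) x)) φ
  rw [zero_add, add_comm _ φ, h1, zero_add] at h2
  rw [kPart, kPart, ← h2, ← intervalIntegral.integral_const_mul]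
  refine intervalIntegral.integral_congr fun θ _ => ?_
  have h3 : chi n φ * chi (-n) (θ + φ) = chi (-n) θ := by
    rw [chi_add, mul_left_comm, chi_mul, add_neg_cancel, zero_chi, mul_one]
  simp only [rightMul_rightMul, ← rot_add]
  rw [← mul_assoc, h3, add_comm φ θ]

lemma IsEigen.const_mul (hf : IsEigen μ f) (c : ℂ) : IsEigen μ (fun x => c * f x) := by
  refine ⟨hf.isCn.const_mul c, fun x => ?_⟩
  have h := hf.eig x
  have hX : ∀ {f : HomSpace Γ → ℂ}, IsCn 1 f →
      derivX (fun x => c * f x) = fun x => c * derivX f x := fun hf =>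
    funext fun x => ((hasDerivAt_geo_zero hf x).const_mul c).deriv
  simp only [casimir] at h ⊢
  rw [hX hf.isCn.one, funext (derivV_const_mul hf.isCn.one c), hX hf.isCn.derivX',
    derivU_const_mul hf.isCn.derivV', mul_left_comm, ← h]
  ring

lemma derivX_const_mul (hf : IsCn 1 f) (c : ℂ) (x : HomSpace Γ) :
    derivX (fun x => c * f x) x = c * derivX f x :=
  ((hasDerivAt_geo_zero hf x).const_mul c).deriv

lemma isEigen_kPart (hf : IsEigen μ f) (n : ℤ) : IsEigen μ (kPart n f) := by
  have h : IsCnFam 2 (fun θ x => chi (-n) θ * f (rightMul (rot θ) x)) := fun x =>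
    ((contDiff_chi (-n)).comp contDiff_fst).mul (hf.isCn.translate smoothFam_rot x)
  exact IsEigen.intervalIntegral h (fun θ => (hf.rightMul (rot θ)).const_mul _) _ _

/-- Rotations are generated by U - V, which acts on weight n as multiplication by in. This
eliminates V in favour of U. -/
lemma IsWeight.deriv (hF : IsCn 1 F) (hw : IsWeight n F) (x : HomSpace Γ) :
    derivV F x = derivU F x + -(Complex.I * n) * F x := by
  have h1 := hasDerivAt_curve hF (fun i j => hasDerivAt_rot i j) x
  have h2 : HasDerivAt (fun θ => F (rightMul (rot θ) x)) (Complex.I * n * F x) 0 := by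
    have h := (hasDerivAt_chi n 0).mul_const (F x)
    rw [chi_zero, mul_one] at h
    simp only [hw _ x]
    exact h
  have h3 := h1.unique h2
  simp [dirD, rightMul_one] at h3
  linear_combination -h3

/-- `X F - i Y F`, where `Y = (U + V) / 2`. -/
noncomputable def lower (F : HomSpace Γ → ℂ) (x : HomSpace Γ) : ℂ :=
  derivX F x + -(Complex.I / 2) * derivU F x + -(Complex.I / 2) * derivV F x

lemma IsCn.lower (hF : IsCn 2 F) : IsCn 1 (HorocycleFlow.lower F) :=
  (hF.derivX'.add_mul hF.derivU' _).add_mul hF.derivV' _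

lemma lower_eq (hF : IsCn 1 F) (hw : IsWeight n F) (x : HomSpace Γ) :
    lower F x = derivX F x - Complex.I * derivU F x - n / 2 * F x := by
  rw [lower, hw.deriv hF]
  linear_combination (n / 2 * F x) * Complex.I_sq

/-- With Θ = U - V and Y = (U + V)/2, the brackets give □ = -X² - Y² + Θ²/4 and [X, Y] = Θ/2. Hence
(X + iY)(X - iY) = -□ + Θ²/4 - (i/2)Θ, where Θ acts as in. -/
lemma raise_lower (hF : IsEigen μ F) (hw : IsWeight n F) (x : HomSpace Γ) :
    derivX (lower F) x + Complex.I / 2 * (derivU (lower F) x + derivV (lower F) x)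
      = -(μ + n ^ 2 / 4 - n / 2) * F x := by
  have h := hF.isCn
  have c1 := h.derivX'.add_mul h.derivU' (-(Complex.I / 2))
  have hV : derivV F = _ := funext (hw.deriv h.one)
  have hUV : derivU (derivV F) x = derivU (derivU F) x + -(Complex.I * n) * derivU F x := by
    rw [hV, derivU_add_mul h.derivU' h.one]
  have hVV : derivV (derivV F) x = derivV (derivU F) x + -(Complex.I * n) * derivV F x := by
    conv_lhs => rw [hV, derivV_add_mul h.derivU' h.one]
  have e := hF.eig x
  rw [casimir] at e
  have hl : lower F = fun x => (fun x => derivX F x + -(Complex.I / 2) * derivU F x) x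
    + -(Complex.I / 2) * derivV F x := rfl
  rw [hl, derivX_add_mul c1 h.derivV', derivU_add_mul c1 h.derivV', derivV_add_mul c1 h.derivV',
    derivX_add_mul h.derivX' h.derivU', derivU_add_mul h.derivX' h.derivU',
    derivV_add_mul h.derivX' h.derivU', bracket_XU h, bracket_XV h]
  have hb := bracket_UV h x
  have hVx := hw.deriv h.one x
  linear_combination -e - (1 / 4) * hUV + (1 / 4) * hVV - (1 / 2) * hb
    - (Complex.I * n / 4 - Complex.I / 2) * hVx + (-(derivU (derivU F) x + derivU (derivV F) x
      + derivV (derivU F) x + derivV (derivV F) x) / 4 + (n ^ 2 / 4 - n / 2) * F x) * Complex.I_sq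

/-- The energy identity for the lowering operator. -/
lemma integral_lower [DiscreteTopology Γ] [CompactSpace (HomSpace Γ)]
    (hF : IsEigen μ F) (hw : IsWeight n F) :
    ∫ x, ‖lower F x‖ ^ 2 ∂(vol Γ) = (μ + n ^ 2 / 4 - n / 2) * ∫ x, ‖F x‖ ^ 2 ∂(vol Γ) := by
  have h := hF.isCn
  have cB : IsCn 1 (lower F) := h.lower
  have cF := h.one.conj
  have c := cF.mul cB
  have hU := integral_derivU c
  have hX := integral_derivX c
  have hV := integral_derivV c
  -- Integration by parts: apply X + iY to the product of conj F and lower F. The left side has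
  -- integral zero, and moving the operator onto conj F produces the conjugate of lower F.
  have key : ∀ x, derivX (fun x => (starRingEnd ℂ) (F x) * lower F x) x + (Complex.I / 2) *
      (derivU (fun x => (starRingEnd ℂ) (F x) * lower F x) x
        + derivV (fun x => (starRingEnd ℂ) (F x) * lower F x) x)
      = (starRingEnd ℂ) (lower F x) * lower F x
        - (μ + n ^ 2 / 4 - n / 2) * ((starRingEnd ℂ) (F x) * F x) := fun x => by
    have e := raise_lower hF hw x
    have hl : (starRingEnd ℂ) (lower F x) = (starRingEnd ℂ) (derivX F x)
        + Complex.I / 2 * (starRingEnd ℂ) (derivU F x)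
        + Complex.I / 2 * (starRingEnd ℂ) (derivV F x) := by
      simp [lower, map_ofNat]
      ring
    rw [derivX_mul cF cB, derivU_mul cF cB, derivV_mul cF cB, hl]
    have fX : derivX (fun x => (starRingEnd ℂ) (F x)) x = (starRingEnd ℂ) (derivX F x) :=
      flowDeriv_conj geo F x
    have fU : derivU (fun x => (starRingEnd ℂ) (F x)) x = (starRingEnd ℂ) (derivU F x) :=
      flowDeriv_conj horo F x
    have fV : derivV (fun x => (starRingEnd ℂ) (F x)) x = (starRingEnd ℂ) (derivV F x) :=
      flowDeriv_conj horoUn F x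
    rw [fX, fU, fV]
    linear_combination (starRingEnd ℂ) (F x) * e
  have iX := integrable_vol (continuous_derivX c)
  have iU := integrable_vol (continuous_derivU c)
  have iV := integrable_vol (continuous_derivV c)
  have h1 := integral_add iX ((iU.add iV).const_mul (Complex.I / 2))
  simp only [Pi.add_apply] at h1
  rw [integral_const_mul, integral_add iU iV, hU, hX, hV, integral_congr_ae
    (Eventually.of_forall key)] at h1
  have hn : ∀ z : ℂ, (starRingEnd ℂ) z * z = ((‖z‖ ^ 2 : ℝ) : ℂ) := fun z => by
    rw [Complex.conj_mul']; push_cast; rfl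
  simp only [hn] at h1
  have i1 : Integrable (fun x => ((‖lower F x‖ ^ 2 : ℝ) : ℂ)) (vol Γ) :=
    integrable_vol (Complex.continuous_ofReal.comp (cB.continuous.norm.pow 2))
  have i2 : Integrable (fun x => ((‖F x‖ ^ 2 : ℝ) : ℂ)) (vol Γ) :=
    integrable_vol (Complex.continuous_ofReal.comp (h.continuous.norm.pow 2))
  rw [integral_sub i1 (i2.const_mul _), integral_const_mul, integral_complex_ofReal, integral_complex_ofReal,
    add_zero, mul_zero, add_zero, sub_eq_zero] at h1
  have h2 : ((μ : ℂ) + n ^ 2 / 4 - n / 2) = ((μ + n ^ 2 / 4 - n / 2 : ℝ) : ℂ) := by push_cast; rfl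
  rw [h2] at h1
  exact_mod_cast h1

lemma eq_zero_of_integral_sq [DiscreteTopology Γ] [CompactSpace (HomSpace Γ)]
    (hF : Continuous F) (h : ∫ x, ‖F x‖ ^ 2 ∂(vol Γ) = 0) (x : HomSpace Γ) : F x = 0 := by
  have i2 : Integrable (fun x => ‖F x‖ ^ 2) (vol Γ) := by
    have := (integrable_vol (Γ := Γ) (Complex.continuous_ofReal.comp (hF.norm.pow 2))).re
    exact this
  have h1 := (integral_eq_zero_iff_of_nonneg (fun x => by positivity) i2).1 h
  have h2 := ((hF.norm.pow 2).ae_eq_iff_eq (vol Γ) continuous_const).1 h1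
  have h3 : ‖F x‖ ^ 2 = 0 := congrFun h2 x
  exact norm_eq_zero.1 (pow_eq_zero_iff two_ne_zero |>.1 h3)

lemma lower_eq_zero [DiscreteTopology Γ] [CompactSpace (HomSpace Γ)] (hF : IsEigen μ F)
    (hw : IsWeight n F) (h : μ + (n : ℝ) ^ 2 / 4 - n / 2 = 0) (x : HomSpace Γ) : lower F x = 0 :=
  eq_zero_of_integral_sq hF.isCn.lower.continuous (by rw [integral_lower hF hw, h, zero_mul]) x

lemma eq_zero_of_neg [DiscreteTopology Γ] [CompactSpace (HomSpace Γ)] (hF : IsEigen μ F)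
    (hw : IsWeight n F) (h : μ + (n : ℝ) ^ 2 / 4 - n / 2 < 0) (x : HomSpace Γ) : F x = 0 := by
  refine eq_zero_of_integral_sq hF.isCn.continuous ?_ x
  have h1 := integral_lower hF hw
  have h2 : 0 ≤ ∫ x, ‖lower F x‖ ^ 2 ∂(vol Γ) := integral_nonneg fun x => by positivity
  have h3 : 0 ≤ ∫ x, ‖F x‖ ^ 2 ∂(vol Γ) := integral_nonneg fun x => by positivity
  nlinarith

lemma eq_zero_of_lower [DiscreteTopology Γ] [CompactSpace (HomSpace Γ)] (hF : IsEigen μ F)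
    (hw : IsWeight n F) (h : μ + (n : ℝ) ^ 2 / 4 - n / 2 ≠ 0) (hl : ∀ x, lower F x = 0)
    (x : HomSpace Γ) : F x = 0 := by
  refine eq_zero_of_integral_sq hF.isCn.continuous ?_ x
  have h1 := integral_lower hF hw
  simp only [hl, norm_zero, ne_eq, OfNat.ofNat_ne_zero, not_false_eq_true, zero_pow,
    integral_zero] at h1
  exact (mul_eq_zero.1 h1.symm).resolve_left h

/-- The projection of `X F` to the weight `n - 2`. -/
lemma kPart_derivX (hF : IsCn 1 F) (hw : IsWeight n F) (x : HomSpace Γ) :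
    kPart (n - 2) (derivX F) x = Real.pi * lower F x := by
  have hX : ∀ θ, derivX F (rightMul (rot θ) x) = chi n θ * ((Real.cos θ ^ 2 - Real.sin θ ^ 2)
      * derivX F x - Real.sin θ * Real.cos θ * (derivU F x + derivV F x)) := fun θ => by
    have h1 := derivX_rightMul (hF.const_mul (chi n θ)) (rot θ)⁻¹ (rightMul (rot θ) x)
    have h2 : (fun y => chi n θ * F (rightMul (rot θ)⁻¹ y)) = F := funext fun y => by
      rw [← hw, rightMul_rightMul, inv_mul_cancel, rightMul_one]
    rw [h2, rightMul_rightMul, mul_inv_cancel, rightMul_one] at h1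
    rw [h1]
    simp only [dirD, derivX_const_mul hF, derivU_const_mul hF, derivV_const_mul hF]
    simp [inv_val, rot_val, Matrix.mul_apply, Fin.sum_univ_two]
    ring
  -- Split X into halves of X - iY and X + iY. The first lowers the weight by 2 and gives a constant
  -- integrand; the second raises it by 2 and leaves the character of index 4, whose integral is
  -- zero.
  have hI : ∀ θ, chi (-(n - 2)) θ * derivX F (rightMul (rot θ) x)
      = chi 4 θ * ((derivX F x + Complex.I / 2 * (derivU F x + derivV F x)) / 2)
        + lower F x / 2 := fun θ => by
    have e : chi (-(n - 2)) θ * chi n θ = chi 2 θ := by rw [chi_mul]; congr 1; ring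
    have e4 : chi 4 θ = chi 2 θ * chi 2 θ := by rw [chi_mul]; rfl
    have ec : chi 2 θ = Real.cos θ ^ 2 - Real.sin θ ^ 2
        + 2 * Real.sin θ * Real.cos θ * Complex.I := by
      have e1 : chi 2 θ = chi 1 θ * chi 1 θ := by rw [chi_mul]; rfl
      have e2 : chi 1 θ = Real.cos θ + Real.sin θ * Complex.I := by
        rw [chi, Complex.ofReal_cos, Complex.ofReal_sin, ← Complex.exp_mul_I]
        congr 1; push_cast; ring
      rw [e1, e2]
      linear_combination (Real.sin θ : ℂ) ^ 2 * Complex.I_sq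
    have et : (Real.sin θ : ℂ) ^ 2 + (Real.cos θ : ℂ) ^ 2 = 1 := by
      exact_mod_cast Real.sin_sq_add_cos_sq θ
    rw [hX, ← mul_assoc, e, e4, ec, lower]
    linear_combination (((Real.sin θ : ℂ) ^ 2 + (Real.cos θ : ℂ) ^ 2 + 1) * (derivX F x / 2
      - Complex.I / 4 * (derivU F x + derivV F x))) * et
      + (-(2 * Real.sin θ * Real.cos θ : ℂ) ^ 2 / 2 * derivX F x
        - ((Real.cos θ ^ 2 - Real.sin θ ^ 2) * (2 * Real.sin θ * Real.cos θ) / 2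
          + Complex.I * (2 * Real.sin θ * Real.cos θ) ^ 2 / 4)
          * (derivU F x + derivV F x)) * Complex.I_sq
  simp only [kPart, hI]
  rw [intervalIntegral.integral_add ((continuous_chi 4).mul_const _ |>.intervalIntegrable _ _)
    intervalIntegrable_const, intervalIntegral.integral_mul_const, integral_chi (by norm_num),
    intervalIntegral.integral_const, Complex.real_smul]
  push_cast
  ring

lemma kPart_of_isWeight (hw : IsWeight n F) {m : ℤ} (hm : m ≠ n) (x : HomSpace Γ) :
    kPart m F x = 0 := by
  simp only [kPart, hw _ _]
  have : ∀ θ, chi (-m) θ * (chi n θ * F x) = chi (n - m) θ * F x := fun θ => by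
    rw [← mul_assoc, chi_mul, add_comm, sub_eq_add_neg]
  simp only [this]
  rw [intervalIntegral.integral_mul_const, integral_chi (by omega), zero_mul]

end Weights


/-! ### Reduction of eigenfunctions to weight vectors in a closed space. -/

section ClosedSpaces

variable {f F g : HomSpace Γ → ℂ} {μ : ℝ} {n : ℤ} {Z : Submodule ℂ C(HomSpace Γ, ℂ)}

/-- The function `F` is continuous and lies in the space `Z`. -/
def Mem (Z : Submodule ℂ C(HomSpace Γ, ℂ)) (F : HomSpace Γ → ℂ) : Prop :=
  ∃ h : Continuous F, (⟨F, h⟩ : C(HomSpace Γ, ℂ)) ∈ Z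

lemma Mem.const_mul (h : Mem Z F) (c : ℂ) : Mem Z (fun x => c * F x) :=
  ⟨continuous_const.mul h.1, Z.smul_mem c h.2⟩

lemma Mem.add (h : Mem Z F) (h' : Mem Z g) : Mem Z (fun x => F x + g x) :=
  ⟨h.1.add h'.1, Z.add_mem h.2 h'.2⟩

lemma mem_of_uniform_limit [CompactSpace (HomSpace Γ)] (hZ : IsClosed (Z : Set C(HomSpace Γ, ℂ)))
    (hF : Continuous F) (h : ∀ ε > 0, ∃ g, Mem Z g ∧ ∀ x, ‖F x - g x‖ ≤ ε) : Mem Z F := by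
  refine ⟨hF, hZ.closure_subset (Metric.mem_closure_iff.2 fun ε hε => ?_)⟩
  obtain ⟨g, hg, hd⟩ := h (ε / 2) (half_pos hε)
  refine ⟨⟨g, hg.1⟩, hg.2, lt_of_le_of_lt ?_ (half_lt_self hε)⟩
  exact (ContinuousMap.dist_le (half_pos hε).le).2 fun x => by
    rw [dist_eq_norm]; exact hd x

lemma norm_geo_sub_le (hF : IsCn 2 F) {C : ℝ} (hC : ∀ x, ‖derivX (derivX F) x‖ ≤ C)
    (x : HomSpace Γ) {t : ℝ} (ht : 0 ≤ t) : ‖F (geo t x) - F x - t * derivX F x‖ ≤ C * t * t := by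
  have h1 : ∀ s ∈ Icc 0 t, ‖derivX F (geo s x) - derivX F x‖ ≤ C * t := fun s hs => by
    have := norm_image_sub_le_of_norm_deriv_le_segment' (a := 0) (b := t)
      (fun s _ => (hasDerivAt_geo hF.derivX' x s).hasDerivWithinAt) (fun s _ => hC _) s hs
    rw [geo_zero, sub_zero] at this
    exact this.trans (mul_le_mul_of_nonneg_left hs.2 ((norm_nonneg _).trans (hC x)))
  have hd : ∀ s ∈ Icc 0 t, HasDerivWithinAt (fun s : ℝ => F (geo s x) - s * derivX F x)
      (derivX F (geo s x) - derivX F x) (Icc 0 t) s := fun s _ => by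
    have h2 := ((hasDerivAt_id s).ofReal_comp).mul_const (derivX F x)
    exact (((hasDerivAt_geo hF.one x s).sub h2).congr_deriv (by simp)).hasDerivWithinAt
  have := norm_image_sub_le_of_norm_deriv_le_segment' hd
    (fun s hs => h1 s (Ico_subset_Icc_self hs)) t (right_mem_Icc.2 ht)
  rw [geo_zero, sub_zero] at this
  refine le_of_eq_of_le ?_ this
  congr 1
  push_cast
  ring

/-- For `C^2` F, lower F is only known to be `C^1`, so it is not available as an eigenfunction of
weight n - 2. It is instead a uniform limit of such eigenfunctions: project F translated by `φ^X_t`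
to weight n - 2 and divide by πt. -/
lemma mem_lower [CompactSpace (HomSpace Γ)] (hZ : IsClosed (Z : Set C(HomSpace Γ, ℂ)))
    (hF : IsEigen μ F) (hw : IsWeight n F)
    (h : ∀ g, IsEigen μ g → IsWeight (n - 2) g → Mem Z g) : Mem Z (lower F) := by
  have hc := hF.isCn
  obtain ⟨C, hC0, hC⟩ := exists_norm_le (continuous_derivX hc.derivX')
  refine mem_of_uniform_limit hZ hc.lower.continuous fun ε hε => ?_
  -- The second order Taylor remainder contributes 2πCt², so after division by πt the error is 2Ct,
  -- which this choice keeps below ε.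
  set t := ε / (2 * (C + 1)) with ht
  have ht0 : 0 < t := by positivity
  have hpi := Real.pi_pos
  have he : IsEigen μ (fun x => F (geo t x)) := hF.rightMul (expX t)
  refine ⟨_, (h _ (isEigen_kPart he (n - 2)) (isWeight_kPart _ _)).const_mul
    ((1 / (Real.pi * t) : ℝ) : ℂ), fun x => ?_⟩
  have hrot : Continuous fun θ => rightMul (rot θ) x := continuous_rightMul_of continuous_rot
    continuous_const
  have hg : Continuous fun y : HomSpace Γ => geo t y := continuous_geo_of continuous_const
    continuous_id
  have hχ := continuous_chi (-(n - 2))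
  have e1 : kPart (n - 2) (fun x => F (geo t x)) x = ∫ θ in (0 : ℝ)..2 * Real.pi,
      (chi (-(n - 2)) θ * (F (geo t (rightMul (rot θ) x)) - F (rightMul (rot θ) x)
        - t * derivX F (rightMul (rot θ) x)) + (chi (-(n - 2)) θ * F (rightMul (rot θ) x)
        + t * (chi (-(n - 2)) θ * derivX F (rightMul (rot θ) x)))) :=
    intervalIntegral.integral_congr fun θ _ => by ring
  have cF : Continuous fun θ => F (rightMul (rot θ) x) := hc.continuous.comp hrot
  have cFt : Continuous fun θ => F (geo t (rightMul (rot θ) x)) := hc.continuous.comp (hg.comp hrot)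
  have cX : Continuous fun θ => derivX F (rightMul (rot θ) x) := hc.derivX'.continuous.comp hrot
  have c1 : Continuous fun θ => chi (-(n - 2)) θ * (F (geo t (rightMul (rot θ) x))
      - F (rightMul (rot θ) x) - t * derivX F (rightMul (rot θ) x)) :=
    hχ.mul ((cFt.sub cF).sub (continuous_const.mul cX))
  have c2 : Continuous fun θ => chi (-(n - 2)) θ * F (rightMul (rot θ) x) := hχ.mul cF
  have c3 : Continuous fun θ => (t : ℂ) * (chi (-(n - 2)) θ * derivX F (rightMul (rot θ) x)) :=
    continuous_const.mul (hχ.mul cX)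
  have c4 : Continuous fun θ => chi (-(n - 2)) θ * F (rightMul (rot θ) x)
      + t * (chi (-(n - 2)) θ * derivX F (rightMul (rot θ) x)) := c2.add c3
  rw [intervalIntegral.integral_add (c1.intervalIntegrable _ _) (c4.intervalIntegrable _ _),
    intervalIntegral.integral_add (c2.intervalIntegrable _ _) (c3.intervalIntegrable _ _),
    intervalIntegral.integral_const_mul] at e1
  -- The zeroth order term F has weight n and projects to zero, so only the first order term
  -- survives besides the remainder.
  have e2 := kPart_of_isWeight hw (show n - 2 ≠ n by omega) x
  have e3 := kPart_derivX hc.one hw x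
  rw [kPart] at e2 e3
  rw [e2, e3, zero_add] at e1
  have e4 := intervalIntegral.norm_integral_le_of_norm_le_const (a := 0) (b := 2 * Real.pi)
    (f := fun θ => chi (-(n - 2)) θ * (F (geo t (rightMul (rot θ) x)) - F (rightMul (rot θ) x)
        - t * derivX F (rightMul (rot θ) x))) (C := C * t * t) fun θ _ => by
      rw [norm_mul, norm_chi, one_mul]
      exact norm_geo_sub_le hc hC _ ht0.le
  rw [e1]
  set J := ∫ θ in (0 : ℝ)..2 * Real.pi, chi (-(n - 2)) θ *
    (F (geo t (rightMul (rot θ) x)) - F (rightMul (rot θ) x) - t * derivX F (rightMul (rot θ) x))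
  have e5 : lower F x - ((1 / (Real.pi * t) : ℝ) : ℂ) * (J + t * (Real.pi * lower F x))
      = -(((1 / (Real.pi * t) : ℝ) : ℂ) * J) := by
    have : (Real.pi : ℂ) ≠ 0 := by exact_mod_cast hpi.ne'
    have : (t : ℂ) ≠ 0 := by exact_mod_cast ht0.ne'
    push_cast
    field_simp
    ring
  rw [e5, norm_neg, norm_mul, Complex.norm_real, Real.norm_of_nonneg (by positivity)]
  rw [sub_zero, abs_of_pos (by positivity)] at e4
  calc 1 / (Real.pi * t) * ‖J‖ ≤ 1 / (Real.pi * t) * (C * t * t * (2 * Real.pi)) := by gcongr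
    _ = C * (2 * t) := by field_simp
    _ = ε * (C / (C + 1)) := by rw [ht]; field_simp
    _ ≤ ε * 1 := by
      gcongr
      rw [div_le_one (by positivity)]
      linarith
    _ = ε := mul_one ε

/-- Strong induction in steps of 2: weight n - 2 gives membership of lower F by `mem_lower`, and
`hs` recovers F from it. -/
lemma mem_of_weight_natCast [CompactSpace (HomSpace Γ)]
    (hZ : IsClosed (Z : Set C(HomSpace Γ, ℂ)))
    (h0 : ∀ n : ℕ, n ≤ 2 → ∀ F, IsEigen μ F → IsWeight n F → Mem Z F)
    (hs : ∀ n : ℕ, 3 ≤ n → ∀ F, IsEigen μ F → IsWeight n F → Mem Z (lower F) → Mem Z F)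
    (n : ℕ) : ∀ F, IsEigen μ F → IsWeight n F → Mem Z F := by
  induction n using Nat.strong_induction_on with
  | _ n ih =>
    intro F hF hw
    rcases le_or_gt n 2 with hn | hn
    · exact h0 n hn F hF hw
    · refine hs n hn F hF hw (mem_lower hZ hF hw fun g hg hgw => ih (n - 2) (by omega) g hg ?_)
      have : ((n - 2 : ℕ) : ℤ) = (n : ℤ) - 2 := by omega
      rwa [this]

lemma IsWeight.conj (hw : IsWeight n F) : IsWeight (-n) (fun x => (starRingEnd ℂ) (F x)) :=
  fun θ x => by simp only [hw θ x, map_mul, conj_chi]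

lemma mem_of_weight [CompactSpace (HomSpace Γ)] (hZ : IsClosed (Z : Set C(HomSpace Γ, ℂ)))
    (hconj : ∀ F, Mem Z F → Mem Z (fun x => (starRingEnd ℂ) (F x)))
    (h0 : ∀ n : ℕ, n ≤ 2 → ∀ F, IsEigen μ F → IsWeight n F → Mem Z F)
    (hs : ∀ n : ℕ, 3 ≤ n → ∀ F, IsEigen μ F → IsWeight n F → Mem Z (lower F) → Mem Z F)
    (hF : IsEigen μ F) (hw : IsWeight n F) : Mem Z F := by
  rcases Int.eq_nat_or_neg n with ⟨m, rfl | rfl⟩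
  · exact mem_of_weight_natCast hZ h0 hs m F hF hw
  · have h := mem_of_weight_natCast hZ h0 hs m _ hF.conj (by simpa using hw.conj)
    simpa using hconj _ h

/-- Otherwise Hahn–Banach gives a functional L killing Z but not f. The function sending θ to L of
the rotated f is continuous and periodic, and its Fourier integrals are the values of L at `kPart n
f`, all zero; so it vanishes at θ = 0, a contradiction. -/
lemma mem_of_kPart [CompactSpace (HomSpace Γ)] (hZ : IsClosed (Z : Set C(HomSpace Γ, ℂ)))
    (hf : Continuous f) (h : ∀ n, Mem Z (kPart n f)) : Mem Z f := by
  refine ⟨hf, ?_⟩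
  have : IsClosed (Z : Set C(HomSpace Γ, ℂ)) := hZ
  by_contra hfZ
  have hq : (Submodule.Quotient.mk ⟨f, hf⟩ : C(HomSpace Γ, ℂ) ⧸ Z) ≠ 0 := fun h =>
    hfZ ((Submodule.Quotient.mk_eq_zero Z).1 h)
  obtain ⟨ℓ, hℓ⟩ := SeparatingDual.exists_ne_zero (R := ℂ) hq
  let L : C(HomSpace Γ, ℂ) →L[ℂ] ℂ := ℓ.comp Z.mkQL
  have hL : ∀ g ∈ Z, L g = 0 := fun g hg => by
    have : Z.mkQL g = 0 := (Submodule.Quotient.mk_eq_zero Z).2 hg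
    change ℓ (Z.mkQL g) = 0
    rw [this, map_zero]
  have hT : Continuous fun p : ℝ × HomSpace Γ => f (rightMul (rot p.1) p.2) :=
    hf.comp (continuous_rightMul_of (continuous_rot.comp continuous_fst) continuous_snd)
  let T : C(ℝ, C(HomSpace Γ, ℂ)) := ContinuousMap.curry ⟨_, hT⟩
  have hTx : ∀ θ x, T θ x = f (rightMul (rot θ) x) := fun θ x => rfl
  have key := eq_zero_of_fourier (c := fun θ => L (T θ)) (L.continuous.comp T.continuous)
    (fun θ => congrArg L (ContinuousMap.ext fun x => by rw [hTx, hTx, rot_periodic θ]))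
    (fun n => ?_) 0
  · refine hℓ ?_
    have h1 : T 0 = ⟨f, hf⟩ := ContinuousMap.ext fun x => by
      rw [hTx, rot_zero, rightMul_one]; rfl
    simp only [h1] at key
    exact key
  · have hci : Continuous fun θ => chi (-n) θ • T θ := (continuous_chi (-n)).smul T.continuous
    have h1 : ∫ θ in (0 : ℝ)..2 * Real.pi, chi (-n) θ • T θ ∈ Z := by
      obtain ⟨hk, hkZ⟩ := h n
      convert hkZ
      ext x
      have := (ContinuousMap.evalCLM ℂ x : C(HomSpace Γ, ℂ) →L[ℂ] ℂ).intervalIntegral_comp_comm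
        (hci.intervalIntegrable (μ := volume) 0 (2 * Real.pi))
      exact this.symm
    have h2 := L.intervalIntegral_comp_comm
        (hci.intervalIntegrable (μ := volume) 0 (2 * Real.pi))
    rw [hL _ h1] at h2
    simpa using h2

/-- A closed space of continuous functions, invariant under conjugation, contains all
eigenfunctions as soon as it contains those of weights `0`, `1`, `2` and inverts the lowering
operator on the other positive weights. -/
lemma mem_of_isEigen [CompactSpace (HomSpace Γ)] (hZ : IsClosed (Z : Set C(HomSpace Γ, ℂ)))
    (hconj : ∀ F, Mem Z F → Mem Z (fun x => (starRingEnd ℂ) (F x)))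
    (h0 : ∀ n : ℕ, n ≤ 2 → ∀ F, IsEigen μ F → IsWeight n F → Mem Z F)
    (hs : ∀ n : ℕ, 3 ≤ n → ∀ F, IsEigen μ F → IsWeight n F → Mem Z (lower F) → Mem Z F)
    (hf : IsEigen μ f) : Mem Z f :=
  mem_of_kPart hZ hf.isCn.continuous fun n =>
    mem_of_weight hZ hconj h0 hs (isEigen_kPart hf n) (isWeight_kPart n f)

/-- For `-3/4 < μ < 0` there are no eigenfunctions. -/
lemma eq_zero_of_isEigen [DiscreteTopology Γ] [CompactSpace (HomSpace Γ)] (hμ : -(3 / 4) < μ)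
    (hμ0 : μ < 0) (hf : IsEigen μ f) (x : HomSpace Γ) : f x = 0 := by
  have hb : ∀ {F : HomSpace Γ → ℂ}, Mem (⊥ : Submodule ℂ C(HomSpace Γ, ℂ)) F ↔ ∀ x, F x = 0 :=
    fun {F} => ⟨fun h x => DFunLike.congr_fun ((Submodule.mem_bot ℂ).1 h.2) x, fun h => by
      have : F = fun _ => 0 := funext h
      subst this
      exact ⟨continuous_const, (Submodule.mem_bot ℂ).2 rfl⟩⟩
  -- The closed space is zero. For n = 0, 1, 2 the energy factor is μ, μ - 1/4, μ, all negative; for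
  -- n ≥ 3 it is at least μ + 3/4 > 0, so F vanishes together with lower F.
  refine hb.1 (mem_of_isEigen (μ := μ) (by simp) (fun F hF => ?_) (fun n hn F hF hw => ?_)
    (fun n hn F hF hw hl => ?_) hf) x
  · exact hb.2 fun x => by rw [hb.1 hF, map_zero]
  · refine hb.2 (eq_zero_of_neg hF hw ?_)
    interval_cases n <;> norm_num <;> linarith
  · refine hb.2 (eq_zero_of_lower hF hw ?_ (hb.1 hl))
    have : (3 : ℝ) ≤ n := by exact_mod_cast hn
    have : 0 < μ + ((n : ℤ) : ℝ) ^ 2 / 4 - ((n : ℤ) : ℝ) / 2 := by push_cast; nlinarith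
    exact this.ne'

end ClosedSpaces


/-! ### Negative eigenvalues: transfer functions for the horocycle flow. -/

section Coboundary

/-- The exponentially weighted integral of `h` along half a geodesic orbit. -/
noncomputable def geoTransform (c σ : ℝ) (h : HomSpace Γ → ℂ) (x : HomSpace Γ) : ℂ :=
  ∫ ξ in Ioi (0 : ℝ), Real.exp (-(c * ξ)) • h (geo (σ * ξ) x)

variable {f h : HomSpace Γ → ℂ} {a b c σ μ : ℝ}

lemma norm_horoAverage_le_of_coboundary {u : HomSpace Γ → ℂ} (hf : Continuous f)
    (hd : ∀ x, HasDerivAt (fun t => u (horo t x)) (f x) 0) {C : ℝ} (hC : ∀ x, ‖u x‖ ≤ C)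
    (x : HomSpace Γ) {T : ℝ} (hT : 0 < T) : ‖horoAverage f x T‖ ≤ 2 * C / T := by
  have hd' : ∀ t, HasDerivAt (fun t => u (horo t x)) (f (horo t x)) t := fun t => by
    have h := hd (horo t x)
    have h2 := HasDerivAt.comp_sub_const t t (by rwa [sub_self] : HasDerivAt _ _ (t - t))
    refine h2.congr_of_eventuallyEq (Eventually.of_forall fun s => ?_)
    simp only [horo_horo]
    rw [add_sub_cancel]
  have hc : Continuous fun t => f (horo t x) :=
    hf.comp (continuous_horo_of continuous_id continuous_const)
  rw [horoAverage, intervalIntegral.integral_eq_sub_of_hasDerivAt (fun t _ => hd' t)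
    (hc.intervalIntegrable _ _), norm_smul, Real.norm_of_nonneg (by positivity), mul_comm,
    mul_one_div]
  gcongr
  exact (norm_sub_le _ _).trans ((add_le_add (hC _) (hC _)).trans_eq (two_mul C).symm)

variable [CompactSpace (HomSpace Γ)]

lemma continuous_geo_mul (hh : Continuous h) (σ : ℝ) (x : HomSpace Γ) :
    Continuous fun ξ : ℝ => h (geo (σ * ξ) x) :=
  hh.comp (continuous_geo_of (continuous_const.mul continuous_id) continuous_const)

lemma integrableOn_exp_smul_geo (hc : 0 < c) (hh : Continuous h) (σ : ℝ) (x : HomSpace Γ) :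
    IntegrableOn (fun ξ : ℝ => Real.exp (-(c * ξ)) • h (geo (σ * ξ) x)) (Ioi 0) := by
  obtain ⟨C, -, hC⟩ := exists_norm_le hh
  exact Integrable.smul_bdd (integrableOn_exp_neg_mul hc) C
    (continuous_geo_mul hh σ x).aestronglyMeasurable (Eventually.of_forall fun _ => hC _)

lemma norm_geoTransform_le (hc : 0 < c) {C : ℝ} (hC : ∀ x, ‖h x‖ ≤ C) (σ : ℝ) (x : HomSpace Γ) :
    ‖geoTransform c σ h x‖ ≤ C / c := by
  have := norm_integral_le_of_norm_le (f := fun ξ : ℝ => Real.exp (-(c * ξ)) • h (geo (σ * ξ) x))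
    ((integrableOn_exp_neg_mul hc).const_mul C) (Eventually.of_forall fun ξ => by
      rw [norm_smul, Real.norm_of_nonneg (Real.exp_pos _).le, mul_comm C]
      exact mul_le_mul_of_nonneg_left (hC _) (Real.exp_pos _).le)
  rw [integral_const_mul, integral_exp_neg_mul hc, mul_one_div] at this
  exact this

lemma continuous_geoTransform (hc : 0 < c) (hh : Continuous h) (σ : ℝ) :
    Continuous (geoTransform c σ h) := by
  obtain ⟨C, -, hC⟩ := exists_norm_le hh
  refine isOpenQuotientMap_proj.isQuotientMap.continuous_iff.2 ?_
  refine continuous_of_dominated (bound := fun ξ => Real.exp (-(c * ξ)) * C)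
    (fun g => (integrableOn_exp_smul_geo hc hh σ _).aestronglyMeasurable)
    (fun g => Eventually.of_forall fun ξ => ?_) ((integrableOn_exp_neg_mul hc).mul_const C)
    (Eventually.of_forall fun ξ => ?_)
  · rw [norm_smul, Real.norm_of_nonneg (Real.exp_pos _).le]
    exact mul_le_mul_of_nonneg_left (hC _) (Real.exp_pos _).le
  · have hg : Continuous fun g => h (geo (σ * ξ) (proj Γ g)) :=
      hh.comp (continuous_geo_of continuous_const continuous_proj)
    exact hg.const_smul (Real.exp (-(c * ξ)))

/-- Moving by `φ^X_{σξ}` rescales horocycle time by e^{-σξ}, so differentiation along U changes the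
exponential weight from a to a + σ. -/
lemma hasDerivAt_geoTransform (hh : IsCn 1 h) (ha : 0 < a) (hb : 0 < b) (hab : a + σ = b)
    (x : HomSpace Γ) :
    HasDerivAt (fun t => geoTransform a σ h (horo t x)) (geoTransform b σ (derivU h) x) 0 := by
  obtain ⟨C, -, hC⟩ := exists_norm_le (continuous_derivU hh)
  have hd : ∀ ξ t, HasDerivAt (fun t => Real.exp (-(a * ξ)) • h (geo (σ * ξ) (horo t x)))
      (Real.exp (-(b * ξ)) • derivU h (geo (σ * ξ) (horo t x))) t := fun ξ t => by
    have e : ∀ t, geo (σ * ξ) (horo t x) = horo (Real.exp (-(σ * ξ)) * t) (geo (σ * ξ) x) :=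
      fun t => by
        rw [horo_geo, ← mul_assoc, ← Real.exp_add, add_neg_cancel, Real.exp_zero, one_mul]
    simp only [e]
    have := ((hasDerivAt_horo hh (geo (σ * ξ) x) (Real.exp (-(σ * ξ)) * t)).scomp t
      ((hasDerivAt_id t).const_mul (Real.exp (-(σ * ξ))))).const_smul (Real.exp (-(a * ξ)))
    refine this.congr_deriv ?_
    rw [mul_one, smul_smul, ← Real.exp_add, ← hab]
    congr 2
    ring
  have := (hasDerivAt_integral_of_dominated_loc_of_deriv_le (x₀ := (0 : ℝ)) (s := univ)
    (μ := volume.restrict (Ioi (0 : ℝ)))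
    (F := fun t ξ => Real.exp (-(a * ξ)) • h (geo (σ * ξ) (horo t x)))
    (F' := fun t ξ => Real.exp (-(b * ξ)) • derivU h (geo (σ * ξ) (horo t x)))
    (bound := fun ξ => Real.exp (-(b * ξ)) * C) univ_mem
    (Eventually.of_forall fun t =>
      (integrableOn_exp_smul_geo ha hh.continuous σ _).aestronglyMeasurable)
    (integrableOn_exp_smul_geo ha hh.continuous σ _)
    (integrableOn_exp_smul_geo hb (continuous_derivU hh) σ _).aestronglyMeasurable
    (Eventually.of_forall fun ξ t _ => by
      rw [norm_smul, Real.norm_of_nonneg (Real.exp_pos _).le]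
      exact mul_le_mul_of_nonneg_left (hC _) (Real.exp_pos _).le)
    ((integrableOn_exp_neg_mul hb).mul_const C)
    (Eventually.of_forall fun ξ t _ => hd ξ t)).2
  simp only [horo_zero] at this
  exact this

/-- The eigenvalue equation factors as UVf = -(X - σb)(X + σc)f, with σ = ±1. Along the orbit the
first factor, weighted by e^{-bξ}, is an exact derivative in ξ, so only the boundary value at ξ = 0
remains. -/
lemma geoTransform_derivU_derivV (hf : IsEigen μ f) (hσ : σ * σ = 1) (hb : 0 < b)
    (hbc : b - c = σ) (hμ : μ = -(b * c)) (x : HomSpace Γ) :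
    geoTransform b σ (derivU (derivV f)) x = σ * derivX f x + c * f x := by
  have hn := hf.isCn
  have e : ∀ x, derivU (derivV f) x = -derivX (derivX f) x + derivX f x - μ * f x := fun x => by
    rw [← hf.eig x, casimir]; ring
  set k : HomSpace Γ → ℂ := fun x => σ * derivX f x + c * f x with hk
  have kc : Continuous k :=
    (continuous_const.mul hn.derivX'.continuous).add (continuous_const.mul hn.continuous)
  have hgeo : ∀ {g : HomSpace Γ → ℂ}, IsCn 1 g → ∀ ξ,
      HasDerivAt (fun ξ : ℝ => g (geo (σ * ξ) x)) (σ * derivX g (geo (σ * ξ) x)) ξ :=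
    fun {g} hg ξ => by
      have := (hasDerivAt_geo hg x (σ * ξ)).scomp ξ ((hasDerivAt_id ξ).const_mul σ)
      exact this.congr_deriv (by rw [mul_one, Complex.real_smul])
  have hd : ∀ ξ ∈ Ici (0 : ℝ), HasDerivAt (fun ξ : ℝ => -(Real.exp (-(b * ξ)) • k (geo (σ * ξ) x)))
      (Real.exp (-(b * ξ)) • derivU (derivV f) (geo (σ * ξ) x)) ξ := fun ξ _ => by
    have h1 : HasDerivAt (fun ξ : ℝ => Real.exp (-(b * ξ))) (Real.exp (-(b * ξ)) * -(b * 1)) ξ :=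
      ((hasDerivAt_id ξ).const_mul b).neg.exp
    have h2 := (h1.smul (((hgeo hn.derivX' ξ).const_mul (σ : ℂ)).add
      ((hgeo hn.one ξ).const_mul (c : ℂ)))).neg
    refine h2.congr_deriv ?_
    have hσ' : (σ : ℂ) * σ = 1 := by exact_mod_cast hσ
    have hbc' : (b : ℂ) - c = σ := by exact_mod_cast hbc
    rw [e, hμ]
    simp only [Complex.real_smul, Pi.add_apply]
    push_cast
    generalize derivX (derivX f) (geo (σ * ξ) x) = A
    generalize derivX f (geo (σ * ξ) x) = B
    generalize Complex.exp (-(b * ξ)) = E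
    linear_combination (-(E * A) + E * B) * hσ' + E * B * σ * hbc'
  have hi := integrableOn_exp_smul_geo hb (continuous_derivU hn.derivV') σ x
  have ht : Tendsto (fun ξ : ℝ => -(Real.exp (-(b * ξ)) • k (geo (σ * ξ) x))) atTop (𝓝 0) := by
    obtain ⟨C, -, hC⟩ := exists_norm_le kc
    have h0 : Tendsto (fun ξ : ℝ => Real.exp (-(b * ξ)) * C) atTop (𝓝 0) := by
      have := (Real.tendsto_exp_neg_atTop_nhds_zero.comp
        (tendsto_id.const_mul_atTop hb)).mul_const C
      rw [zero_mul] at this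
      exact this
    refine squeeze_zero_norm (fun ξ => ?_) h0
    rw [norm_neg, norm_smul, Real.norm_of_nonneg (Real.exp_pos _).le]
    exact mul_le_mul_of_nonneg_left (hC _) (Real.exp_pos _).le
  rw [geoTransform, integral_Ioi_of_hasDerivAt_of_tendsto' hd hi ht]
  simp [hk]

/-- For `μ < 0` the eigenfunctions are coboundaries for the horocycle flow. -/
lemma exists_coboundary (hf : IsEigen μ f) (hμ : μ < 0) :
    ∃ u : HomSpace Γ → ℂ, Continuous u ∧ (∀ x, ‖u x‖ ≤ c2Norm f / -μ) ∧
      ∀ x, HasDerivAt (fun t => u (horo t x)) (f x) 0 := by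
  have hn := hf.isCn
  -- The positive root of a(a + 1) = -μ.
  set a := (Real.sqrt (1 - 4 * μ) - 1) / 2 with ha
  have hsq := Real.sq_sqrt (show 0 ≤ 1 - 4 * μ by linarith)
  have ha0 : 0 < a := by
    have : 1 < Real.sqrt (1 - 4 * μ) := Real.lt_sqrt_of_sq_lt (by linarith)
    linarith
  have hμa : μ = -(a * (a + 1)) := by rw [ha]; nlinarith
  have hc := hn.derivV'.continuous
  refine ⟨fun x => ((1 / (2 * a + 1) : ℝ) : ℂ) * (geoTransform a 1 (derivV f) x
    + geoTransform (a + 1) (-1) (derivV f) x), continuous_const.mul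
    ((continuous_geoTransform ha0 hc 1).add (continuous_geoTransform (by linarith) hc (-1))),
    fun x => ?_, fun x => ?_⟩
  · have h1 := norm_geoTransform_le ha0 (norm_derivV_le hn) 1 x
    have h2 := norm_geoTransform_le (show 0 < a + 1 by linarith) (norm_derivV_le hn) (-1) x
    rw [norm_mul, Complex.norm_real, Real.norm_of_nonneg (by positivity)]
    calc _ ≤ 1 / (2 * a + 1) * (c2Norm f / a + c2Norm f / (a + 1)) := by
          gcongr
          exact (norm_add_le _ _).trans (add_le_add h1 h2)
      _ = c2Norm f / -μ := by
          rw [hμa, neg_neg]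
          field_simp
          ring
  · have h1 := hasDerivAt_geoTransform (σ := 1) hn.derivV' ha0 (show 0 < a + 1 by linarith) rfl x
    have h2 := hasDerivAt_geoTransform (σ := -1) hn.derivV' (show 0 < a + 1 by linarith) ha0
      (by ring) x
    -- The forward transform contributes Xf + af and the backward one -Xf + (a + 1)f; the Xf terms
    -- cancel and (2a + 1)f is left.
    rw [geoTransform_derivU_derivV (c := a) hf (by norm_num) (by linarith) (by ring)
      (by rw [hμa]; ring)] at h1
    rw [geoTransform_derivU_derivV (c := a + 1) hf (by norm_num) ha0 (by ring) hμa] at h2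
    refine ((h1.add h2).const_mul _).congr_deriv ?_
    have : (2 * (a : ℂ) + 1) ≠ 0 := by
      have : (2 * a + 1) ≠ 0 := by positivity
      exact_mod_cast this
    push_cast
    field_simp
    ring

/-- The coboundary bound 2/(|μ|T) degenerates as μ tends to 0. The absence of eigenfunctions for
-3/4 < μ < 0 leaves |μ| ≥ 3/4, where 2/|μ| ≤ 8/3. -/
lemma norm_horoAverage_le_of_neg [DiscreteTopology Γ] (hf : IsEigen μ f) (hμ : μ < 0)
    (x : HomSpace Γ) {T : ℝ} (hT : 0 < T) : ‖horoAverage f x T‖ ≤ 5 / T * c2Norm f := by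
  have hN := c2Norm_nonneg hf.isCn
  rcases lt_or_ge (-(3 / 4)) μ with h | h
  · have h0 : f = fun _ => 0 := funext (eq_zero_of_isEigen h hμ hf)
    have : horoAverage f x T = 0 := by simp [h0, horoAverage]
    rw [this, norm_zero]
    positivity
  · obtain ⟨u, -, hu, hd⟩ := exists_coboundary hf hμ
    refine (norm_horoAverage_le_of_coboundary hf.isCn.continuous hd hu x hT).trans ?_
    rw [div_mul_eq_mul_div]
    refine div_le_div_of_nonneg_right ?_ hT.le
    rw [← mul_div_assoc, div_le_iff₀ (by linarith)]
    nlinarith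

end Coboundary


/-! ### The differential equation for the eigenvalue zero. -/

section Harmonic

variable {f F : HomSpace Γ → ℂ} [CompactSpace (HomSpace Γ)]

lemma norm_integral_gFun_le (hF : IsCn 2 F) (y : HomSpace Γ) {ξ : ℝ} (hξ : 0 ≤ ξ) :
    ‖∫ η in (0 : ℝ)..ξ, gFun F y η‖ ≤ 2 * c2Norm F * ξ := by
  have := intervalIntegral.norm_integral_le_of_norm_le_const (a := 0) (b := ξ)
    (f := gFun F y) fun η _ => norm_gFun_le hF y η
  rwa [sub_zero, abs_of_nonneg hξ] at this

lemma arcAvg_derivX (hF : IsEigen 0 F) (y : HomSpace Γ) (ξ : ℝ) :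
    Real.exp ξ * arcAvg (derivX F) y ξ
      = unitInt (derivX F) y - ∫ η in (0 : ℝ)..ξ, gFun F y η := by
  have hn := hF.isCn
  have hd : ∀ ξ : ℝ, HasDerivAt (fun ξ : ℝ => (Real.exp ξ : ℂ) * arcAvg (derivX F) y ξ)
      (-gFun F y ξ) ξ := fun ξ => by
    have h1 := (Real.hasDerivAt_exp ξ).ofReal_comp.mul (hasDerivAt_arcAvg hn.derivX' y ξ)
    rw [arcAvg_derivX_derivX hn hF.eig] at h1
    refine h1.congr_deriv ?_
    have : (Real.exp ξ : ℂ) * Real.exp (-ξ) = 1 := by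
      rw [← Complex.ofReal_mul, ← Real.exp_add, add_neg_cancel, Real.exp_zero, Complex.ofReal_one]
    rw [Complex.ofReal_zero]
    linear_combination (-gFun F y ξ) * this
  have h := intervalIntegral.integral_eq_sub_of_hasDerivAt (a := 0) (b := ξ) (fun ξ _ => hd ξ)
    ((continuous_gFun_right hn y).neg.intervalIntegrable _ _)
  rw [intervalIntegral.integral_neg, Real.exp_zero, Complex.ofReal_one, one_mul, arcAvg_zero] at h
  linear_combination -h

/-- The fundamental solution is 1 - e^{-t}; its constant part produces terms without decay, and its
exponential part cancels the weight e^{-η} in the last integral. -/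
lemma arcAvg_harmonic (hf : IsEigen 0 f) (y : HomSpace Γ) (ξ : ℝ) :
    arcAvg f y ξ = unitInt f y - unitInt (derivX f) y + Real.exp (-ξ) * unitInt (derivX f) y
      + (∫ η in (0 : ℝ)..ξ, Real.exp (-η) • gFun f y η)
      - Real.exp (-ξ) * ∫ η in (0 : ℝ)..ξ, gFun f y η := by
  have hn := hf.isCn
  have hE : ∀ t : ℝ, HasDerivAt (fun t => Real.exp (-t)) (-Real.exp (-t)) t := fun t =>
    ((hasDerivAt_id t).neg.exp).congr_deriv (by simp)
  have h := arcAvg_eq (μ := 0) hn hf.eig (S := fun t => 1 - Real.exp (-t))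
    (S' := fun t => Real.exp (-t)) (fun t => ((hE t).const_sub 1).congr_deriv (by ring))
    (fun t => (hE t).congr_deriv (by ring)) (by simp) (by simp) y ξ
  have hG := continuous_gFun_right hn y
  have h1 : ∫ η in (0 : ℝ)..ξ, ((1 - Real.exp (-(ξ - η))) * Real.exp (-η)) • gFun f y η
      = ∫ η in (0 : ℝ)..ξ, (Real.exp (-η) • gFun f y η - (Real.exp (-ξ) : ℂ) * gFun f y η) :=
    intervalIntegral.integral_congr fun η _ => by
      have : Real.exp (-(ξ - η)) * Real.exp (-η) = Real.exp (-ξ) := by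
        rw [← Real.exp_add]; congr 1; ring
      simp only [sub_mul, one_mul, this, sub_smul, Complex.real_smul]
  have c1 : Continuous fun η => Real.exp (-η) • gFun f y η :=
    (Real.continuous_exp.comp continuous_neg).smul hG
  have c2 : Continuous fun η => (Real.exp (-ξ) : ℂ) * gFun f y η := continuous_const.mul hG
  rw [h1, intervalIntegral.integral_sub (c1.intervalIntegrable _ _)
    (c2.intervalIntegrable _ _), intervalIntegral.integral_const_mul] at h
  rw [h]
  push_cast
  ring

end Harmonic

/-! ### Convergence of the averages of harmonic eigenfunctions. -/

section Equidistribution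

variable {f F : HomSpace Γ → ℂ}

lemma arcAvg_add {g : HomSpace Γ → ℂ} (hf : Continuous f) (hg : Continuous g) (y : HomSpace Γ)
    (ξ : ℝ) : arcAvg (fun x => f x + g x) y ξ = arcAvg f y ξ + arcAvg g y ξ :=
  intervalIntegral.integral_add ((continuous_arc_right hf y ξ).intervalIntegrable _ _)
    ((continuous_arc_right hg y ξ).intervalIntegrable _ _)

lemma arcAvg_const_mul (c : ℂ) (f : HomSpace Γ → ℂ) (y : HomSpace Γ) (ξ : ℝ) :
    arcAvg (fun x => c * f x) y ξ = c * arcAvg f y ξ :=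
  intervalIntegral.integral_const_mul _ _

lemma arcAvg_conj (f : HomSpace Γ → ℂ) (y : HomSpace Γ) (ξ : ℝ) :
    arcAvg (fun x => (starRingEnd ℂ) (f x)) y ξ = (starRingEnd ℂ) (arcAvg f y ξ) :=
  intervalIntegral.intervalIntegral_conj

lemma arcAvg_const (c : ℂ) (y : HomSpace Γ) (ξ : ℝ) : arcAvg (fun _ => c) y ξ = c := by
  simp [arcAvg]

lemma eq_const_of_derivU_derivV (hF : IsCn 1 F) (hU : ∀ x, derivU F x = 0)
    (hV : ∀ x, derivV F x = 0) (x : HomSpace Γ) : F x = F (proj Γ 1) := by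
  have h0 : ∀ {w : ℝ → ℂ}, (∀ t, HasDerivAt w 0 t) → ∀ t, w t = w 0 := fun hw t =>
    is_const_of_deriv_eq_zero (fun t => (hw t).differentiableAt) (fun t => (hw t).deriv) t 0
  obtain ⟨g, rfl⟩ := proj_surjective x
  have h := shear_induction (P := fun k => ∀ x : HomSpace Γ, F (rightMul k x) = F x)
    (fun s x => by
      have := h0 (fun t => (hasDerivAt_horo hF x t).congr_deriv (hU _)) s
      rw [horo_zero] at this
      exact this)
    (fun s x => by
      have := h0 (fun t => (hasDerivAt_horoUn hF x t).congr_deriv (hV _)) s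
      simp only [horoUn, expV_zero, rightMul_one] at this
      exact this)
    (fun k l hk hl x => by rw [← rightMul_rightMul, hl, hk]) g (proj Γ 1)
  rwa [rightMul_proj, one_mul] at h

variable [DiscreteTopology Γ] [CompactSpace (HomSpace Γ)]

lemma norm_integral_vol_le {C : ℝ} (hC : ∀ x, ‖f x‖ ≤ C) : ‖∫ x, f x ∂(vol Γ)‖ ≤ C := by
  have := norm_integral_le_of_norm_le_const (μ := vol Γ) (Eventually.of_forall hC)
  simpa using this

/-- The space of continuous functions whose averages along expanding horocycle arcs converge to
their mean. -/
noncomputable def equiSpace (Γ : Subgroup SL2R) [DiscreteTopology Γ]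
    [CompactSpace (HomSpace Γ)] : Submodule ℂ C(HomSpace Γ, ℂ) where
  carrier := {h | ∀ y, Tendsto (arcAvg h y) atTop (𝓝 (∫ x, h x ∂(vol Γ)))}
  add_mem' {f g} hf hg y := by
    have h1 : arcAvg (f + g : C(HomSpace Γ, ℂ)) y = fun ξ => arcAvg f y ξ + arcAvg g y ξ :=
      funext fun ξ => arcAvg_add f.continuous g.continuous y ξ
    have h2 : ∫ x, (f + g : C(HomSpace Γ, ℂ)) x ∂(vol Γ)
        = (∫ x, f x ∂(vol Γ)) + ∫ x, g x ∂(vol Γ) :=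
      integral_add (integrable_vol f.continuous) (integrable_vol g.continuous)
    rw [h1, h2]
    exact (hf y).add (hg y)
  zero_mem' y := by
    have h1 : arcAvg (0 : C(HomSpace Γ, ℂ)) y = fun _ => 0 := funext fun ξ => arcAvg_const 0 y ξ
    rw [h1]
    simp
  smul_mem' c f hf y := by
    have h1 : arcAvg (c • f : C(HomSpace Γ, ℂ)) y = fun ξ => c * arcAvg f y ξ :=
      funext fun ξ => arcAvg_const_mul c f y ξ
    have h2 : ∫ x, (c • f : C(HomSpace Γ, ℂ)) x ∂(vol Γ) = c * ∫ x, f x ∂(vol Γ) :=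
      integral_const_mul c _
    rw [h1, h2]
    exact (hf y).const_mul c

lemma mem_equiSpace : Mem (equiSpace Γ) F ↔
    Continuous F ∧ ∀ y, Tendsto (arcAvg F y) atTop (𝓝 (∫ x, F x ∂(vol Γ))) :=
  ⟨fun ⟨h, h'⟩ => ⟨h, h'⟩, fun ⟨h, h'⟩ => ⟨h, h'⟩⟩

/-- Arc averages and the mean are both contractions for the supremum norm, so the usual
three-epsilon argument applies. -/
lemma isClosed_equiSpace : IsClosed (equiSpace Γ : Set C(HomSpace Γ, ℂ)) := by
  refine isClosed_of_closure_subset fun f hf y => Metric.tendsto_atTop.2 fun ε hε => ?_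
  obtain ⟨g, hg, hd⟩ := Metric.mem_closure_iff.1 hf (ε / 3) (by positivity)
  obtain ⟨R, hR⟩ := Metric.tendsto_atTop.1 (hg y) (ε / 3) (by positivity)
  refine ⟨R, fun ξ hξ => ?_⟩
  have hC : ∀ x, ‖f x + (-1) * g x‖ ≤ dist f g := fun x => by
    have := ContinuousMap.dist_apply_le_dist (f := f) (g := g) x
    rw [dist_eq_norm] at this
    rwa [neg_one_mul, ← sub_eq_add_neg]
  have cg : Continuous fun x => (-1 : ℂ) * g x := continuous_const.mul g.continuous
  have h1 := norm_arcAvg_le hC y ξ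
  rw [arcAvg_add f.continuous cg, arcAvg_const_mul] at h1
  have h2 := norm_integral_vol_le hC
  rw [integral_add (integrable_vol f.continuous) (integrable_vol cg), integral_const_mul] at h2
  have h3 := hR ξ hξ
  rw [dist_eq_norm] at h3 ⊢
  calc ‖arcAvg f y ξ - ∫ x, f x ∂(vol Γ)‖
      = ‖(arcAvg f y ξ + -1 * arcAvg g y ξ) + (arcAvg g y ξ - ∫ x, g x ∂(vol Γ))
        - ((∫ x, f x ∂(vol Γ)) + -1 * ∫ x, g x ∂(vol Γ))‖ := by congr 1; ring
    _ ≤ (‖arcAvg f y ξ + -1 * arcAvg g y ξ‖ + ‖arcAvg g y ξ - ∫ x, g x ∂(vol Γ)‖)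
        + ‖(∫ x, f x ∂(vol Γ)) + -1 * ∫ x, g x ∂(vol Γ)‖ :=
      (norm_sub_le _ _).trans (add_le_add_left (norm_add_le _ _) _)
    _ < ε := by linarith

lemma mem_equiSpace_conj (h : Mem (equiSpace Γ) F) :
    Mem (equiSpace Γ) (fun x => (starRingEnd ℂ) (F x)) := by
  obtain ⟨hc, ht⟩ := mem_equiSpace.1 h
  refine mem_equiSpace.2 ⟨Complex.continuous_conj.comp hc, fun y => ?_⟩
  rw [integral_conj, funext (arcAvg_conj F y)]
  exact (Complex.continuous_conj.tendsto _).comp (ht y)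

lemma mem_equiSpace_const (c : ℂ) : Mem (equiSpace Γ) (fun _ => c) :=
  mem_equiSpace.2 ⟨continuous_const, fun y => by
    rw [funext (arcAvg_const c y)]
    simp⟩

lemma tendsto_exp_neg_mul_affine (a b : ℝ) :
    Tendsto (fun ξ : ℝ => Real.exp (-ξ) * (a + b * ξ)) atTop (𝓝 0) := by
  have h1 := Real.tendsto_exp_neg_atTop_nhds_zero.mul_const a
  have h2 := (Real.tendsto_pow_mul_exp_neg_atTop_nhds_zero 1).const_mul b
  have := h1.add h2
  rw [zero_mul, mul_zero, add_zero] at this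
  refine this.congr fun ξ => ?_
  ring

lemma mem_equiSpace_derivU (hF : IsCn 1 F) : Mem (equiSpace Γ) (derivU F) := by
  obtain ⟨C, hC0, hC⟩ := exists_norm_le hF.continuous
  refine mem_equiSpace.2 ⟨continuous_derivU hF, fun y => ?_⟩
  rw [integral_derivU hF]
  refine squeeze_zero_norm (fun ξ => ?_) (tendsto_exp_neg_mul_affine (2 * C) 0)
  rw [arcAvg_derivU hF, norm_mul, Complex.norm_real, Real.norm_of_nonneg (Real.exp_pos _).le]
  refine mul_le_mul_of_nonneg_left ?_ (Real.exp_pos _).le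
  refine (norm_sub_le _ _).trans ((add_le_add (hC _) (hC _)).trans_eq (by ring))

lemma mem_equiSpace_derivX (hF : IsEigen 0 F) : Mem (equiSpace Γ) (derivX F) := by
  have hn := hF.isCn
  refine mem_equiSpace.2 ⟨continuous_derivX hn.one, fun y => ?_⟩
  rw [integral_derivX hn.one]
  refine squeeze_zero_norm' ?_ (tendsto_exp_neg_mul_affine (c2Norm F) (2 * c2Norm F))
  filter_upwards [eventually_ge_atTop 0] with ξ hξ
  have h : arcAvg (derivX F) y ξ = Real.exp (-ξ) * (unitInt (derivX F) y
      - ∫ η in (0 : ℝ)..ξ, gFun F y η) := by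
    rw [← arcAvg_derivX hF, ← mul_assoc, ← Complex.ofReal_mul, ← Real.exp_add, neg_add_cancel,
      Real.exp_zero, Complex.ofReal_one, one_mul]
  rw [h, norm_mul, Complex.norm_real, Real.norm_of_nonneg (Real.exp_pos _).le]
  refine mul_le_mul_of_nonneg_left ?_ (Real.exp_pos _).le
  exact (norm_sub_le _ _).trans (add_le_add (norm_unitInt_le (norm_derivX_le hn) y)
    (norm_integral_gFun_le hn y hξ))

/-- By `lower_eq`, (n/2)F = XF - iUF - lower F, and the averages of XF and UF are already known to
converge. -/
lemma mem_equiSpace_of_lower {n : ℤ} (hn : n ≠ 0) (hF : IsEigen 0 F) (hw : IsWeight n F)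
    (hl : Mem (equiSpace Γ) (lower F)) : Mem (equiSpace Γ) F := by
  have h := (((mem_equiSpace_derivX hF).add ((mem_equiSpace_derivU hF.isCn.one).const_mul
    (-Complex.I))).add (hl.const_mul (-1))).const_mul (2 / n)
  have e : (fun x => 2 / (n : ℂ) * (derivX F x + -Complex.I * derivU F x + -1 * lower F x)) = F :=
    funext fun x => by
      have : (n : ℂ) ≠ 0 := by exact_mod_cast hn
      rw [lower_eq hF.isCn.one hw]
      field_simp
      ring
  rwa [e] at h

/-- The averages of the harmonic eigenfunctions converge to their mean. -/
lemma mem_equiSpace_of_isEigen (hf : IsEigen 0 f) : Mem (equiSpace Γ) f := by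
  refine mem_of_isEigen isClosed_equiSpace (fun F => mem_equiSpace_conj)
    (fun n hn F hF hw => ?_) (fun n hn F hF hw hl => mem_equiSpace_of_lower (by omega) hF hw hl) hf
  interval_cases n
  -- In weight 0 the energy factor vanishes for F and for its conjugate. Together these give XF =
  -- iUF and XF = -iUF, hence UF = VF = 0 and F is constant.
  · have h1 := fun x => lower_eq_zero hF hw (by norm_num) x
    have h2 := fun x => lower_eq_zero hF.conj hw.conj (by norm_num) x
    have hU : ∀ x, derivU F x = 0 := fun x => by
      have e1 := h1 x
      have e2 := h2 x
      rw [lower_eq hF.isCn.one hw] at e1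
      rw [lower_eq hF.isCn.conj.one hw.conj] at e2
      have fX : derivX (fun x => (starRingEnd ℂ) (F x)) x = (starRingEnd ℂ) (derivX F x) :=
        flowDeriv_conj geo F x
      have fU : derivU (fun x => (starRingEnd ℂ) (F x)) x = (starRingEnd ℂ) (derivU F x) :=
        flowDeriv_conj horo F x
      rw [fX, fU] at e2
      have e3 := congrArg (starRingEnd ℂ) e2
      simp at e1 e3
      linear_combination (Complex.I / 2) * (e1 - e3) + derivU F x * Complex.I_sq
    have hV : ∀ x, derivV F x = 0 := fun x => by
      rw [hw.deriv hF.isCn.one, hU]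
      simp
    rw [funext (eq_const_of_derivU_derivV hF.isCn.one hU hV)]
    exact mem_equiSpace_const _
  -- In weight 1 the energy factor is -1/4, so F = 0.
  · rw [funext (eq_zero_of_neg hF hw (by norm_num))]
    exact mem_equiSpace_const _
  -- In weight 2 the energy factor is 0, so lower F = 0.
  · refine mem_equiSpace_of_lower two_ne_zero hF hw ?_
    rw [funext (lower_eq_zero hF hw (by norm_num))]
    exact mem_equiSpace_const _

end Equidistribution

/-! ### The estimate for the eigenvalue zero. -/

section HarmonicAverages

variable {f : HomSpace Γ → ℂ} [DiscreteTopology Γ] [CompactSpace (HomSpace Γ)]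

lemma norm_arcAvg_harmonic_le (hf : IsEigen 0 f) (hmean : ∫ x, f x ∂(vol Γ) = 0)
    (y : HomSpace Γ) {ξ : ℝ} (hξ : 0 ≤ ξ) :
    ‖arcAvg f y ξ + Real.exp (-ξ) * ∫ η in (0 : ℝ)..ξ, gFun f y η‖
      ≤ 3 * Real.exp (-ξ) * c2Norm f := by
  have hn := hf.isCn
  set N := c2Norm f
  have hi : IntegrableOn (fun η => Real.exp (-η) • gFun f y η) (Ioi 0) :=
    integrableOn_smul_gFun hn y (by simpa using integrableOn_exp_neg_mul one_pos)
  have hi' : IntegrableOn (fun η => Real.exp (-η)) (Ioi ξ) := integrableOn_exp_neg_Ioi ξ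
  -- The limit of `arcAvg_harmonic` as ξ tends to infinity: the average tends to the mean, which is
  -- zero, so the non-decaying terms add up to zero.
  have hlim : unitInt f y - unitInt (derivX f) y
      + ∫ η in Ioi (0 : ℝ), Real.exp (-η) • gFun f y η = 0 := by
    have h1 := (mem_equiSpace.1 (mem_equiSpace_of_isEigen hf)).2 y
    rw [hmean] at h1
    have h2 := intervalIntegral_tendsto_integral_Ioi 0 hi tendsto_id
    have h3 : Tendsto (fun ξ : ℝ => Real.exp (-ξ) * unitInt (derivX f) y) atTop (𝓝 0) := by
      refine squeeze_zero_norm (fun ξ => ?_) (tendsto_exp_neg_mul_affine N 0)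
      rw [norm_mul, Complex.norm_real, Real.norm_of_nonneg (Real.exp_pos _).le]
      refine mul_le_mul_of_nonneg_left ?_ (Real.exp_pos _).le
      simpa using norm_unitInt_le (norm_derivX_le hn) y
    have h4 : Tendsto (fun ξ : ℝ => Real.exp (-ξ) * ∫ η in (0 : ℝ)..ξ, gFun f y η) atTop
        (𝓝 0) := by
      refine squeeze_zero_norm' ?_ (tendsto_exp_neg_mul_affine 0 (2 * N))
      filter_upwards [eventually_ge_atTop 0] with ξ hξ
      rw [norm_mul, Complex.norm_real, Real.norm_of_nonneg (Real.exp_pos _).le, zero_add]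
      exact mul_le_mul_of_nonneg_left (norm_integral_gFun_le hn y hξ) (Real.exp_pos _).le
    have h5 := (((tendsto_const_nhds (x := unitInt f y - unitInt (derivX f) y)).add h3).add
      h2).sub h4
    rw [add_zero, sub_zero] at h5
    exact tendsto_nhds_unique (h5.congr fun ξ => (arcAvg_harmonic hf y ξ).symm) h1
  have hsplit := intervalIntegral.integral_Ioi_sub_Ioi hi hξ
  have hbound := norm_setIntegral_smul_gFun_le hn y measurableSet_Ioi hi'
    (k := fun η => Real.exp (-η)) fun η _ => (abs_of_pos (Real.exp_pos _)).le
  rw [integral_exp_neg_Ioi] at hbound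
  -- By `hlim` the finite integral can be traded for minus its tail. The two remaining terms are
  -- bounded by 1 and 2 times e^{-ξ}‖f‖, whence the constant 3.
  have e : arcAvg f y ξ + Real.exp (-ξ) * ∫ η in (0 : ℝ)..ξ, gFun f y η
      = Real.exp (-ξ) * unitInt (derivX f) y
        - ∫ η in Ioi ξ, Real.exp (-η) • gFun f y η := by
    rw [arcAvg_harmonic hf, ← hsplit]
    linear_combination hlim
  rw [e]
  refine (norm_sub_le _ _).trans ((add_le_add ?_ hbound).trans_eq
    (show Real.exp (-ξ) * N + _ = _ by ring))
  rw [norm_mul, Complex.norm_real, Real.norm_of_nonneg (Real.exp_pos _).le]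
  exact mul_le_mul_of_nonneg_left (norm_unitInt_le (norm_derivX_le hn) y) (Real.exp_pos _).le

lemma norm_horoAverage_harmonic_le (hf : IsEigen 0 f) (hmean : ∫ x, f x ∂(vol Γ) = 0)
    (x : HomSpace Γ) {T : ℝ} (hT : 1 ≤ T) :
    ‖horoAverage f x T - (1 / T) • ∫ ξ in (0 : ℝ)..Real.log T,
      (derivV f (geo ξ (horo T x)) - derivV f (geo ξ x))‖ ≤ 3 / T * c2Norm f := by
  have hT0 : 0 < T := one_pos.trans_le hT
  have h := norm_arcAvg_harmonic_le hf hmean (geo (Real.log T) x) (Real.log_nonneg hT)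
  have hE : Real.exp (-Real.log T) = 1 / T := by rw [Real.exp_neg, Real.exp_log hT0, one_div]
  have hI : ∫ η in (0 : ℝ)..Real.log T, gFun f (geo (Real.log T) x) η
      = -∫ ξ in (0 : ℝ)..Real.log T, (derivV f (geo ξ (horo T x)) - derivV f (geo ξ x)) := by
    have h1 := intervalIntegral.integral_comp_sub_left (a := 0) (b := Real.log T)
      (fun ξ => derivV f (geo ξ (horo T x)) - derivV f (geo ξ x)) (Real.log T)
    rw [sub_self, sub_zero] at h1
    rw [← h1, ← intervalIntegral.integral_neg]
    refine intervalIntegral.integral_congr fun η _ => ?_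
    simp only [gFun, horo_geo, geo_geo, mul_one, Real.exp_log hT0, sub_eq_add_neg]
    ring
  rw [hI, hE] at h
  rw [horoAverage_eq_arcAvg f x hT0, Complex.real_smul, sub_eq_add_neg, ← mul_neg]
  refine h.trans_eq ?_
  ring

end HarmonicAverages

end HorocycleFlow

/-! ### Assembly of the five spectral cases with ξ = log T. -/

theorem mainTheorem1 (Γ : Subgroup SL2R) [DiscreteTopology Γ] [CompactSpace (HomSpace Γ)]
    (f : HomSpace Γ → ℂ) (hf : IsC2 f) (μ : ℝ)
    (heig : ∀ x, casimir f x = (μ : ℂ) * f x)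
    (hmean : ∫ x, f x ∂(vol Γ) = 0)
    (ν : ℂ) (hν : (ν.im = 0 ∧ 0 ≤ ν.re) ∨ (ν.re = 0 ∧ 0 < ν.im))
    (hμν : (1 - ν ^ 2) / 4 = (μ : ℂ)) :
    -- (i)
    (1 / 4 < μ →
      IsHolder (1 / 2) (princPlus ν.im f) ∧ IsHolder (1 / 2) (princMinus ν.im f) ∧
      (∀ x, ‖princPlus ν.im f x‖ ≤ (11 / ν.im + 1) * c2Norm f) ∧
      (∀ x, ‖princMinus ν.im f x‖ ≤ (11 / ν.im + 1) * c2Norm f) ∧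
      ∀ (x : HomSpace Γ) (T : ℝ), 1 ≤ T →
        ‖horoAverage f x T -
            ((T ^ (-(1 / 2) : ℝ) * Real.cos (ν.im / 2 * Real.log T)) •
                princPlus ν.im f (geo (Real.log T) x) +
              (T ^ (-(1 / 2) : ℝ) * Real.sin (ν.im / 2 * Real.log T)) •
                princMinus ν.im f (geo (Real.log T) x))‖
          ≤ 16 / ν.im * c2Norm f * T⁻¹ ∧
        ‖horoAverage f x T‖ ≤ 15 * (Real.log T + 1) / Real.sqrt T * c2Norm f) ∧
    -- (ii)
    (μ = 1 / 4 →
      (∀ ε : ℝ, 0 < ε → ε < 1 / 2 → IsHolder (1 / 2 - ε) (quarterPlus f)) ∧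
      IsHolder (1 / 2) (quarterMinus f) ∧
      (∀ x, ‖quarterPlus f x‖ ≤ 9 * c2Norm f) ∧
      (∀ x, ‖quarterMinus f x‖ ≤ 9 * c2Norm f) ∧
      ∀ (x : HomSpace Γ) (T : ℝ), 1 ≤ T →
        ‖horoAverage f x T -
            (T ^ (-(1 / 2) : ℝ) • quarterPlus f (geo (Real.log T) x) +
              (T ^ (-(1 / 2) : ℝ) * Real.log T) • quarterMinus f (geo (Real.log T) x))‖
          ≤ 8 * ((Real.log T + 2) / T) * c2Norm f) ∧
    -- (iii)
    (0 < μ → μ < 1 / 4 →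
      IsHolder ((1 - ν.re) / 2) (compPlus ν.re f) ∧
      IsHolder ((1 + ν.re) / 2) (compMinus ν.re f) ∧
      (∀ x, ‖compPlus ν.re f x‖ ≤ 6 / (ν.re * (1 - ν.re)) * c2Norm f) ∧
      (∀ x, ‖compMinus ν.re f x‖ ≤ 6 / (ν.re * (1 - ν.re)) * c2Norm f) ∧
      ∀ (x : HomSpace Γ) (T : ℝ), 1 ≤ T →
        ‖horoAverage f x T -
            (T ^ (-((1 + ν.re) / 2)) • compPlus ν.re f (geo (Real.log T) x) +
              T ^ (-((1 - ν.re) / 2)) • compMinus ν.re f (geo (Real.log T) x))‖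
          ≤ 8 / ((1 - ν.re ^ 2) * ν.re) * c2Norm f * T⁻¹ ∧
        ‖horoAverage f x T‖ ≤
          15 / (1 - ν.re) ^ 2 * c2Norm f * (Real.log T + 1) * T ^ (-((1 - ν.re) / 2))) ∧
    -- (iv)
    (μ = 0 →
      ∀ (x : HomSpace Γ) (T : ℝ), 1 ≤ T →
        ‖horoAverage f x T -
            (1 / T) • ∫ ξ in (0 : ℝ)..Real.log T,
              (derivV f (geo ξ (horo T x)) - derivV f (geo ξ x))‖
          ≤ 3 / T * c2Norm f) ∧
    -- (v)
    (μ < 0 →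
      (∀ (x : HomSpace Γ) (T : ℝ), 1 ≤ T → ‖horoAverage f x T‖ ≤ 5 / T * c2Norm f) ∧
      ∃ u : HomSpace Γ → ℂ, Continuous u ∧
        ∀ x, HasDerivAt (fun t => u (horo t x)) (f x) 0) := by
  have hn : IsCn 2 f := isC2_iff.1 hf
  have hN := c2Norm_nonneg hn
  have hE : IsEigen μ f := ⟨hn, heig⟩
  have hμ : μ = (1 - (ν.re ^ 2 - ν.im ^ 2)) / 4 := by
    have h : (1 - ν ^ 2) = ((4 * μ : ℝ) : ℂ) := by
      push_cast
      linear_combination 4 * hμν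
    have h := congrArg Complex.re h
    simp only [pow_two, Complex.sub_re, Complex.one_re, Complex.mul_re, Complex.ofReal_re] at h
    linarith
  refine ⟨fun h => ?_, fun h => ?_, fun h0 h1 => ?_, fun h => ?_, fun h => ⟨fun x T hT =>
    norm_horoAverage_le_of_neg hE h x (one_pos.trans_le hT), ?_⟩⟩
  · have hy : 0 < ν.im := by
      rcases hν with ⟨h1, -⟩ | ⟨-, h1⟩
      · rw [h1] at hμ
        nlinarith [sq_nonneg ν.re]
      · exact h1
    have hre : ν.re = 0 := by
      rcases hν with ⟨h1, -⟩ | ⟨h1, -⟩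
      · exact absurd h1 hy.ne'
      · exact h1
    have he : ∀ x, casimir f x = (((1 + ν.im ^ 2) / 4 : ℝ) : ℂ) * f x := fun x => by
      rw [heig, hμ, hre]
      congr 2
      ring
    refine ⟨isHolder_princPlus hn _, isHolder_princMinus hn _, norm_princPlus_le hn hy,
      norm_princMinus_le hn hy, fun x T hT => ?_⟩
    have hξ := Real.log_nonneg hT
    have e1 := princ_expansion hn hy he (geo (Real.log T) x) hξ
    have e2 := princ_bound hn hy he (geo (Real.log T) x) hξ
    have hT' : T ^ (-(1 / 2) : ℝ) = Real.exp (-Real.log T / 2) := by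
      rw [rpow_eq_exp_log hT]
      congr 1
      ring
    have hs : (Real.sqrt T)⁻¹ = Real.exp (-(1 / 2) * Real.log T) := by
      rw [Real.sqrt_eq_rpow, ← Real.rpow_neg (by linarith), rpow_eq_exp_log hT]
    rw [horoAverage_eq_arcAvg f x (by linarith), hT', inv_eq_exp_log hT, div_eq_mul_inv _ (Real.sqrt T), hs]
    exact ⟨e1, e2⟩
  · refine ⟨fun ε => isHolder_quarterPlus hn, isHolder_quarterMinus hn, norm_quarterPlus_le hn,
      norm_quarterMinus_le hn, fun x T hT => ?_⟩
    have hξ := Real.log_nonneg hT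
    have e1 := quarter_expansion hn (fun x => by rw [heig, h]) (geo (Real.log T) x) hξ
    have hT' : T ^ (-(1 / 2) : ℝ) = Real.exp (-Real.log T / 2) := by
      rw [rpow_eq_exp_log hT]
      congr 1
      ring
    rw [horoAverage_eq_arcAvg f x (by linarith), hT', div_eq_mul_inv _ T, inv_eq_exp_log hT]
    refine e1.trans ?_
    have := mul_nonneg hN (Real.exp_pos (-Real.log T)).le
    nlinarith
  · have him : ν.im = 0 := by
      rcases hν with ⟨h2, -⟩ | ⟨h2, h3⟩
      · exact h2
      · rw [h2] at hμ
        nlinarith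
    have hre : 0 ≤ ν.re := by
      rcases hν with ⟨-, h2⟩ | ⟨h2, -⟩
      · exact h2
      · exact h2.ge
    rw [him] at hμ
    have hn0 : 0 < ν.re := lt_of_le_of_ne hre fun h2 => by
      rw [← h2] at hμ
      linarith
    have hn1 : ν.re < 1 := by nlinarith
    have he : ∀ x, casimir f x = (((1 - ν.re ^ 2) / 4 : ℝ) : ℂ) * f x := fun x => by
      rw [heig, hμ]
      congr 2
      ring
    refine ⟨isHolder_compPlus hn hn0 hn1, isHolder_compMinus hn hn0 hn1,
      norm_compPlus_le hn hn0 hn1, norm_compMinus_le hn hn0 hn1, fun x T hT => ?_⟩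
    have hξ := Real.log_nonneg hT
    have e1 := comp_expansion hn hn0 hn1 he (geo (Real.log T) x) hξ
    have e2 := comp_bound hn hn0 he (geo (Real.log T) x) hξ
    rw [horoAverage_eq_arcAvg f x (by linarith), inv_eq_exp_log hT, rpow_eq_exp_log hT,
      rpow_eq_exp_log hT]
    refine ⟨e1, e2.trans ?_⟩
    -- `comp_bound` has the constant 15 without a denominator; the stated bound is weaker because 0
    -- < 1 - ν < 1.
    have h15 : (15 : ℝ) ≤ 15 / (1 - ν.re) ^ 2 := by
      rw [le_div_iff₀ (by nlinarith)]
      nlinarith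
    have hp : 0 ≤ (Real.log T + 1) * Real.exp (-((1 - ν.re) / 2) * Real.log T) * c2Norm f := by
      positivity
    nlinarith [mul_le_mul_of_nonneg_right h15 hp]
  · intro x T hT
    subst h
    exact norm_horoAverage_harmonic_le hE hmean x hT
  · obtain ⟨u, hu, -, hd⟩ := exists_coboundary hE h
    exact ⟨u, hu, hd⟩
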